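/- Conventions. Let $V \subset \mathbb{R}^d$ be open. A Finsler metric on $V$ is a function $F : V \times \mathbb{R}^d \to [0,\infty)$ with $F(x,tv) = tF(x,v)$ for $t \ge 0$, smooth on $V \times (\mathbb{R}^d \setminus \{0\})$, such that the matrix $g_{ij}(x,v) = \frac12 \frac{\partial^2 F^2}{\partial v^i \partial v^j}(x,v)$ is positive definite for all $x \in V$ and $v \ne 0$. The dual metric is $F_*(x,\xi) = \sup\{\xi\cdot v : F(x,v)=1\}$, the Legendre transform is $(\mathcal{L}_x v)_i = \sum_j g_{ij}(x,v)v^j$, and the cosphere at $x$ is $S_x^* = \{\xi \in \mathbb{R}^d : F_*(x,\xi)=1\}$. A (constant speed, forward) geodesic is a solution of $\ddot c^a = -\sum_{j,k}\gamma^a_{jk}(c,\dot c)\,\dot c^j\dot c^k$, with $\gamma^a_{jk} = \sum_i \frac{g^{ai}}{2}(\partial_{x_k}g_{ij}+\partial_{x_j}g_{ik}-\partial_{x_i}g_{jk})$, where $(g^{ai})$ is the inverse of $(g_{ij})$. The length of a curve is $L(c) = \int F(c,\dot c)\,dt$. For an open set $U_0 \subset V$, $d^+(p,q)$ is the infimum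 of $L(c)$ over $C^1$ curves in $U_0$ from $p$ to $q$, and $d^-(p,q)=d^+(q,p)$. A geodesic from $p$ to $q$ is minimizing if its length is $d^+(p,q)$. An open set $U \subset U_0$ is geodesically convex if for all $p,q\in U$ there is a minimizing geodesic from $p$ to $q$ contained in $U$. Proposition. Let $U_0 \subset \mathbb{R}^d$ be a bounded open set and let $F$ be a Finsler metric on an open set $V$ containing the closure of $U_0$. Then there are constants $K, r, C > 0$ such that the following holds. Let $U \subset U_0$ be open and geodesically convex, with Euclidean diameter $\operatorname{diam} U \le r$, and let $W$ be the set of points at Euclidean distance less than $K \operatorname{diam} U$ from $U$. Let $\phi = \phi(x,y,\xi)$ be a real-valued function, smooth for $x \in W$, $y \in U$, $\xi \in \mathbb{R}^d\setminus\{0\}$, that solves the eikonal equation $$F_*(x,\nabla_x\phi(x,y,\xi)) = F_*(y,\xi),$$ satisfies $\phi(x,y,\xi)=0$ for all $x \in W$ with $\xi\cdot(x-y)=0$, and is oriented so that $\nabla_x\phi(x,y,\xi)=\xi$ at $x=y$. Let $x_0 \neq x_1$ be points of $U$, and define $\Psi : S_{x_0}^* \to \mathbb{R}$ by $\Psi(\xi)=\phi(x_1,x_0,\xi)$.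 Let $v^+$ be the unit tangent vector at $x_0$ (with $F(x_0,v^+)=1$) of a minimizing geodesic in $U$ from $x_0$ to $x_1$, let $v^-$ be the unit tangent vector at $x_0$ of a minimizing geodesic in $U$ from $x_1$ to $x_0$, and put $\xi^\pm = \mathcal{L}_{x_0}v^\pm$. Then: 1. $\xi^+\ne\xi^-$, and $\Psi$ has exactly two critical points on $S_{x_0}^*$, namely $\xi^+$ and $\xi^-$; 2. $\Psi(\xi^+) = d^+(x_0,x_1)$ and $\Psi(\xi^-) = -d^-(x_0,x_1)$; 3. the Hessians $H_\pm$ of $\Psi$ at $\xi^\pm$, viewed as quadratic forms on $T_{\xi^\pm}S_{x_0}^*$, satisfy $$H_+(\zeta) \le -C\,d^+(x_0,x_1)\,|\zeta|^2 \quad\text{and}\quad H_-(\zeta)\ge C\,d^-(x_0,x_1)\,|\zeta|^2 .$$ In particular both critical points are nondegenerate, with Hessian eigenvalues of magnitude at least $C\,d^\pm(x_0,x_1)$; the constant $C$ does not depend on $U$, $\phi$, $x_0$ or $x_1$. -/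

import Mathlib

open Set Filter Topology
open scoped ContDiff

noncomputable section

namespace Finsler

/-- Points, tangent vectors and covectors in coordinates; a covector `ξ` acts on a vector `v` by
the dot product `inner ℝ ξ v`. -/
abbrev Sp (d : ℕ) := EuclideanSpace ℝ (Fin d)

variable {d : ℕ}

/-- The partial derivative `∂f/∂x_i` at `x`. -/
def pd (f : Sp d → ℝ) (i : Fin d) (x : Sp d) : ℝ :=
  fderiv ℝ f x (EuclideanSpace.single i 1)

/-- `g_ij(x,v) = (1/2) ∂²F²/∂v^i∂v^j (x,v)`. -/
def metricCoeff (F : Sp d → Sp d → ℝ) (x v : Sp d) : Matrix (Fin d) (Fin d) ℝ :=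
  Matrix.of fun i j => (1 / 2) * pd (fun u => pd (fun w => F x w ^ 2) j u) i v

/-- `F` is a (not necessarily reversible) Finsler metric over the open set `V`. -/
structure IsFinsler (V : Set (Sp d)) (F : Sp d → Sp d → ℝ) : Prop where
  nonneg : ∀ x ∈ V, ∀ v, 0 ≤ F x v
  homogeneous : ∀ x ∈ V, ∀ v, ∀ t : ℝ, 0 ≤ t → F x (t • v) = t * F x v
  smooth : ContDiffOn ℝ ∞ (fun z : Sp d × Sp d => F z.1 z.2) (V ×ˢ {0}ᶜ)
  posDef : ∀ x ∈ V, ∀ v, v ≠ 0 → (metricCoeff F x v).PosDef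

/-- The dual metric `F_*(x,ξ) = sup {ξ(v) : F(x,v) = 1}`. -/
def dual (F : Sp d → Sp d → ℝ) (x ξ : Sp d) : ℝ :=
  sSup {s : ℝ | ∃ v : Sp d, F x v = 1 ∧ s = inner ℝ ξ v}

/-- The Legendre transform `(ℒ_x v)_i = ∑_j g_ij(x,v) v^j`. -/
def legendre (F : Sp d → Sp d → ℝ) (x v : Sp d) : Sp d :=
  WithLp.toLp 2 fun i => ∑ j, metricCoeff F x v i j * v j

/-- The formal Christoffel symbols
`γ^a_jk = ∑_i (g^{ai}/2) (∂_{x_k} g_ij + ∂_{x_j} g_ik - ∂_{x_i} g_jk)`. -/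
def christoffel (F : Sp d → Sp d → ℝ) (x v : Sp d) (a j k : Fin d) : ℝ :=
  ∑ i, (metricCoeff F x v)⁻¹ a i / 2 *
    (pd (fun z => metricCoeff F z v i j) k x + pd (fun z => metricCoeff F z v i k) j x
      - pd (fun z => metricCoeff F z v j k) i x)

/-- The velocity of a curve parametrized by `[0,1]` (one-sided at the end points). -/
def velocity (c : ℝ → Sp d) (t : ℝ) : Sp d := derivWithin c (Icc 0 1) t

/-- The length `∫ F(c, c') dt` of a curve parametrized by `[0,1]`. -/
def length (F : Sp d → Sp d → ℝ) (c : ℝ → Sp d) : ℝ :=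
  ∫ t in (0 : ℝ)..1, F (c t) (velocity c t)

/-- `c : [0,1] → S` is a `C¹` curve from `p` to `q`. -/
structure IsPath (S : Set (Sp d)) (p q : Sp d) (c : ℝ → Sp d) : Prop where
  contDiff : ContDiffOn ℝ 1 c (Icc 0 1)
  mapsTo : MapsTo c (Icc 0 1) S
  source : c 0 = p
  target : c 1 = q

/-- The forward distance `d_+(p,q)` in `S`: the infimum of the lengths of curves in `S` from `p`
to `q`. -/
def dPlus (F : Sp d → Sp d → ℝ) (S : Set (Sp d)) (p q : Sp d) : ℝ :=
  sInf {l : ℝ | ∃ c, IsPath S p q c ∧ l = length F c}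

/-- The backward distance `d_-(p,q) = d_+(q,p)`. -/
def dMinus (F : Sp d → Sp d → ℝ) (S : Set (Sp d)) (p q : Sp d) : ℝ := dPlus F S q p

/-- `c : [0,1] → ℝ^d` is a constant speed forward geodesic. -/
structure IsGeodesic (F : Sp d → Sp d → ℝ) (c : ℝ → Sp d) : Prop where
  contDiff : ContDiffOn ℝ 2 c (Icc 0 1)
  equation : ∀ t ∈ Icc (0 : ℝ) 1, ∀ a : Fin d,
    derivWithin (velocity c) (Icc 0 1) t a =
      -∑ j, ∑ k, christoffel F (c t) (velocity c t) a j k * velocity c t j * velocity c t k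

/-- `c` is a forward geodesic from `p` to `q`, contained in `U`, whose length is the forward
distance from `p` to `q` in `U₀`. -/
structure IsMinimizingGeodesic (F : Sp d → Sp d → ℝ) (U₀ U : Set (Sp d)) (p q : Sp d)
    (c : ℝ → Sp d) : Prop where
  geodesic : IsGeodesic F c
  path : IsPath U p q c
  minimizing : length F c = dPlus F U₀ p q

/-- Any two points of `U` are joined, in either direction, by a minimizing geodesic in `U`. -/
def GeodesicallyConvex (F : Sp d → Sp d → ℝ) (U₀ U : Set (Sp d)) : Prop :=
  ∀ p ∈ U, ∀ q ∈ U, ∃ c, IsMinimizingGeodesic F U₀ U p q c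

/-- The direction of `v`, normalized to have `F(x,·)`-length one. -/
def unit (F : Sp d → Sp d → ℝ) (x v : Sp d) : Sp d := (F x v)⁻¹ • v

/-- `φ(x,y,ξ)`, for `x ∈ W`, `y ∈ U` and `ξ ≠ 0`, is a smooth solution of the eikonal equation
`F_*(x, ∇_x φ) = F_*(y,ξ)` which vanishes on the hyperplane through `y` conormal to `ξ`, with
the orientation `∇_x φ = ξ` at `x = y`. -/
structure IsEikonalPhase (F : Sp d → Sp d → ℝ) (W U : Set (Sp d))
    (φ : Sp d → Sp d → Sp d → ℝ) : Prop where
  smooth : ContDiffOn ℝ ∞ (fun z : Sp d × Sp d × Sp d => φ z.1 z.2.1 z.2.2) (W ×ˢ U ×ˢ {0}ᶜ)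
  eikonal : ∀ x ∈ W, ∀ y ∈ U, ∀ ξ, ξ ≠ 0 →
    dual F x (gradient (fun z => φ z y ξ) x) = dual F y ξ
  vanishing : ∀ x ∈ W, ∀ y ∈ U, ∀ ξ, ξ ≠ 0 → inner ℝ ξ (x - y) = 0 → φ x y ξ = 0
  orientation : ∀ y ∈ U, ∀ ξ, ξ ≠ 0 → gradient (fun z => φ z y ξ) y = ξ

/-- The cosphere `S_x^* = {ξ : F_*(x,ξ) = 1}`. -/
def cosphere (F : Sp d → Sp d → ℝ) (x : Sp d) : Set (Sp d) := {ξ | dual F x ξ = 1}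

/-- The tangent space of the cosphere `S_x^*` at `ξ`, the kernel of the differential of
`F_*(x,·)` at `ξ`. -/
def cosphereTangent (F : Sp d → Sp d → ℝ) (x ξ : Sp d) : Submodule ℝ (Sp d) :=
  LinearMap.ker (fderiv ℝ (dual F x) ξ : Sp d →ₗ[ℝ] ℝ)

/-- `η` is a smooth curve in the hypersurface `S`, defined near parameter `0`, passing through
`ξ` with velocity `ζ` at parameter `0`. -/
structure IsCurveThrough (S : Set (Sp d)) (ξ ζ : Sp d) (η : ℝ → Sp d) : Prop where
  smooth : ContDiffAt ℝ ∞ η 0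
  mem : ∀ᶠ a in 𝓝 (0 : ℝ), η a ∈ S
  base : η 0 = ξ
  vel : HasDerivAt η ζ 0

/-- `ξ ∈ S` is a critical point of the function `Ψ` on the hypersurface `S`. -/
def IsCritical (S : Set (Sp d)) (Ψ : Sp d → ℝ) (ξ : Sp d) : Prop :=
  ξ ∈ S ∧ ∀ ζ η, IsCurveThrough S ξ ζ η → HasDerivAt (fun a => Ψ (η a)) 0 0

/-- `H` is the Hessian at `ξ` of the function `Ψ` on the hypersurface `S` with tangent space `T`
at `ξ`, for a critical point `ξ`: the second derivative of `Ψ` along any curve in `S` through `ξ`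
with velocity `ζ` is `H ζ`. -/
def IsHessian (S : Set (Sp d)) (Ψ : Sp d → ℝ) (ξ : Sp d) (T : Submodule ℝ (Sp d))
    (H : QuadraticForm ℝ T) : Prop :=
  ∀ (ζ : T) (η : ℝ → Sp d), IsCurveThrough S ξ ζ η →
    iteratedDeriv 2 (fun a => Ψ (η a)) 0 = H ζ

end Finsler

end

/-!
Write `u = φ(·, y, ξ)` with `F_*(y, ξ) = 1`. The characteristics of the eikonal equation
`F_*(x, ∇u) = 1`, the integral curves of the inverse Legendre transform of `∇u`, are unit speed
geodesics, so a geodesic through `y` whose unit tangent vector there is dual to `ξ` is one of them.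
Along a characteristic `u` grows at unit rate, and along any other curve it grows by at most the
length; hence two characteristics with the same end points, even of different phases, have the same
covector at `y`.

By finite speed of propagation every `x` near `y` lies on a characteristic of `u` starting on the
hyperplane `ξ · (z - y) = 0`. The derivative of `φ(x, y, ·)` along the cosphere is constant along
it, and on the hyperplane it is determined by the vanishing of `φ` there; so `ξ` is a critical point
of `φ(x, y, ·)` exactly when that characteristic starts at `y`. This leaves the forward and the
reversed geodesic between `y` and `x`.

For the Hessian, let `Φ(x, a) = φ(x, y, η(a))` for a curve `η` in the cosphere with `η(0) = ξ` and
velocity `ζ`. Differentiating the eikonal equation twice in `a` shows that `∂ₐ²Φ` decreases along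
the characteristic at the rate `D_ξ²H(∇∂ₐΦ, ∇∂ₐΦ)`, where `H = F_*² / 2` and `∇∂ₐΦ = ζ` at `y`. The
Riccati equation for the Hessian of `u` keeps `∇∂ₐΦ` close to `ζ` over short times, and the
convexity of `H` then bounds this rate from below by a multiple of `|ζ|²`.
-/

noncomputable section

namespace Finsler

variable {d : ℕ}

section PartialGradients

variable {A C E G : Type*} [NormedAddCommGroup A] [NormedSpace ℝ A] [NormedAddCommGroup C]
  [NormedSpace ℝ C] [NormedAddCommGroup E] [InnerProductSpace ℝ E] [CompleteSpace E]
  [NormedAddCommGroup G] [NormedSpace ℝ G]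

theorem two_le_infty : (2 : WithTop ℕ∞) ≤ ∞ :=
  WithTop.coe_le_coe.2 (le_top : (2 : ℕ∞) ≤ ⊤)

theorem fderiv_fderiv_comm {f : A → G} {z : A} (hf : ContDiffAt ℝ 2 f z) (u w : A) :
    fderiv ℝ (fderiv ℝ f) z u w = fderiv ℝ (fderiv ℝ f) z w u :=
  (hf.isSymmSndFDerivAt minSmoothness_of_isRCLikeNormedField.le).eq u w

theorem differentiableAt_fderiv {f : A → G} {z : A} (hf : ContDiffAt ℝ 2 f z) :
    DifferentiableAt ℝ (fderiv ℝ f) z :=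
  (hf.fderiv_right (m := 1) one_add_one_eq_two.le).differentiableAt one_ne_zero

theorem fderiv_apply_self_of_homogeneous {f : A → G} {x : A} {n : ℕ} (hf : DifferentiableAt ℝ f x)
    (h : ∀ t : ℝ, 0 < t → f (t • x) = t ^ n • f x) : fderiv ℝ f x x = (n : ℝ) • f x := by
  have hray : HasDerivAt (fun t : ℝ => t • x) x 1 := by
    simpa using (hasDerivAt_id (1 : ℝ)).smul_const x
  have hleft : HasDerivAt (fun t : ℝ => f (t • x)) (fderiv ℝ f x x) 1 :=
    hf.hasFDerivAt.comp_hasDerivAt_of_eq 1 hray (one_smul ℝ x).symm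
  have hright : HasDerivAt (fun t : ℝ => t ^ n • f x) ((n : ℝ) • f x) 1 := by
    simpa using (hasDerivAt_pow n (1 : ℝ)).smul_const (f x)
  refine hleft.unique (hright.congr_of_eventuallyEq ?_)
  filter_upwards [lt_mem_nhds one_pos] with t ht using h t ht

theorem hasFDerivAt_comp_prodMk_left {f : A × C → G} {x : A} {y : C}
    (h : DifferentiableAt ℝ f (x, y)) :
    HasFDerivAt (fun w => f (w, y)) ((fderiv ℝ f (x, y)).comp (.inl ℝ A C)) x :=
  h.hasFDerivAt.comp x (hasFDerivAt_prodMk_left x y)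

theorem hasFDerivAt_comp_prodMk_right {f : A × C → G} {x : A} {y : C}
    (h : DifferentiableAt ℝ f (x, y)) :
    HasFDerivAt (fun w => f (x, w)) ((fderiv ℝ f (x, y)).comp (.inr ℝ A C)) y :=
  h.hasFDerivAt.comp y (hasFDerivAt_prodMk_right x y)

/-- The gradient of `f : G → ℝ` in the directions of the range of `L : E → G`: the vector of the
Hilbert space `E` representing the functional `df ∘ L`. Partial gradients and the usual gradient are
the cases where `L` is the inclusion of a factor or the identity. -/
def gradAlong (L : E →L[ℝ] G) (f : G → ℝ) (z : G) : E :=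
  (InnerProductSpace.toDual ℝ E).symm ((fderiv ℝ f z).comp L)

/-- The partial gradient with respect to the first variable. -/
abbrev gradFst (f : E × A → ℝ) : E × A → E := gradAlong (.inl ℝ E A) f

/-- The partial gradient with respect to the second variable. -/
abbrev gradSnd (f : A × E → ℝ) : A × E → E := gradAlong (.inr ℝ A E) f

theorem inner_gradAlong (L : E →L[ℝ] G) (f : G → ℝ) (z : G) (u : E) :
    inner ℝ (gradAlong L f z) u = fderiv ℝ f z (L u) := by
  simp [gradAlong]

theorem contDiffAt_gradAlong {m n : WithTop ℕ∞} {f : G → ℝ} {z : G} (h : ContDiffAt ℝ n f z)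
    (hmn : m + 1 ≤ n) (L : E →L[ℝ] G) : ContDiffAt ℝ m (gradAlong L f) z :=
  (LinearIsometryEquiv.contDiff _).contDiffAt.comp z
    ((h.fderiv_right hmn).clm_comp contDiffAt_const)

theorem inner_fderiv_gradAlong {f : G → ℝ} {z : G} (h : ContDiffAt ℝ 2 f z) (L : E →L[ℝ] G)
    (w : G) (u : E) :
    inner ℝ (fderiv ℝ (gradAlong L f) z w) u = fderiv ℝ (fderiv ℝ f) z w (L u) := by
  have h1 : (fun y => inner ℝ (gradAlong L f y) u) = fun y => fderiv ℝ f y (L u) :=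
    funext fun y => inner_gradAlong L f y u
  have h2 := congrArg (fun g => fderiv ℝ g z w) h1
  rw [fderiv_inner_apply ℝ ((contDiffAt_gradAlong h one_add_one_eq_two.le L).differentiableAt
    one_ne_zero) (differentiableAt_const u), fderiv_clm_apply (differentiableAt_fderiv h)
    (differentiableAt_const _)] at h2
  simpa using h2

theorem inner_gradFst (f : E × A → ℝ) (z : E × A) (u : E) :
    inner ℝ (gradFst f z) u = fderiv ℝ f z (u, 0) :=
  inner_gradAlong _ f z u

theorem inner_gradSnd (f : A × E → ℝ) (z : A × E) (u : E) :
    inner ℝ (gradSnd f z) u = fderiv ℝ f z (0, u) :=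
  inner_gradAlong _ f z u

theorem gradient_comp_prodMk_left {f : E × A → ℝ} {x : E} {y : A}
    (h : DifferentiableAt ℝ f (x, y)) : gradient (fun w => f (w, y)) x = gradFst f (x, y) := by
  rw [gradient, (hasFDerivAt_comp_prodMk_left h).fderiv, gradFst, gradAlong]

theorem gradient_eq_gradAlong (f : E → ℝ) : gradient f = gradAlong (.id ℝ E) f := rfl

theorem contDiffAt_gradient {m n : WithTop ℕ∞} {f : E → ℝ} {x : E} (h : ContDiffAt ℝ n f x)
    (hmn : m + 1 ≤ n) : ContDiffAt ℝ m (gradient f) x :=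
  gradient_eq_gradAlong f ▸ contDiffAt_gradAlong h hmn _

theorem inner_fderiv_gradient_comm {f : E → ℝ} {x : E} (h : ContDiffAt ℝ 2 f x) (a b : E) :
    inner ℝ (fderiv ℝ (gradient f) x a) b = inner ℝ (fderiv ℝ (gradient f) x b) a := by
  simp only [gradient_eq_gradAlong, inner_fderiv_gradAlong h]
  exact fderiv_fderiv_comm h a b

end PartialGradients

section Metric

variable {V : Set (Sp d)} {F : Sp d → Sp d → ℝ} {x v : Sp d}

/-- The square of the metric as a function of position and velocity. -/
def sq (F : Sp d → Sp d → ℝ) (z : Sp d × Sp d) : ℝ := F z.1 z.2 ^ 2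

/-- The Legendre transform `½ ∇_v F²` as a function of position and velocity. It agrees with
`legendre` by Euler's identity, but is visibly smooth in both variables. -/
def momentum (F : Sp d → Sp d → ℝ) (z : Sp d × Sp d) : Sp d := (1 / 2 : ℝ) • gradSnd (sq F) z

/-- The fundamental tensor `g(x,v)` as an operator on `ℝ^d`: the differential of the Legendre
transform with respect to the velocity. -/
def fundamentalTensor (F : Sp d → Sp d → ℝ) (x v : Sp d) : Sp d →L[ℝ] Sp d :=
  (fderiv ℝ (momentum F) (x, v)).comp (.inr ℝ (Sp d) (Sp d))

theorem fundamentalTensor_apply (F : Sp d → Sp d → ℝ) (x v u : Sp d) :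
    fundamentalTensor F x v u = fderiv ℝ (momentum F) (x, v) (0, u) := rfl

theorem eq_sum_single (u : Sp d) : u = ∑ i, u i • EuclideanSpace.single i (1 : ℝ) := by
  simpa using ((EuclideanSpace.basisFun (Fin d) ℝ).sum_repr u).symm

theorem fderiv_sq_snd (F : Sp d → Sp d → ℝ) (z : Sp d × Sp d) (u : Sp d) :
    fderiv ℝ (sq F) z (0, u) = 2 * inner ℝ (momentum F z) u := by
  rw [momentum, real_inner_smul_left, inner_gradSnd]; ring

namespace IsFinsler

theorem mono {W : Set (Sp d)} (hF : IsFinsler V F) (hWV : W ⊆ V) : IsFinsler W F where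
  nonneg x hx := hF.nonneg x (hWV hx)
  homogeneous x hx := hF.homogeneous x (hWV hx)
  smooth := hF.smooth.mono (prod_mono_left hWV)
  posDef x hx := hF.posDef x (hWV hx)

theorem apply_zero (hF : IsFinsler V F) (hx : x ∈ V) : F x 0 = 0 := by
  simpa using hF.homogeneous x hx 0 0 le_rfl

theorem sq_smul (hF : IsFinsler V F) (hx : x ∈ V) (v : Sp d) {t : ℝ} (ht : 0 ≤ t) :
    sq F (x, t • v) = t ^ 2 * sq F (x, v) := by
  simp only [sq]; rw [hF.homogeneous x hx v t ht, mul_pow]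

variable (hV : IsOpen V) (hF : IsFinsler V F) (hx : x ∈ V) (hv : v ≠ 0)
include hV hF hx hv

theorem contDiffAt : ContDiffAt ℝ ∞ (fun z : Sp d × Sp d => F z.1 z.2) (x, v) :=
  hF.smooth.contDiffAt ((hV.prod isOpen_compl_singleton).mem_nhds ⟨hx, hv⟩)

theorem contDiffAt_sq : ContDiffAt ℝ ∞ (sq F) (x, v) :=
  (hF.contDiffAt hV hx hv).pow 2

theorem contDiffAt_momentum : ContDiffAt ℝ ∞ (momentum F) (x, v) :=
  (contDiffAt_gradAlong (hF.contDiffAt_sq hV hx hv) (by simp) _).const_smul _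

theorem hasFDerivAt_sq : HasFDerivAt (fun w => sq F (x, w))
    ((2 : ℝ) • innerSL ℝ (momentum F (x, v))) v := by
  have heq : (fderiv ℝ (sq F) (x, v)).comp (.inr ℝ (Sp d) (Sp d))
      = (2 : ℝ) • innerSL ℝ (momentum F (x, v)) :=
    ContinuousLinearMap.ext fun u => by simp [fderiv_sq_snd]
  exact heq ▸ hasFDerivAt_comp_prodMk_right
    ((hF.contDiffAt_sq hV hx hv).differentiableAt (by simp))

theorem hasFDerivAt_momentum :
    HasFDerivAt (fun w => momentum F (x, w)) (fundamentalTensor F x v) v :=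
  hasFDerivAt_comp_prodMk_right ((hF.contDiffAt_momentum hV hx hv).differentiableAt (by simp))

theorem inner_fderiv_momentum (w : Sp d × Sp d) (u : Sp d) :
    inner ℝ (fderiv ℝ (momentum F) (x, v) w) u
      = 1 / 2 * fderiv ℝ (fderiv ℝ (sq F)) (x, v) w (0, u) := by
  have h := hF.contDiffAt_sq hV hx hv
  have hgrad : fderiv ℝ (momentum F) (x, v) = (1 / 2 : ℝ) • fderiv ℝ (gradSnd (sq F)) (x, v) :=
    fderiv_fun_const_smul
      ((contDiffAt_gradAlong (m := ∞) h (by simp) _).differentiableAt (by simp)) (1 / 2 : ℝ)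
  rw [hgrad, smul_apply, real_inner_smul_left, inner_fderiv_gradAlong (h.of_le two_le_infty)]
  rfl

theorem inner_fundamentalTensor_comm (w u : Sp d) :
    inner ℝ (fundamentalTensor F x v w) u = inner ℝ (fundamentalTensor F x v u) w := by
  simp only [fundamentalTensor_apply, hF.inner_fderiv_momentum hV hx hv]
  rw [fderiv_fderiv_comm ((hF.contDiffAt_sq hV hx hv).of_le two_le_infty)]

theorem pd_sq (j : Fin d) : pd (fun w => F x w ^ 2) j v = 2 * momentum F (x, v) j := by
  change fderiv ℝ (fun w => sq F (x, w)) v _ = _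
  rw [HasFDerivAt.fderiv (hF.hasFDerivAt_sq hV hx hv)]
  simp [EuclideanSpace.inner_single_right]

theorem metricCoeff_eq (i j : Fin d) :
    metricCoeff F x v i j = fundamentalTensor F x v (EuclideanSpace.single i 1) j := by
  have hpd : (fun u => pd (fun w => F x w ^ 2) j u) =ᶠ[𝓝 v] fun u => 2 * momentum F (x, u) j := by
    filter_upwards [isOpen_compl_singleton.mem_nhds hv] with u hu using hF.pd_sq hV hx hu j
  have hderiv : HasFDerivAt (fun u => 2 * momentum F (x, u) j)
      ((2 : ℝ) • ((EuclideanSpace.proj j : Sp d →L[ℝ] ℝ).comp (fundamentalTensor F x v))) v :=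
    (((EuclideanSpace.proj j : Sp d →L[ℝ] ℝ).hasFDerivAt).comp v
      (hF.hasFDerivAt_momentum hV hx hv)).const_mul 2
  simp only [metricCoeff, Matrix.of_apply]
  rw [pd, hpd.fderiv_eq, HasFDerivAt.fderiv hderiv]
  simp

theorem inner_fundamentalTensor_eq_sum (u w : Sp d) :
    inner ℝ (fundamentalTensor F x v u) w = ∑ i, ∑ j, metricCoeff F x v i j * u i * w j := by
  conv_lhs => rw [eq_sum_single u, map_sum, sum_inner]
  refine Finset.sum_congr rfl fun i _ => ?_
  rw [map_smul, real_inner_smul_left, PiLp.inner_apply, Finset.mul_sum]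
  refine Finset.sum_congr rfl fun j _ => ?_
  rw [hF.metricCoeff_eq hV hx hv]
  simp; ring

theorem inner_fundamentalTensor_self_pos {u : Sp d} (hu : u ≠ 0) :
    0 < inner ℝ (fundamentalTensor F x v u) u := by
  rw [hF.inner_fundamentalTensor_eq_sum hV hx hv]
  have h := ((Matrix.posDef_iff_dotProduct_mulVec).1 (hF.posDef x hx v hv)).2
    (x := u.ofLp) (by simpa using hu)
  simp only [dotProduct, Matrix.mulVec, star_trivial, Finset.mul_sum] at h
  refine h.trans_eq (Finset.sum_congr rfl fun i _ => Finset.sum_congr rfl fun j _ => ?_)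
  ring

theorem momentum_smul {t : ℝ} (ht : 0 < t) : momentum F (x, t • v) = t • momentum F (x, v) := by
  refine ext_inner_right ℝ fun u => ?_
  have hscale : (fun w => sq F (x, t • w)) = fun w => t ^ 2 * sq F (x, w) :=
    funext fun w => hF.sq_smul hx w ht.le
  have hfderiv := congrArg (fun f => fderiv ℝ f v u) hscale
  rw [fderiv_comp_smul (f := fun w => sq F (x, w)),
    HasFDerivAt.fderiv (hF.hasFDerivAt_sq hV hx (smul_ne_zero ht.ne' hv)),
    HasFDerivAt.fderiv ((hF.hasFDerivAt_sq hV hx hv).const_mul _)] at hfderiv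
  simp only [smul_apply, innerSL_apply_apply, smul_eq_mul] at hfderiv
  rw [real_inner_smul_left]
  exact mul_left_cancel₀ (by positivity : t * 2 ≠ 0) (by linear_combination hfderiv)

theorem inner_momentum_self : inner ℝ (momentum F (x, v)) v = F x v ^ 2 := by
  have heuler := fderiv_apply_self_of_homogeneous (n := 2)
    (hF.hasFDerivAt_sq hV hx hv).differentiableAt fun t ht => hF.sq_smul hx v ht.le
  rw [HasFDerivAt.fderiv (hF.hasFDerivAt_sq hV hx hv)] at heuler
  simpa [sq] using heuler

theorem fundamentalTensor_apply_self : fundamentalTensor F x v v = momentum F (x, v) := by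
  rw [← HasFDerivAt.fderiv (hF.hasFDerivAt_momentum hV hx hv)]
  simpa using fderiv_apply_self_of_homogeneous (n := 1)
    (hF.hasFDerivAt_momentum hV hx hv).differentiableAt
    fun t ht => by simpa using hF.momentum_smul hV hx hv ht

theorem pos : 0 < F x v := by
  have h := hF.inner_fundamentalTensor_self_pos hV hx hv hv
  rw [hF.fundamentalTensor_apply_self hV hx hv, hF.inner_momentum_self hV hx hv] at h
  exact lt_of_le_of_ne (hF.nonneg x hx v) fun h0 => by simp [← h0] at h

theorem legendre_eq : legendre F x v = momentum F (x, v) := by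
  refine ext_inner_right ℝ fun u => ?_
  rw [← hF.fundamentalTensor_apply_self hV hx hv, hF.inner_fundamentalTensor_comm hV hx hv,
    hF.inner_fundamentalTensor_eq_sum hV hx hv, PiLp.inner_apply]
  refine Finset.sum_congr rfl fun i _ => ?_
  simp only [legendre, RCLike.inner_apply, conj_trivial, Finset.mul_sum]
  exact Finset.sum_congr rfl fun j _ => by ring

end IsFinsler

end Metric

section Duality

theorem add_smul_sub_ne_zero {𝕜 E : Type*} [Field 𝕜] [AddCommGroup E] [Module 𝕜 E] {v w : E}
    (hv : v ≠ 0) (h : ∀ t : 𝕜, w ≠ t • v) (τ : 𝕜) : v + τ • (w - v) ≠ 0 := by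
  intro h0
  rcases eq_or_ne τ 0 with rfl | hτ
  · simp [hv] at h0
  · refine h (τ⁻¹ * (τ - 1)) ?_
    have hτw : τ • w = (τ - 1) • v := by rw [← sub_eq_zero, ← h0]; module
    rw [mul_smul, ← hτw, inv_smul_smul₀ hτ]

theorem contDiffAt_of_eventually_leftInverse {E G : Type*} [NormedAddCommGroup E]
    [NormedSpace ℝ E] [CompleteSpace E] [NormedAddCommGroup G] [NormedSpace ℝ G]
    {n : WithTop ℕ∞} {f : E → G} {g : G → E} {f' : E ≃L[ℝ] G} {a : E} (hf : ContDiffAt ℝ n f a)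
    (hf' : HasFDerivAt f (f' : E →L[ℝ] G) a) (hn : n ≠ 0) (hg : ∀ᶠ x in 𝓝 a, g (f x) = x) :
    ContDiffAt ℝ n g (f a) :=
  (hf.to_localInverse hf' hn).congr_of_eventuallyEq
    ((hf.hasStrictFDerivAt' hf' hn).localInverse_unique hg)

/-- The inverse of the Legendre transform, as a function of position and covector. -/
def colegendre (F : Sp d → Sp d → ℝ) (z : Sp d × Sp d) : Sp d :=
  Classical.epsilon fun v => v ≠ 0 ∧ momentum F (z.1, v) = z.2

/-- The Hamiltonian of the metric, half the square of the dual metric, in a form which is visibly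
smooth. -/
def ham (F : Sp d → Sp d → ℝ) (z : Sp d × Sp d) : ℝ := 1 / 2 * inner ℝ z.2 (colegendre F z)

/-- Half the gradient in position of the squared metric, as a function of position and covector.
It is the right-hand side of Hamilton's equation for the covector. -/
def force (F : Sp d → Sp d → ℝ) (z : Sp d × Sp d) : Sp d :=
  (1 / 2 : ℝ) • gradFst (sq F) (z.1, colegendre F z)

variable {V : Set (Sp d)} {F : Sp d → Sp d → ℝ} {x v w ξ : Sp d}

theorem dual_zero_right (F : Sp d → Sp d → ℝ) (x : Sp d) : dual F x 0 = 0 :=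
  le_antisymm (Real.sSup_nonpos (by rintro _ ⟨v, -, rfl⟩; simp))
    (Real.sSup_nonneg (by rintro _ ⟨v, -, rfl⟩; simp))

theorem ne_zero_of_mem_cosphere (h : ξ ∈ cosphere F x) : ξ ≠ 0 := by
  rintro rfl
  exact zero_ne_one ((dual_zero_right F x).symm.trans h)

namespace IsFinsler

variable (hV : IsOpen V) (hF : IsFinsler V F) (hx : x ∈ V)
include hV hF hx

section Momentum

variable (hv : v ≠ 0)
include hv

theorem hasFDerivAt : HasFDerivAt (F x) ((F x v)⁻¹ • innerSL ℝ (momentum F (x, v))) v := by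
  have hFv := hF.pos hV hx hv
  have hsqrt : (fun w => √(sq F (x, w))) = F x :=
    funext fun w => Real.sqrt_sq (hF.nonneg x hx w)
  have h := (hF.hasFDerivAt_sq hV hx hv).sqrt (pow_pos hFv 2).ne'
  have hscale : 1 / (2 * F x v) * 2 = (F x v)⁻¹ := by field_simp
  rwa [hsqrt, smul_smul, sq, Real.sqrt_sq hFv.le, hscale] at h

theorem two_mul_inner_momentum_lt (h : ∀ t : ℝ, w ≠ t • v) :
    2 * inner ℝ (momentum F (x, v)) w < F x v ^ 2 + F x w ^ 2 := by
  set γ : ℝ → Sp d := fun τ => v + τ • (w - v)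
  have hγ₀ (τ : ℝ) : γ τ ≠ 0 := add_smul_sub_ne_zero hv h τ
  have hγ (τ : ℝ) : HasDerivAt γ (w - v) τ := by
    simpa [γ] using ((hasDerivAt_id τ).smul_const (w - v)).const_add v
  have hsq (τ : ℝ) : HasDerivAt (fun τ => sq F (x, γ τ))
      (2 * inner ℝ (momentum F (x, γ τ)) (w - v)) τ := by
    simpa [Function.comp_def] using (hF.hasFDerivAt_sq hV hx (hγ₀ τ)).comp_hasDerivAt τ (hγ τ)
  have hmomentum (τ : ℝ) : HasDerivAt (fun τ => 2 * inner ℝ (momentum F (x, γ τ)) (w - v))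
      (2 * inner ℝ (fundamentalTensor F x (γ τ) (w - v)) (w - v)) τ := by
    simpa using (((hF.hasFDerivAt_momentum hV hx (hγ₀ τ)).comp_hasDerivAt τ (hγ τ)).inner ℝ
      (hasDerivAt_const τ (w - v))).const_mul 2
  have hmono : StrictMono fun τ => 2 * inner ℝ (momentum F (x, γ τ)) (w - v) := by
    refine strictMono_of_deriv_pos fun τ => ?_
    rw [(hmomentum τ).deriv]
    have hwv : w - v ≠ 0 := sub_ne_zero.2 fun e => h 1 (by simpa using e)
    exact mul_pos two_pos (hF.inner_fundamentalTensor_self_pos hV hx (hγ₀ τ) hwv)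
  obtain ⟨c, hc, hslope⟩ := exists_hasDerivAt_eq_slope _ _ (zero_lt_one' ℝ)
    (fun τ _ => (hsq τ).continuousAt.continuousWithinAt) (fun τ _ => hsq τ)
  have hγ_zero : γ 0 = v := by simp [γ]
  have hγ_one : γ 1 = w := by simp [γ]
  have hlt : 2 * inner ℝ (momentum F (x, γ 0)) (w - v) < _ :=
    (hmono hc.1).trans_eq hslope
  rw [hγ_zero, hγ_one, inner_sub_right, hF.inner_momentum_self hV hx hv] at hlt
  simp only [sq] at hlt
  linarith

theorem inner_momentum_lt (h : ¬SameRay ℝ v w) :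
    inner ℝ (momentum F (x, v)) w < F x v * F x w := by
  have hFv := hF.pos hV hx hv
  by_cases hline : ∃ t : ℝ, w = t • v
  · obtain ⟨t, rfl⟩ := hline
    have ht : t < 0 := not_le.1 fun ht => h (SameRay.sameRay_nonneg_smul_right v ht)
    rw [inner_smul_right, hF.inner_momentum_self hV hx hv]
    exact (mul_neg_of_neg_of_pos ht (by positivity)).trans_le
      (mul_nonneg hFv.le (hF.nonneg x hx _))
  · push Not at hline
    have hw : w ≠ 0 := by simpa using hline 0
    have hFw := hF.pos hV hx hw
    have hs : 0 < F x v / F x w := by positivity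
    have hlt := hF.two_mul_inner_momentum_lt hV hx hv (w := (F x v / F x w) • w) fun t ht =>
      hline ((F x v / F x w)⁻¹ * t) (by rw [mul_smul, ← ht, inv_smul_smul₀ hs.ne'])
    rw [hF.homogeneous x hx w _ hs.le, inner_smul_right, div_mul_cancel₀ _ hFw.ne'] at hlt
    have hdiv : F x v * inner ℝ (momentum F (x, v)) w / F x w < F x v ^ 2 := by
      rw [mul_div_right_comm]; linarith
    rw [div_lt_iff₀ hFw, pow_two, mul_assoc] at hdiv
    exact lt_of_mul_lt_mul_left hdiv hFv.le

theorem inner_momentum_le (w : Sp d) : inner ℝ (momentum F (x, v)) w ≤ F x v * F x w := by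
  by_cases h : SameRay ℝ v w
  · obtain ⟨t, ht, rfl⟩ := h.exists_nonneg_left hv
    rw [inner_smul_right, hF.inner_momentum_self hV hx hv, hF.homogeneous x hx v t ht]
    exact le_of_eq (by ring)
  · exact (hF.inner_momentum_lt hV hx hv h).le

theorem eq_of_inner_momentum_eq (hvw : F x v = F x w)
    (h : inner ℝ (momentum F (x, v)) w = F x v * F x w) : w = v := by
  have hray : SameRay ℝ v w := not_not.1 fun hr => (hF.inner_momentum_lt hV hx hv hr).ne h
  obtain ⟨t, ht, rfl⟩ := hray.exists_nonneg_left hv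
  rw [hF.homogeneous x hx v t ht] at hvw
  rw [mul_eq_right₀ (hF.pos hV hx hv).ne' |>.1 hvw.symm, one_smul]

theorem momentum_ne_zero : momentum F (x, v) ≠ 0 := by
  intro h
  have hself := hF.inner_momentum_self hV hx hv
  rw [h, inner_zero_left] at hself
  exact (pow_pos (hF.pos hV hx hv) 2).ne hself

theorem dual_momentum : dual F x (momentum F (x, v)) = F x v := by
  have hFv := hF.pos hV hx hv
  refine IsGreatest.csSup_eq ⟨⟨(F x v)⁻¹ • v, ?_, ?_⟩, ?_⟩
  · rw [hF.homogeneous x hx v _ (inv_pos.2 hFv).le, inv_mul_cancel₀ hFv.ne']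
  · rw [inner_smul_right, hF.inner_momentum_self hV hx hv]; field_simp
  · rintro s ⟨w, hw, rfl⟩
    simpa [hw] using hF.inner_momentum_le hV hx hv w

theorem momentum_injective (hw : w ≠ 0) (h : momentum F (x, v) = momentum F (x, w)) : w = v := by
  have hvw : F x v = F x w := by
    rw [← hF.dual_momentum hV hx hv, h, hF.dual_momentum hV hx hw]
  refine hF.eq_of_inner_momentum_eq hV hx hv hvw ?_
  rw [h, hF.inner_momentum_self hV hx hw, hvw]; ring

theorem fundamentalTensor_injective : Function.Injective (fundamentalTensor F x v) := by
  refine (injective_iff_map_eq_zero _).2 fun u hu => by_contra fun hu₀ => ?_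
  have h := hF.inner_fundamentalTensor_self_pos hV hx hv hu₀
  rw [hu, inner_zero_left] at h
  exact h.false

end Momentum

section Covector

variable (hξ : ξ ≠ 0)
include hξ

theorem exists_forall_inner_le_mul : ∃ u, u ≠ 0 ∧ ∃ m : ℝ, 0 < m ∧ inner ℝ ξ u = m * F x u ∧
    ∀ w, inner ℝ ξ w ≤ m * F x w := by
  have hne : ∀ u ∈ Metric.sphere (0 : Sp d) 1, u ≠ 0 := fun _ hu =>
    Metric.ne_of_mem_sphere hu one_ne_zero
  have hcont : ContinuousOn (fun u => inner ℝ ξ u / F x u) (Metric.sphere (0 : Sp d) 1) :=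
    fun u hu => ((innerSL ℝ ξ).continuous.continuousAt.div
      (hF.hasFDerivAt hV hx (hne u hu)).continuousAt
      (hF.pos hV hx (hne u hu)).ne').continuousWithinAt
  have hmem (w : Sp d) (hw : w ≠ 0) : ‖w‖⁻¹ • w ∈ Metric.sphere (0 : Sp d) 1 := by
    simp [norm_smul, norm_ne_zero_iff.2 hw]
  obtain ⟨u, hu, hmax⟩ := (isCompact_sphere (0 : Sp d) 1).exists_isMaxOn ⟨_, hmem ξ hξ⟩ hcont
  have hle (w : Sp d) : inner ℝ ξ w ≤ inner ℝ ξ u / F x u * F x w := by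
    rcases eq_or_ne w 0 with rfl | hw
    · simp [hF.apply_zero hx]
    have hn : 0 < ‖w‖⁻¹ := inv_pos.2 (norm_pos_iff.2 hw)
    have h : inner ℝ ξ (‖w‖⁻¹ • w) / F x (‖w‖⁻¹ • w) ≤ inner ℝ ξ u / F x u := hmax (hmem w hw)
    rwa [inner_smul_right, hF.homogeneous x hx w _ hn.le, mul_div_mul_left _ _ hn.ne',
      div_le_iff₀ (hF.pos hV hx hw)] at h
  refine ⟨u, hne u hu, inner ℝ ξ u / F x u, ?_, ?_, hle⟩
  · exact pos_of_mul_pos_left ((real_inner_self_pos.2 hξ).trans_le (hle ξ)) (hF.pos hV hx hξ).le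
  · rw [div_mul_cancel₀ _ (hF.pos hV hx (hne u hu)).ne']

theorem exists_momentum_eq : ∃ v, v ≠ 0 ∧ momentum F (x, v) = ξ := by
  obtain ⟨u, hu, m, hm, hmu, hle⟩ := hF.exists_forall_inner_le_mul hV hx hξ
  have hFu := hF.pos hV hx hu
  have hmin : IsLocalMin (fun w => m * F x w - inner ℝ ξ w) u :=
    Eventually.of_forall fun w => by simpa only [hmu, sub_self] using sub_nonneg.2 (hle w)
  have hcrit := hmin.hasFDerivAt_eq_zero
    (((hF.hasFDerivAt hV hx hu).const_mul m).sub (innerSL ℝ ξ).hasFDerivAt)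
  refine ⟨(m / F x u) • u, smul_ne_zero (by positivity) hu, ?_⟩
  rw [hF.momentum_smul hV hx hu (by positivity)]
  refine ext_inner_right ℝ fun w => ?_
  have h := congrArg (fun g => g w) hcrit
  simp only [sub_apply, smul_apply, smul_eq_mul, innerSL_apply_apply, zero_apply] at h
  rw [real_inner_smul_left, div_eq_mul_inv]
  linarith

theorem colegendre_ne_zero : colegendre F (x, ξ) ≠ 0 :=
  (Classical.epsilon_spec (hF.exists_momentum_eq hV hx hξ)).1

theorem momentum_colegendre : momentum F (x, colegendre F (x, ξ)) = ξ :=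
  (Classical.epsilon_spec (hF.exists_momentum_eq hV hx hξ)).2

end Covector

theorem colegendre_momentum (hv : v ≠ 0) : colegendre F (x, momentum F (x, v)) = v :=
  have hm := hF.momentum_ne_zero hV hx hv
  hF.momentum_injective hV hx hv (hF.colegendre_ne_zero hV hx hm)
    (hF.momentum_colegendre hV hx hm).symm

variable (hξ : ξ ≠ 0)
include hξ

theorem apply_colegendre : F x (colegendre F (x, ξ)) = dual F x ξ := by
  rw [← hF.dual_momentum hV hx (hF.colegendre_ne_zero hV hx hξ), hF.momentum_colegendre hV hx hξ]

theorem dual_pos : 0 < dual F x ξ := by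
  rw [← hF.apply_colegendre hV hx hξ]
  exact hF.pos hV hx (hF.colegendre_ne_zero hV hx hξ)

theorem inner_le_dual_mul (w : Sp d) : inner ℝ ξ w ≤ dual F x ξ * F x w := by
  have h := hF.inner_momentum_le hV hx (hF.colegendre_ne_zero hV hx hξ) w
  rwa [hF.momentum_colegendre hV hx hξ, hF.apply_colegendre hV hx hξ] at h

theorem inner_colegendre : inner ℝ ξ (colegendre F (x, ξ)) = dual F x ξ ^ 2 := by
  have h := hF.inner_momentum_self hV hx (hF.colegendre_ne_zero hV hx hξ)
  rwa [hF.momentum_colegendre hV hx hξ, hF.apply_colegendre hV hx hξ] at h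

theorem colegendre_smul {t : ℝ} (ht : 0 < t) :
    colegendre F (x, t • ξ) = t • colegendre F (x, ξ) := by
  have hv := hF.colegendre_ne_zero hV hx hξ
  have h := hF.momentum_smul hV hx hv ht
  rw [hF.momentum_colegendre hV hx hξ] at h
  rw [← h, hF.colegendre_momentum hV hx (smul_ne_zero ht.ne' hv)]

theorem dual_smul {t : ℝ} (ht : 0 < t) : dual F x (t • ξ) = t * dual F x ξ := by
  rw [← hF.apply_colegendre hV hx (smul_ne_zero ht.ne' hξ), hF.colegendre_smul hV hx hξ ht,
    hF.homogeneous x hx _ t ht.le, hF.apply_colegendre hV hx hξ]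

theorem contDiffAt_colegendre : ContDiffAt ℝ ∞ (colegendre F) (x, ξ) := by
  set v := colegendre F (x, ξ) 
  have hv : v ≠ 0 := hF.colegendre_ne_zero hV hx hξ
  have hm := hF.contDiffAt_momentum hV hx hv
  set D : Sp d × Sp d →L[ℝ] Sp d × Sp d := (ContinuousLinearMap.fst ℝ (Sp d) (Sp d)).prod
    (fderiv ℝ (momentum F) (x, v))
  have hD : HasFDerivAt (fun z : Sp d × Sp d => (z.1, momentum F z)) D (x, v) :=
    hasFDerivAt_fst.prodMk (hm.differentiableAt (by simp)).hasFDerivAt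
  have hinj : Function.Injective (D : Sp d × Sp d →ₗ[ℝ] Sp d × Sp d) := by
    refine (injective_iff_map_eq_zero _).2 ?_
    rintro ⟨u, w⟩ h
    obtain ⟨rfl, hw⟩ := Prod.mk.inj h
    rw [hF.fundamentalTensor_injective hV hx hv (hw.trans (map_zero _).symm)]
    rfl
  have hinv : ContDiffAt ℝ ∞ (fun z : Sp d × Sp d => (z.1, colegendre F z))
      (x, momentum F (x, v)) := by
    refine contDiffAt_of_eventually_leftInverse (contDiffAt_fst.prodMk hm)
      (f' := (LinearEquiv.ofInjectiveEndo _ hinj).toContinuousLinearEquiv) hD (by simp) ?_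
    filter_upwards [(hV.prod isOpen_compl_singleton).mem_nhds ⟨hx, hv⟩] with z hz
    rw [hF.colegendre_momentum hV hz.1 hz.2]
  rw [hF.momentum_colegendre hV hx hξ] at hinv
  exact contDiffAt_snd.comp _ hinv

theorem fundamentalTensor_fderiv_colegendre (w : Sp d) :
    fundamentalTensor F x (colegendre F (x, ξ)) (fderiv ℝ (colegendre F) (x, ξ) (0, w)) = w := by
  have hcomp := (hF.hasFDerivAt_momentum hV hx (hF.colegendre_ne_zero hV hx hξ)).comp ξ
    (hasFDerivAt_comp_prodMk_right
      ((hF.contDiffAt_colegendre hV hx hξ).differentiableAt (by simp)))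
  have hid : ((fun w => momentum F (x, w)) ∘ fun η => colegendre F (x, η)) =ᶠ[𝓝 ξ] id := by
    filter_upwards [isOpen_compl_singleton.mem_nhds hξ] with η hη
    exact hF.momentum_colegendre hV hx hη
  exact congrArg (fun g => g w)
    ((hcomp.congr_of_eventuallyEq hid.symm).unique (hasFDerivAt_id ξ))

theorem inner_fderiv_colegendre_pos (hw : w ≠ 0) :
    0 < inner ℝ w (fderiv ℝ (colegendre F) (x, ξ) (0, w)) := by
  set u := fderiv ℝ (colegendre F) (x, ξ) (0, w)
  have hu : fundamentalTensor F x (colegendre F (x, ξ)) u = w :=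
    hF.fundamentalTensor_fderiv_colegendre hV hx hξ w
  have hu₀ : u ≠ 0 := fun h => hw (by rw [← hu, h, map_zero])
  nth_rewrite 1 [← hu]
  exact hF.inner_fundamentalTensor_self_pos hV hx (hF.colegendre_ne_zero hV hx hξ) hu₀

theorem ham_eq : ham F (x, ξ) = 1 / 2 * dual F x ξ ^ 2 := by
  rw [ham, hF.inner_colegendre hV hx hξ]

theorem contDiffAt_ham : ContDiffAt ℝ ∞ (ham F) (x, ξ) :=
  contDiffAt_const.mul (contDiffAt_snd.inner ℝ (hF.contDiffAt_colegendre hV hx hξ))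

theorem contDiffAt_force : ContDiffAt ℝ ∞ (force F) (x, ξ) :=
  ((contDiffAt_gradAlong (m := ∞)
    (hF.contDiffAt_sq hV hx (hF.colegendre_ne_zero hV hx hξ)) (by simp) _).comp (x, ξ)
    (contDiffAt_fst.prodMk (hF.contDiffAt_colegendre hV hx hξ))).const_smul (1 / 2 : ℝ)

theorem contDiffAt_dual : ContDiffAt ℝ ∞ (fun z : Sp d × Sp d => dual F z.1 z.2) (x, ξ) := by
  refine ((hF.contDiffAt hV hx (hF.colegendre_ne_zero hV hx hξ)).comp (x, ξ)
    (contDiffAt_fst.prodMk (hF.contDiffAt_colegendre hV hx hξ))).congr_of_eventuallyEq ?_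
  filter_upwards [(hV.prod isOpen_compl_singleton).mem_nhds ⟨hx, hξ⟩] with z hz
  exact (hF.apply_colegendre hV hz.1 hz.2).symm

theorem fderiv_ham (u w : Sp d) : fderiv ℝ (ham F) (x, ξ) (u, w)
    = inner ℝ (colegendre F (x, ξ)) w - inner ℝ (force F (x, ξ)) u := by
  have hc := ((hF.contDiffAt_colegendre hV hx hξ).differentiableAt (by simp)).hasFDerivAt
  have hsq := ((hF.contDiffAt_sq hV hx (hF.colegendre_ne_zero hV hx hξ)).differentiableAt
    (by simp)).hasFDerivAt
  -- The velocity is stationary for `⟨ξ, v⟩ - F(x,v)²/2`, so its variation does not contribute.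
  have heq : ham F =ᶠ[𝓝 (x, ξ)]
      fun z => inner ℝ z.2 (colegendre F z) - 1 / 2 * sq F (z.1, colegendre F z) := by
    filter_upwards [(hV.prod isOpen_compl_singleton).mem_nhds ⟨hx, hξ⟩] with z hz
    rw [ham, hF.inner_colegendre hV hz.1 hz.2, sq, hF.apply_colegendre hV hz.1 hz.2]
    ring
  have hderiv := (hasFDerivAt_snd.inner ℝ hc).sub
    ((hsq.comp (x, ξ) (hasFDerivAt_fst.prodMk hc)).const_mul (1 / 2))
  set c' := fderiv ℝ (colegendre F) (x, ξ) (u, w)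
  have hsplit : fderiv ℝ (sq F) (x, colegendre F (x, ξ)) (u, c')
      = 2 * inner ℝ (force F (x, ξ)) u + 2 * inner ℝ ξ c' := by
    rw [show (u, c') = (u, 0) + (0, c') by simp, map_add, fderiv_sq_snd,
      hF.momentum_colegendre hV hx hξ, force, real_inner_smul_left, inner_gradFst]
    ring
  rw [(hderiv.congr_of_eventuallyEq heq).fderiv, real_inner_comm w]
  simp [c', hsplit]
  ring

end IsFinsler

end Duality

section Geodesic

variable {V : Set (Sp d)} {F : Sp d → Sp d → ℝ} {x v w ξ : Sp d}

theorem sum_half_add_swap_sub_mul {ι : Type*} [Fintype ι] (a b : ι → ι → ℝ) (v : ι → ℝ) :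
    ∑ j, ∑ k, 1 / 2 * (a j k + a k j - b j k) * v j * v k
      = ∑ j, ∑ k, a j k * v j * v k - 1 / 2 * ∑ j, ∑ k, b j k * v j * v k := by
  have hswap : ∑ j, ∑ k, a k j * v j * v k = ∑ j, ∑ k, a j k * v j * v k := by
    rw [Finset.sum_comm]
    exact Finset.sum_congr rfl fun j _ => Finset.sum_congr rfl fun k _ => by ring
  calc ∑ j, ∑ k, 1 / 2 * (a j k + a k j - b j k) * v j * v k
      = ∑ j, ∑ k, (1 / 2 * (a j k * v j * v k) + 1 / 2 * (a k j * v j * v k)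
          - 1 / 2 * (b j k * v j * v k)) :=
        Finset.sum_congr rfl fun j _ => Finset.sum_congr rfl fun k _ => by ring
    _ = _ := by
        simp only [Finset.sum_sub_distrib, Finset.sum_add_distrib, ← Finset.mul_sum, hswap]
        ring

theorem hasDerivWithinAt_zero_of_norm_le_mul_norm_sq {E G : Type*} [NormedAddCommGroup E]
    [NormedSpace ℝ E] [NormedAddCommGroup G] [NormedSpace ℝ G] {f : ℝ → G} {u : ℝ → E} {u' : E}
    {s : Set ℝ} {t C : ℝ} (hu : HasDerivWithinAt u u' s t) (hut : u t = 0) (ht : t ∈ s)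
    (hf : ∀ y ∈ s, ‖f y‖ ≤ C * ‖u y‖ ^ 2) : HasDerivWithinAt f 0 s t := by
  have hft : f t = 0 := by simpa [hut] using hf t ht
  have hfu : f =O[𝓝[s] t] fun y => ‖u y‖ ^ 2 := by
    refine .of_bound C ?_
    filter_upwards [self_mem_nhdsWithin] with y hy
    simpa using hf y hy
  have hu_sub : u =O[𝓝[s] t] fun y => y - t := by
    simpa [Function.comp_def, hut] using (hu.isBigO_sub.comp_tendsto
      (tendsto_id.prodMk (tendsto_const_pure (b := t))))
  have hpow : (fun y : ℝ => (y - t) ^ 2) =o[𝓝[s] t] fun y => y - t := by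
    simpa using (Asymptotics.isLittleO_pow_sub_sub t one_lt_two).mono nhdsWithin_le_nhds
  refine hasDerivWithinAt_iff_isLittleO.2 ?_
  simpa [hft] using (hfu.trans (hu_sub.norm_left.pow 2)).trans_isLittleO hpow

namespace IsFinsler

theorem sum_metricCoeff_christoffel (hF : IsFinsler V F) (hx : x ∈ V) (hv : v ≠ 0)
    (b j k : Fin d) : ∑ a, metricCoeff F x v b a * christoffel F x v a j k =
      1 / 2 * (pd (fun z => metricCoeff F z v b j) k x + pd (fun z => metricCoeff F z v b k) j x
        - pd (fun z => metricCoeff F z v j k) b x) := by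
  have hdet : IsUnit (metricCoeff F x v).det :=
    (Matrix.isUnit_iff_isUnit_det _).1 (hF.posDef x hx v hv).isUnit
  set G : Fin d → ℝ := fun i => pd (fun z => metricCoeff F z v i j) k x +
    pd (fun z => metricCoeff F z v i k) j x - pd (fun z => metricCoeff F z v j k) i x
  have hchristoffel : (fun a => christoffel F x v a j k)
      = (1 / 2 : ℝ) • (metricCoeff F x v)⁻¹.mulVec G := by
    ext a
    simp only [Pi.smul_apply, Matrix.mulVec, dotProduct, smul_eq_mul, Finset.mul_sum]
    exact Finset.sum_congr rfl fun i _ => by ring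
  change (metricCoeff F x v).mulVec (fun a => christoffel F x v a j k) b = _
  rw [hchristoffel, Matrix.mulVec_smul, Matrix.mulVec_mulVec, Matrix.mul_nonsing_inv _ hdet,
    Matrix.one_mulVec]
  rfl

theorem exists_le_mul_norm (hV : IsOpen V) (hF : IsFinsler V F)
    {K : Set (Sp d)} (hK : IsCompact K) (hKV : K ⊆ V) :
    ∃ C > 0, ∀ x ∈ K, ∀ v, F x v ≤ C * ‖v‖ ∧ ‖v‖ ≤ C * F x v := by
  have hne : ∀ u ∈ Metric.sphere (0 : Sp d) 1, u ≠ 0 := fun _ hu =>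
    Metric.ne_of_mem_sphere hu one_ne_zero
  have hcpt : IsCompact (K ×ˢ Metric.sphere (0 : Sp d) 1) := hK.prod (isCompact_sphere _ _)
  have hcont : ContinuousOn (fun z : Sp d × Sp d => F z.1 z.2) (K ×ˢ Metric.sphere (0 : Sp d) 1) :=
    fun z hz => (hF.contDiffAt hV (hKV hz.1) (hne _ hz.2)).continuousAt.continuousWithinAt
  have hcont_inv : ContinuousOn (fun z : Sp d × Sp d => (F z.1 z.2)⁻¹)
      (K ×ˢ Metric.sphere (0 : Sp d) 1) :=
    hcont.inv₀ fun z hz => (hF.pos hV (hKV hz.1) (hne _ hz.2)).ne'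
  obtain ⟨C₁, hC₁⟩ := hcpt.exists_bound_of_continuousOn hcont
  obtain ⟨C₂, hC₂⟩ := hcpt.exists_bound_of_continuousOn hcont_inv
  refine ⟨max 1 (max C₁ C₂), by positivity, fun x hx v => ?_⟩
  rcases eq_or_ne v 0 with rfl | hv
  · simp [hF.apply_zero (hKV hx)]
  have hn : 0 < ‖v‖ := norm_pos_iff.2 hv
  have hFv := hF.pos hV (hKV hx) hv
  have hmem : (x, ‖v‖⁻¹ • v) ∈ K ×ˢ Metric.sphere (0 : Sp d) 1 := ⟨hx, by
    simp [norm_smul, hn.ne']⟩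
  have hupper := hC₁ _ hmem
  have hlower := hC₂ _ hmem
  simp only [hF.homogeneous x (hKV hx) v _ (inv_pos.2 hn).le, norm_inv, norm_mul,
    Real.norm_of_nonneg hFv.le, norm_norm, mul_inv, inv_inv] at hupper hlower
  rw [inv_mul_le_iff₀ hn] at hupper
  rw [mul_inv_le_iff₀ hFv] at hlower
  constructor
  · nlinarith [le_max_left C₁ C₂, le_max_right 1 (max C₁ C₂)]
  · nlinarith [le_max_right C₁ C₂, le_max_right 1 (max C₁ C₂)]

variable (hV : IsOpen V) (hF : IsFinsler V F) (hx : x ∈ V)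
include hV hF hx

section Velocity

variable (hv : v ≠ 0)
include hv

theorem differentiableAt_metricCoeff (i j : Fin d) :
    DifferentiableAt ℝ (fun z => metricCoeff F z v i j) x := by
  have hslot := (hasFDerivAt_comp_prodMk_left (f := fun y : Sp d × Sp d =>
    fderiv ℝ (momentum F) y (0, EuclideanSpace.single i 1))
    ((differentiableAt_fderiv ((hF.contDiffAt_momentum hV hx hv).of_le two_le_infty)).clm_apply
      (differentiableAt_const _))).differentiableAt
  refine (((EuclideanSpace.proj j : Sp d →L[ℝ] ℝ).differentiableAt).comp x
    hslot).congr_of_eventuallyEq ?_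
  filter_upwards [hV.mem_nhds hx] with z hz
  simp [hF.metricCoeff_eq hV hz hv, fundamentalTensor_apply]

theorem metricCoeff_comm (i j : Fin d) : metricCoeff F x v i j = metricCoeff F x v j i := by
  have h := hF.inner_fundamentalTensor_comm hV hx hv (EuclideanSpace.single i 1)
    (EuclideanSpace.single j 1)
  simpa [hF.metricCoeff_eq hV hx hv, EuclideanSpace.inner_single_right] using h

theorem fundamentalTensor_apply_eq_sum (w : Sp d) (b : Fin d) :
    fundamentalTensor F x v w b = ∑ a, metricCoeff F x v b a * w a := by
  have h := hF.inner_fundamentalTensor_eq_sum hV hx hv w (EuclideanSpace.single b 1)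
  simp only [EuclideanSpace.inner_single_right, one_mul, conj_trivial] at h
  rw [h]
  refine Finset.sum_congr rfl fun a _ => ?_
  rw [hF.metricCoeff_comm hV hx hv b a]
  simp

theorem momentum_apply (b : Fin d) :
    momentum F (x, v) b = ∑ j, metricCoeff F x v b j * v j := by
  rw [← hF.legendre_eq hV hx hv]; rfl

theorem fderiv_momentum_fst (u : Sp d) (b : Fin d) : fderiv ℝ (momentum F) (x, v) (u, 0) b
    = ∑ j, ∑ k, pd (fun z => metricCoeff F z v b j) k x * v j * u k := by
  have hslot : HasFDerivAt (fun z => momentum F (z, v) b) _ x :=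
    ((EuclideanSpace.proj b : Sp d →L[ℝ] ℝ).hasFDerivAt).comp x
      (hasFDerivAt_comp_prodMk_left ((hF.contDiffAt_momentum hV hx hv).differentiableAt (by simp)))
  have hsum : HasFDerivAt (fun z => ∑ j, metricCoeff F z v b j * v j)
      (∑ j, v j • fderiv ℝ (fun z => metricCoeff F z v b j) x) x :=
    HasFDerivAt.fun_sum fun j _ =>
      (hF.differentiableAt_metricCoeff hV hx hv b j).hasFDerivAt.mul_const (v j)
  have heq : (fun z => momentum F (z, v) b) =ᶠ[𝓝 x] fun z => ∑ j, metricCoeff F z v b j * v j := by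
    filter_upwards [hV.mem_nhds hx] with z hz using hF.momentum_apply hV hz hv b
  have happly := congrArg (fun g => g u) (hslot.unique (hsum.congr_of_eventuallyEq heq))
  simp only [ContinuousLinearMap.comp_apply, ContinuousLinearMap.inl_apply,
    sum_apply, smul_apply, smul_eq_mul] at happly
  refine happly.trans (Finset.sum_congr rfl fun j _ => ?_)
  conv_lhs => rw [eq_sum_single u]
  rw [map_sum, Finset.mul_sum]
  refine Finset.sum_congr rfl fun k _ => ?_
  rw [map_smul, smul_eq_mul, pd]; ring

theorem fderiv_sq_fst (b : Fin d) : fderiv ℝ (sq F) (x, v) (EuclideanSpace.single b 1, 0)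
    = ∑ j, ∑ k, pd (fun z => metricCoeff F z v j k) b x * v j * v k := by
  have hslot := hasFDerivAt_comp_prodMk_left
    ((hF.contDiffAt_sq hV hx hv).differentiableAt (by simp))
  have hsum : HasFDerivAt (fun z => ∑ j, ∑ k, metricCoeff F z v j k * v j * v k)
      (∑ j, ∑ k, v k • v j • fderiv ℝ (fun z => metricCoeff F z v j k) x) x :=
    HasFDerivAt.fun_sum fun j _ => HasFDerivAt.fun_sum fun k _ =>
      ((hF.differentiableAt_metricCoeff hV hx hv j k).hasFDerivAt.mul_const (v j)).mul_const (v k)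
  have heq : (fun z => sq F (z, v)) =ᶠ[𝓝 x]
      fun z => ∑ j, ∑ k, metricCoeff F z v j k * v j * v k := by
    filter_upwards [hV.mem_nhds hx] with z hz
    rw [sq, ← hF.inner_momentum_self hV hz hv, ← hF.fundamentalTensor_apply_self hV hz hv,
      hF.inner_fundamentalTensor_eq_sum hV hz hv]
  have happly := congrArg (fun g => g (EuclideanSpace.single b 1))
    (hslot.unique (hsum.congr_of_eventuallyEq heq))
  simp only [ContinuousLinearMap.comp_apply, ContinuousLinearMap.inl_apply,
    sum_apply, smul_apply, smul_eq_mul] at happly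
  refine happly.trans (Finset.sum_congr rfl fun j _ => Finset.sum_congr rfl fun k _ => ?_)
  rw [pd]; ring

theorem fundamentalTensor_apply_of_geodesic_equation
    (hw : ∀ a, w a = -∑ j, ∑ k, christoffel F x v a j k * v j * v k) (b : Fin d) :
    fundamentalTensor F x v w b = -∑ j, ∑ k, 1 / 2 * (pd (fun z => metricCoeff F z v b j) k x
      + pd (fun z => metricCoeff F z v b k) j x
      - pd (fun z => metricCoeff F z v j k) b x) * v j * v k := by
  simp only [hF.fundamentalTensor_apply_eq_sum hV hx hv, hw,
    ← hF.sum_metricCoeff_christoffel hx hv, mul_neg, Finset.sum_neg_distrib, Finset.mul_sum,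
    Finset.sum_mul, neg_inj]
  rw [Finset.sum_comm]
  refine Finset.sum_congr rfl fun j _ => ?_
  rw [Finset.sum_comm]
  exact Finset.sum_congr rfl fun k _ => Finset.sum_congr rfl fun a _ => by ring

theorem fderiv_momentum_of_geodesic_equation
    (hw : ∀ a, w a = -∑ j, ∑ k, christoffel F x v a j k * v j * v k) :
    fderiv ℝ (momentum F) (x, v) (v, w) = (1 / 2 : ℝ) • gradFst (sq F) (x, v) := by
  ext b
  have hgrad : gradFst (sq F) (x, v) b
      = fderiv ℝ (sq F) (x, v) (EuclideanSpace.single b 1, 0) := by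
    simpa [EuclideanSpace.inner_single_right] using
      inner_gradFst (sq F) (x, v) (EuclideanSpace.single b 1)
  rw [show ((v, w) : Sp d × Sp d) = (v, 0) + (0, w) by simp, map_add, PiLp.add_apply,
    ← fundamentalTensor_apply, hF.fundamentalTensor_apply_of_geodesic_equation hV hx hv hw,
    sum_half_add_swap_sub_mul (fun j k => pd (fun z => metricCoeff F z v b j) k x),
    hF.fderiv_momentum_fst hV hx hv, PiLp.smul_apply, hgrad, hF.fderiv_sq_fst hV hx hv,
    smul_eq_mul]
  ring

theorem gradFst_sq_smul {t : ℝ} (ht : 0 ≤ t) (htv : t • v ≠ 0) :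
    gradFst (sq F) (x, t • v) = t ^ 2 • gradFst (sq F) (x, v) := by
  rw [← gradient_comp_prodMk_left ((hF.contDiffAt_sq hV hx htv).differentiableAt (by simp)),
    gradFst, gradAlong, ← map_smul, gradient]
  have heq : (fun z => sq F (z, t • v)) =ᶠ[𝓝 x] fun z => t ^ 2 * sq F (z, v) := by
    filter_upwards [hV.mem_nhds hx] with z hz using hF.sq_smul hz v ht
  rw [heq.fderiv_eq, HasFDerivAt.fderiv ((hasFDerivAt_comp_prodMk_left
    ((hF.contDiffAt_sq hV hx hv).differentiableAt (by simp))).const_mul (t ^ 2))]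

theorem force_momentum :
    force F (x, momentum F (x, v)) = (1 / 2 : ℝ) • gradFst (sq F) (x, v) := by
  rw [force, hF.colegendre_momentum hV hx hv]

end Velocity

theorem force_smul (hξ : ξ ≠ 0) {t : ℝ} (ht : 0 < t) :
    force F (x, t • ξ) = t ^ 2 • force F (x, ξ) := by
  have hv := hF.colegendre_ne_zero hV hx hξ
  simp only [force]
  rw [hF.colegendre_smul hV hx hξ ht,
    hF.gradFst_sq_smul hV hx hv ht.le (smul_ne_zero ht.ne' hv), smul_comm]

end IsFinsler

namespace IsGeodesic

variable {c : ℝ → Sp d} {t : ℝ} (hc : IsGeodesic F c)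
include hc

theorem hasDerivWithinAt (ht : t ∈ Icc (0 : ℝ) 1) :
    HasDerivWithinAt c (velocity c t) (Icc 0 1) t :=
  ((hc.contDiff.differentiableOn (by simp)) t ht).hasDerivWithinAt

theorem differentiableOn_velocity : DifferentiableOn ℝ (velocity c) (Icc 0 1) :=
  (hc.contDiff.derivWithin (m := 1) (uniqueDiffOn_Icc zero_lt_one) (by norm_num)).differentiableOn
    (by simp)

variable (hV : IsOpen V) (hF : IsFinsler V F)
include hV hF

theorem hasDerivWithinAt_momentum (ht : t ∈ Icc (0 : ℝ) 1) (hct : c t ∈ V)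
    (hv : velocity c t ≠ 0) :
    HasDerivWithinAt (fun s => momentum F (c s, velocity c s))
      (force F (c t, momentum F (c t, velocity c t))) (Icc 0 1) t := by
  rw [hF.force_momentum hV hct hv,
    ← hF.fderiv_momentum_of_geodesic_equation hV hct hv (hc.equation t ht)]
  exact ((hF.contDiffAt_momentum hV hct hv).differentiableAt (by simp)).hasFDerivAt
    |>.comp_hasDerivWithinAt t ((hc.hasDerivWithinAt ht).prodMk
      (hc.differentiableOn_velocity t ht).hasDerivWithinAt)

variable (hcV : MapsTo c (Icc 0 1) V)
include hcV

theorem hasDerivWithinAt_sq_of_ne_zero (ht : t ∈ Icc (0 : ℝ) 1) (hv : velocity c t ≠ 0) :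
    HasDerivWithinAt (fun s => sq F (c s, velocity c s)) 0 (Icc 0 1) t := by
  have hm := hF.momentum_ne_zero hV (hcV ht) hv
  have hham := ((((hF.contDiffAt_ham hV (hcV ht) hm).differentiableAt
    (by simp)).hasFDerivAt).comp_hasDerivWithinAt_of_eq t ((hc.hasDerivWithinAt ht).prodMk
    (hc.hasDerivWithinAt_momentum hV hF ht (hcV ht) hv)) rfl).const_mul 2
  rw [hF.fderiv_ham hV (hcV ht) hm, hF.colegendre_momentum hV (hcV ht) hv, real_inner_comm,
    sub_self, mul_zero] at hham
  refine hham.congr_of_eventuallyEq_of_mem ?_ ht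
  filter_upwards [(hc.differentiableOn_velocity.continuousOn t ht).eventually_ne hv,
    self_mem_nhdsWithin] with s hs hs'
  simp only [Function.comp_apply, sq]
  rw [hF.ham_eq hV (hcV hs') (hF.momentum_ne_zero hV (hcV hs') hs),
    hF.dual_momentum hV (hcV hs') hs]
  ring

theorem hasDerivWithinAt_sq (ht : t ∈ Icc (0 : ℝ) 1) :
    HasDerivWithinAt (fun s => sq F (c s, velocity c s)) 0 (Icc 0 1) t := by
  obtain ⟨C, -, hCF⟩ := hF.exists_le_mul_norm hV
    (isCompact_Icc.image_of_continuousOn hc.contDiff.continuousOn) (image_subset_iff.2 hcV)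
  by_cases hv : velocity c t = 0
  · refine hasDerivWithinAt_zero_of_norm_le_mul_norm_sq (C := C ^ 2)
      (hc.differentiableOn_velocity t ht).hasDerivWithinAt hv ht fun s hs => ?_
    have hnonneg := hF.nonneg _ (hcV hs) (velocity c s)
    rw [sq, Real.norm_of_nonneg (by positivity), ← mul_pow]
    gcongr
    exact (hCF _ (mem_image_of_mem c hs) (velocity c s)).1
  · exact hc.hasDerivWithinAt_sq_of_ne_zero hV hF hcV ht hv

theorem speed_eq (ht : t ∈ Icc (0 : ℝ) 1) :
    F (c t) (velocity c t) = F (c 0) (velocity c 0) := by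
  have hconst := constant_of_derivWithin_zero
    (fun t ht => (hc.hasDerivWithinAt_sq hV hF hcV ht).differentiableWithinAt)
    (fun t ht => (hc.hasDerivWithinAt_sq hV hF hcV (Ico_subset_Icc_self ht)).derivWithin
      (uniqueDiffOn_Icc zero_lt_one t (Ico_subset_Icc_self ht))) t ht
  exact (sq_eq_sq₀ (hF.nonneg _ (hcV ht) _) (hF.nonneg _ (hcV (by simp)) _)).1 hconst

theorem velocity_ne_zero {s : ℝ} (hs : s ∈ Icc (0 : ℝ) 1) (hv : velocity c s ≠ 0)
    (ht : t ∈ Icc (0 : ℝ) 1) : velocity c t ≠ 0 := fun h₀ => by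
  have h := (hc.speed_eq hV hF hcV hs).trans (hc.speed_eq hV hF hcV ht).symm
  rw [h₀, hF.apply_zero (hcV ht)] at h
  exact (hF.pos hV (hcV hs) hv).ne' h

end IsGeodesic

end Geodesic

section Eikonal

/-- `u` is a smooth solution on `W` of the eikonal equation `F_*(x, ∇u) = 1`. -/
structure IsEikonal (F : Sp d → Sp d → ℝ) (W : Set (Sp d)) (u : Sp d → ℝ) : Prop where
  smooth : ContDiffOn ℝ ∞ u W
  dual_eq : ∀ x ∈ W, dual F x (gradient u x) = 1

/-- The unit vector field whose integral curves are the characteristics of `u`. -/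
def ray (F : Sp d → Sp d → ℝ) (u : Sp d → ℝ) (x : Sp d) : Sp d := colegendre F (x, gradient u x)

/-- `c` is a characteristic of `u` in `W`, an integral curve of the ray field, parametrized by
`[0,1]` with the constant signed speed `τ`. -/
structure IsCharacteristic (F : Sp d → Sp d → ℝ) (W : Set (Sp d)) (u : Sp d → ℝ) (τ : ℝ)
    (c : ℝ → Sp d) : Prop where
  mapsTo : MapsTo c (Icc 0 1) W
  hasDerivWithinAt : ∀ t ∈ Icc (0 : ℝ) 1,
    HasDerivWithinAt c (τ • ray F u (c t)) (Icc 0 1) t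

variable {W : Set (Sp d)} {F : Sp d → Sp d → ℝ} {u : Sp d → ℝ} {x : Sp d}

namespace IsEikonal

variable (hu : IsEikonal F W u) (hx : x ∈ W)
include hu hx

theorem gradient_ne_zero : gradient u x ≠ 0 := ne_zero_of_mem_cosphere (hu.dual_eq x hx)

variable (hW : IsOpen W)
include hW

theorem contDiffAt : ContDiffAt ℝ ∞ u x := hu.smooth.contDiffAt (hW.mem_nhds hx)

theorem contDiffAt_gradient : ContDiffAt ℝ ∞ (gradient u) x :=
  Finsler.contDiffAt_gradient (hu.contDiffAt hx hW) (by simp)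

variable (hF : IsFinsler W F)
include hF

theorem ray_ne_zero : ray F u x ≠ 0 := hF.colegendre_ne_zero hW hx (hu.gradient_ne_zero hx)

theorem momentum_ray : momentum F (x, ray F u x) = gradient u x :=
  hF.momentum_colegendre hW hx (hu.gradient_ne_zero hx)

theorem apply_ray : F x (ray F u x) = 1 := by
  rw [ray, hF.apply_colegendre hW hx (hu.gradient_ne_zero hx), hu.dual_eq x hx]

theorem inner_gradient_ray : inner ℝ (gradient u x) (ray F u x) = 1 := by
  rw [ray, hF.inner_colegendre hW hx (hu.gradient_ne_zero hx), hu.dual_eq x hx, one_pow]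

theorem inner_gradient_le (w : Sp d) : inner ℝ (gradient u x) w ≤ F x w := by
  simpa [hu.dual_eq x hx] using hF.inner_le_dual_mul hW hx (hu.gradient_ne_zero hx) w

theorem contDiffAt_ray : ContDiffAt ℝ ∞ (ray F u) x :=
  (hF.contDiffAt_colegendre hW hx (hu.gradient_ne_zero hx)).comp x
    (contDiffAt_id.prodMk (hu.contDiffAt_gradient hx hW))

theorem momentum_smul_ray {L : ℝ} (hL : 0 < L) :
    momentum F (x, L • ray F u x) = L • gradient u x := by
  rw [hF.momentum_smul hW hx (hu.ray_ne_zero hx hW hF) hL, hu.momentum_ray hx hW hF]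

theorem fderiv_gradient_ray :
    fderiv ℝ (gradient u) x (ray F u x) = force F (x, gradient u x) := by
  refine ext_inner_right ℝ fun w => ?_
  have hne := hu.gradient_ne_zero hx
  have hderiv := ((hF.contDiffAt_ham hW hx hne).differentiableAt (by simp)).hasFDerivAt.comp x
    ((hasFDerivAt_id x).prodMk
      ((hu.contDiffAt_gradient hx hW).differentiableAt (by simp)).hasFDerivAt)
  have hconst : (ham F ∘ fun y => (id y, gradient u y)) =ᶠ[𝓝 x] fun _ => 1 / 2 := by
    filter_upwards [hW.mem_nhds hx] with y hy
    simp only [Function.comp_apply, id]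
    rw [hF.ham_eq hW hy (hu.gradient_ne_zero hy), hu.dual_eq y hy]; norm_num
  have hzero := congrArg (fun g => g w)
    (hderiv.unique ((hasFDerivAt_const (1 / 2 : ℝ) x).congr_of_eventuallyEq hconst))
  simp only [ContinuousLinearMap.comp_apply, ContinuousLinearMap.prod_apply,
    ContinuousLinearMap.id_apply, zero_apply] at hzero
  rw [hF.fderiv_ham hW hx hne, sub_eq_zero] at hzero
  rw [inner_fderiv_gradient_comm ((hu.contDiffAt hx hW).of_le two_le_infty), ← hzero,
    real_inner_comm]
  rfl

end IsEikonal

theorem eq_zero_of_norm_deriv_le_right {E : Type*} [NormedAddCommGroup E] [NormedSpace ℝ E]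
    {f f' : ℝ → E} {a b K : ℝ} (hf : ∀ t ∈ Icc a b, HasDerivWithinAt f (f' t) (Icc a b) t)
    (hK : ∀ t ∈ Icc a b, ‖f' t‖ ≤ K * ‖f t‖) (ha : f a = 0) : ∀ t ∈ Icc a b, f t = 0 :=
  eq_zero_of_abs_deriv_le_mul_abs_self_of_eq_zero_right
    (fun t ht => (hf t ht).continuousWithinAt)
    (fun t ht => (hf t (Ico_subset_Icc_self ht)).mono_of_mem_nhdsWithin (Icc_mem_nhdsGE_of_mem ht))
    ha (fun t ht => hK t (Ico_subset_Icc_self ht))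

theorem eq_zero_of_norm_deriv_le {E : Type*} [NormedAddCommGroup E] [NormedSpace ℝ E]
    {f f' : ℝ → E} {a b t₀ K : ℝ} (ht₀ : t₀ ∈ Icc a b)
    (hf : ∀ t ∈ Icc a b, HasDerivWithinAt f (f' t) (Icc a b) t)
    (hK : ∀ t ∈ Icc a b, ‖f' t‖ ≤ K * ‖f t‖) (h₀ : f t₀ = 0) {t : ℝ} (ht : t ∈ Icc a b) :
    f t = 0 := by
  rcases le_total t₀ t with h | h
  · have hsub : Icc t₀ b ⊆ Icc a b := Icc_subset_Icc_left ht₀.1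
    exact eq_zero_of_norm_deriv_le_right (fun s hs => (hf s (hsub hs)).mono hsub)
      (fun s hs => hK s (hsub hs)) h₀ t ⟨h, ht.2⟩
  · have hneg : MapsTo (fun s : ℝ => -s) (Icc (-t₀) (-a)) (Icc a b) := fun s hs =>
      ⟨by linarith [hs.2], by linarith [hs.1, ht₀.2]⟩
    have hf_neg : ∀ s ∈ Icc (-t₀) (-a),
        HasDerivWithinAt (fun s => f (-s)) (-f' (-s)) (Icc (-t₀) (-a)) s := fun s hs => by
      simpa [Function.comp_def] using
        (hf (-s) (hneg hs)).scomp s (hasDerivAt_neg s).hasDerivWithinAt hneg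
    simpa using eq_zero_of_norm_deriv_le_right hf_neg
      (fun s hs => by simpa using hK _ (hneg hs)) (by simpa using h₀) (-t)
      ⟨by linarith, by linarith [ht.1]⟩

theorem exists_lipschitzOnWith_of_contDiffAt {E G : Type*} [NormedAddCommGroup E]
    [NormedSpace ℝ E] [NormedAddCommGroup G] [NormedSpace ℝ G] {f : E → G} {K : Set E}
    (hK : IsCompact K) (hf : ∀ z ∈ K, ContDiffAt ℝ 1 f z) : ∃ C, LipschitzOnWith C f K :=
  LocallyLipschitzOn.exists_lipschitzOnWith_of_compact hK fun z hz =>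
    have ⟨C, N, hN, hC⟩ := (hf z hz).exists_lipschitzOnWith
    ⟨C, N, mem_nhdsWithin_of_mem_nhds hN, hC⟩

/-- Along a geodesic, the derivative of the difference between its momentum and `L ∇u`, as a
function of position and momentum. -/
def momentumDefect (F : Sp d → Sp d → ℝ) (u : Sp d → ℝ) (L : ℝ) (z : Sp d × Sp d) : Sp d :=
  force F z - L • fderiv ℝ (gradient u) z.1 (colegendre F z)

section Characteristic

variable (hW : IsOpen W) (hF : IsFinsler W F) (hu : IsEikonal F W u)
include hW hF hu

theorem IsEikonal.contDiffAt_momentumDefect (hx : x ∈ W) {ξ : Sp d} (hξ : ξ ≠ 0) (L : ℝ) :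
    ContDiffAt ℝ ∞ (momentumDefect F u L) (x, ξ) :=
  (hF.contDiffAt_force hW hx hξ).sub (.const_smul L (.clm_apply
    (((hu.contDiffAt_gradient hx hW).fderiv_right (m := ∞) (by simp)).comp (x, ξ) contDiffAt_fst)
    (hF.contDiffAt_colegendre hW hx hξ)))

theorem IsEikonal.momentumDefect_smul_gradient (hx : x ∈ W) {L : ℝ} (hL : 0 < L) :
    momentumDefect F u L (x, L • gradient u x) = 0 := by
  have hne := hu.gradient_ne_zero hx
  rw [momentumDefect, hF.force_smul hW hx hne hL, hF.colegendre_smul hW hx hne hL, map_smul,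
    ← ray, hu.fderiv_gradient_ray hx hW hF, smul_smul, pow_two, sub_self]

theorem IsGeodesic.hasDerivWithinAt_momentum_sub {c : ℝ → Sp d} (hc : IsGeodesic F c) {t : ℝ}
    (ht : t ∈ Icc (0 : ℝ) 1) (hct : c t ∈ W) (hv : velocity c t ≠ 0) (L : ℝ) :
    HasDerivWithinAt (fun s => momentum F (c s, velocity c s) - L • gradient u (c s))
      (momentumDefect F u L (c t, momentum F (c t, velocity c t))) (Icc 0 1) t := by
  rw [momentumDefect, hF.colegendre_momentum hW hct hv]
  exact (hc.hasDerivWithinAt_momentum hW hF ht hct hv).sub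
    ((((hu.contDiffAt_gradient hct hW).differentiableAt (by simp)).hasFDerivAt
      |>.comp_hasDerivWithinAt t (hc.hasDerivWithinAt ht)).const_smul L)

theorem IsGeodesic.velocity_eq_ray {c : ℝ → Sp d} (hc : IsGeodesic F c)
    (hcW : MapsTo c (Icc 0 1) W) {L : ℝ} (hL : 0 < L) {t₀ : ℝ} (ht₀ : t₀ ∈ Icc (0 : ℝ) 1)
    (h₀ : velocity c t₀ = L • ray F u (c t₀)) {t : ℝ} (ht : t ∈ Icc (0 : ℝ) 1) :
    velocity c t = L • ray F u (c t) := by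
  have hv : ∀ s ∈ Icc (0 : ℝ) 1, velocity c s ≠ 0 := fun s => hc.velocity_ne_zero hW hF hcW ht₀
    (h₀ ▸ smul_ne_zero hL.ne' (hu.ray_ne_zero (hcW ht₀) hW hF))
  set m : ℝ → Sp d × Sp d := fun s => (c s, momentum F (c s, velocity c s))
  set p : ℝ → Sp d × Sp d := fun s => (c s, L • gradient u (c s))
  have hm : ContinuousOn m (Icc 0 1) := fun s hs => (hc.contDiff.continuousOn s hs).prodMk
    (hc.hasDerivWithinAt_momentum hW hF hs (hcW hs) (hv s hs)).continuousWithinAt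
  have hp : ContinuousOn p (Icc 0 1) := fun s hs => (hc.contDiff.continuousOn s hs).prodMk
    (((hu.contDiffAt_gradient (hcW hs) hW).continuousAt.comp_continuousWithinAt
      (hc.contDiff.continuousOn s hs)).const_smul L)
  obtain ⟨K, hK⟩ := exists_lipschitzOnWith_of_contDiffAt (f := momentumDefect F u L)
    ((isCompact_Icc.image_of_continuousOn hm).union (isCompact_Icc.image_of_continuousOn hp)) <| by
      rintro _ (⟨s, hs, rfl⟩ | ⟨s, hs, rfl⟩)
      · exact (hu.contDiffAt_momentumDefect hW hF (hcW hs)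
          (hF.momentum_ne_zero hW (hcW hs) (hv s hs)) L).of_le (by simp)
      · exact (hu.contDiffAt_momentumDefect hW hF (hcW hs)
          (smul_ne_zero hL.ne' (hu.gradient_ne_zero (hcW hs))) L).of_le (by simp)
  have hbound : ∀ s ∈ Icc (0 : ℝ) 1, ‖momentumDefect F u L (m s)‖ ≤
      K * ‖momentum F (c s, velocity c s) - L • gradient u (c s)‖ := fun s hs => by
    have h := hK.norm_sub_le (.inl (mem_image_of_mem m hs)) (.inr (mem_image_of_mem p hs))
    rw [hu.momentumDefect_smul_gradient hW hF (hcW hs) hL, sub_zero] at h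
    simpa [m, p, Prod.norm_def] using h
  have hzero := eq_zero_of_norm_deriv_le ht₀ (fun s hs =>
    hc.hasDerivWithinAt_momentum_sub hW hF hu hs (hcW hs) (hv s hs) L) hbound
    (by rw [h₀, hu.momentum_smul_ray (hcW ht₀) hW hF hL, sub_self]) ht
  rw [← hu.momentum_smul_ray (hcW ht) hW hF hL, sub_eq_zero] at hzero
  exact (hF.momentum_injective hW (hcW ht) (hv t ht)
    (smul_ne_zero hL.ne' (hu.ray_ne_zero (hcW ht) hW hF)) hzero).symm

end Characteristic

end Eikonal

section Calibration

variable {W : Set (Sp d)} {F : Sp d → Sp d → ℝ} {u : Sp d → ℝ} {c c' : ℝ → Sp d} {L : ℝ}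

section

variable (hW : IsOpen W) (hF : IsFinsler W F) (hc : IsGeodesic F c) (hcW : MapsTo c (Icc 0 1) W)
include hW hF hc hcW

theorem IsGeodesic.length_eq : length F c = F (c 0) (velocity c 0) := by
  rw [length, intervalIntegral.integral_congr (g := fun _ => F (c 0) (velocity c 0))]
  · simp
  · intro t ht
    rw [uIcc_of_le zero_le_one] at ht
    exact hc.speed_eq hW hF hcW ht

theorem IsGeodesic.speed_pos (hne : c 0 ≠ c 1) : 0 < F (c 0) (velocity c 0) := by
  refine hF.pos hW (hcW (by simp)) fun h₀ => hne ?_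
  have hv : ∀ t ∈ Icc (0 : ℝ) 1, velocity c t = 0 := fun t ht =>
    of_not_not fun hv => hc.velocity_ne_zero hW hF hcW ht hv (by simp) h₀
  exact (constant_of_derivWithin_zero (hc.contDiff.differentiableOn (by simp))
    (fun t ht => hv t (Ico_subset_Icc_self ht)) 1 (by simp)).symm

end

namespace IsEikonal

variable (hW : IsOpen W) (hu : IsEikonal F W u)
  (hc : ∀ t ∈ Icc (0 : ℝ) 1, HasDerivWithinAt c (c' t) (Icc 0 1) t) (hcW : MapsTo c (Icc 0 1) W)
include hW hu hc hcW

theorem hasDerivWithinAt_mul_sub (L : ℝ) {t : ℝ} (ht : t ∈ Icc (0 : ℝ) 1) :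
    HasDerivWithinAt (fun t => L * t - u (c t)) (L - inner ℝ (gradient u (c t)) (c' t))
      (Icc 0 1) t := by
  have hu_diff := (hu.contDiffAt (hcW ht) hW).differentiableAt (by simp)
  have h := ((hasDerivWithinAt_id t (Icc 0 1)).const_mul L).sub
    (hu_diff.hasFDerivAt.comp_hasDerivWithinAt t (hc t ht))
  rwa [mul_one, ← inner_gradient_left] at h

variable (hF : IsFinsler W F)
include hF

theorem monotoneOn_mul_sub (hL : ∀ t ∈ Icc (0 : ℝ) 1, F (c t) (c' t) ≤ L) :
    MonotoneOn (fun t => L * t - u (c t)) (Icc 0 1) := by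
  have hderiv {t : ℝ} := hu.hasDerivWithinAt_mul_sub (t := t) hW hc hcW L
  refine monotoneOn_of_hasDerivWithinAt_nonneg (convex_Icc 0 1)
    (fun t ht => (hderiv ht).continuousWithinAt)
    (fun t ht => (hderiv (interior_subset ht)).mono interior_subset) fun t ht => ?_
  have ht' := interior_subset ht
  linarith [hu.inner_gradient_le (hcW ht') hW hF (c' t), hL t ht']

theorem sub_le_of_speed_le (hL : ∀ t ∈ Icc (0 : ℝ) 1, F (c t) (c' t) ≤ L) :
    u (c 1) - u (c 0) ≤ L := by
  have h := hu.monotoneOn_mul_sub hW hc hcW hF hL (left_mem_Icc.2 zero_le_one)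
    (right_mem_Icc.2 zero_le_one) zero_le_one
  simp only [mul_zero, mul_one] at h
  linarith

theorem inner_gradient_eq_of_sub_eq (hL : ∀ t ∈ Icc (0 : ℝ) 1, F (c t) (c' t) ≤ L)
    (h : u (c 1) - u (c 0) = L) {t : ℝ} (ht : t ∈ Icc (0 : ℝ) 1) :
    inner ℝ (gradient u (c t)) (c' t) = L := by
  have hmono := hu.monotoneOn_mul_sub hW hc hcW hF hL
  have hconst : ∀ t ∈ Icc (0 : ℝ) 1, L * t - u (c t) = -u (c 0) := by
    intro t ht
    have hleft := hmono (left_mem_Icc.2 zero_le_one) ht ht.1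
    have hright := hmono ht (right_mem_Icc.2 zero_le_one) ht.2
    simp only [mul_zero, mul_one] at hleft hright
    linarith
  have hderiv := (uniqueDiffOn_Icc zero_lt_one t ht).eq_deriv _
    (hu.hasDerivWithinAt_mul_sub hW hc hcW L ht)
    ((hasDerivWithinAt_const t (Icc 0 1) (-u (c 0))).congr hconst (hconst t ht))
  linarith

theorem eq_smul_ray_of_sub_eq (hL₀ : 0 < L) (hL : ∀ t ∈ Icc (0 : ℝ) 1, F (c t) (c' t) = L)
    (h : u (c 1) - u (c 0) = L) {t : ℝ} (ht : t ∈ Icc (0 : ℝ) 1) :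
    c' t = L • ray F u (c t) := by
  have hspeed : F (c t) (L • ray F u (c t)) = L := by
    rw [hF.homogeneous _ (hcW ht) _ L hL₀.le, hu.apply_ray (hcW ht) hW hF, mul_one]
  refine hF.eq_of_inner_momentum_eq hW (hcW ht)
    (smul_ne_zero hL₀.ne' (hu.ray_ne_zero (hcW ht) hW hF)) (hspeed.trans (hL t ht).symm) ?_
  rw [hu.momentum_smul_ray (hcW ht) hW hF hL₀, real_inner_smul_left, hspeed, hL t ht,
    hu.inner_gradient_eq_of_sub_eq hW hc hcW hF (fun t ht => (hL t ht).le) h ht]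

end IsEikonal

theorem IsCharacteristic.sub_eq (hc : IsCharacteristic F W u L c) (hW : IsOpen W)
    (hF : IsFinsler W F) (hu : IsEikonal F W u) : u (c 1) - u (c 0) = L := by
  have hderiv : ∀ t ∈ Icc (0 : ℝ) 1,
      HasDerivWithinAt (fun t => L * t - u (c t)) 0 (Icc 0 1) t := fun t ht => by
    simpa [inner_smul_right, hu.inner_gradient_ray (hc.mapsTo ht) hW hF] using
      hu.hasDerivWithinAt_mul_sub hW hc.hasDerivWithinAt hc.mapsTo L ht
  have h := constant_of_derivWithin_zero (fun t ht => (hderiv t ht).differentiableWithinAt)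
    (fun t ht => (hderiv t (Ico_subset_Icc_self ht)).derivWithin
      (uniqueDiffOn_Icc zero_lt_one t (Ico_subset_Icc_self ht))) 1 (by simp)
  simp only [mul_one, mul_zero] at h
  linarith

end Calibration

section Bounds

theorem eventually_norm_le_of_continuousOn {Z E : Type*} [TopologicalSpace Z]
    [SeminormedAddCommGroup E] {S : Set Z} {f : Z → E} (hS : IsCompact S)
    (hf : ContinuousOn f S) : ∀ᶠ B : ℝ in atTop, ∀ z ∈ S, ‖f z‖ ≤ B := by
  obtain ⟨C, hC⟩ := hS.exists_bound_of_continuousOn hf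
  filter_upwards [eventually_ge_atTop C] with B hCB z hz using (hC z hz).trans hCB

theorem exists_pos_mul_norm_sq_le_inner {Z E : Type*} [TopologicalSpace Z] [NormedAddCommGroup E]
    [InnerProductSpace ℝ E] [FiniteDimensional ℝ E] {S : Set Z} {A : Z → E →L[ℝ] E}
    (hS : IsCompact S) (hA : ContinuousOn A S) (hpos : ∀ z ∈ S, ∀ w ≠ 0, 0 < inner ℝ w (A z w)) :
    ∃ κ > 0, ∀ z ∈ S, ∀ w, κ * ‖w‖ ^ 2 ≤ inner ℝ w (A z w) := by
  have hcont : ContinuousOn (fun y : Z × E => inner ℝ y.2 (A y.1 y.2))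
      (S ×ˢ Metric.sphere 0 1) :=
    continuousOn_snd.inner ((hA.comp continuousOn_fst fun _ hy => hy.1).clm_apply continuousOn_snd)
  have : ProperSpace E := FiniteDimensional.proper ℝ E
  obtain ⟨κ, hκ, hmin⟩ := (hS.prod (isCompact_sphere 0 1)).exists_forall_le' hcont
    fun y hy => hpos y.1 hy.1 y.2 (ne_zero_of_mem_unit_sphere ⟨y.2, hy.2⟩)
  refine ⟨κ, hκ, fun z hz w => ?_⟩
  rcases eq_or_ne w 0 with rfl | hw
  · simp
  have hnorm : 0 < ‖w‖ := norm_pos_iff.2 hw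
  have hunit := hmin (z, ‖w‖⁻¹ • w) ⟨hz, by simp [norm_smul, hnorm.ne']⟩
  simp only [map_smul, real_inner_smul_left, inner_smul_right] at hunit
  rwa [← mul_assoc, ← mul_inv, ← pow_two, le_inv_mul_iff₀ (by positivity), mul_comm] at hunit

variable {V W K : Set (Sp d)} {F : Sp d → Sp d → ℝ} {B κ : ℝ}

/-- The unit cosphere bundle over `K`. -/
def cosphereBundle (F : Sp d → Sp d → ℝ) (K : Set (Sp d)) : Set (Sp d × Sp d) :=
  {z | z.1 ∈ K ∧ z.2 ∈ cosphere F z.1}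

theorem IsFinsler.isCompact_cosphereBundle (hV : IsOpen V) (hF : IsFinsler V F)
    (hK : IsCompact K) (hKV : K ⊆ V) : IsCompact (cosphereBundle F K) := by
  have hne : ∀ ξ ∈ Metric.sphere (0 : Sp d) 1, ξ ≠ 0 := fun ξ hξ =>
    ne_zero_of_mem_unit_sphere (⟨ξ, hξ⟩ : Metric.sphere (0 : Sp d) 1)
  have hcont : ContinuousOn (fun z : Sp d × Sp d => (z.1, (dual F z.1 z.2)⁻¹ • z.2))
      (K ×ˢ Metric.sphere (0 : Sp d) 1) := fun z hz =>
    (continuousAt_fst.prodMk (((hF.contDiffAt_dual hV (hKV hz.1) (hne _ hz.2)).continuousAt.inv₀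
      (hF.dual_pos hV (hKV hz.1) (hne _ hz.2)).ne').smul continuousAt_snd)).continuousWithinAt
  convert (hK.prod (isCompact_sphere (0 : Sp d) 1)).image_of_continuousOn hcont using 1
  refine Subset.antisymm (fun ⟨x, ξ⟩ ⟨hx, (hξ : dual F x ξ = 1)⟩ => ?_) ?_
  · have hξ₀ := ne_zero_of_mem_cosphere hξ
    refine ⟨(x, ‖ξ‖⁻¹ • ξ), ⟨hx, by simp [norm_smul, hξ₀]⟩, ?_⟩
    simp only at hx
    simp only [hF.dual_smul hV (hKV hx) hξ₀ (inv_pos.2 (norm_pos_iff.2 hξ₀)), hξ, mul_one, inv_inv,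
      smul_smul, mul_inv_cancel₀ (norm_ne_zero_iff.2 hξ₀), one_smul]
  · rintro _ ⟨z, ⟨hx, hξ⟩, rfl⟩
    have hpos := hF.dual_pos hV (hKV hx) (hne _ hξ)
    refine ⟨hx, ?_⟩
    simp only [cosphere, mem_ofPred_eq]
    rw [hF.dual_smul hV (hKV hx) (hne _ hξ) (inv_pos.2 hpos), inv_mul_cancel₀ hpos.ne']

/-- Uniform bounds for the Hamiltonian vector field `(colegendre F, -force F)` and its first
derivatives on the cosphere bundle over `K`. -/
structure HamiltonianBounds (F : Sp d → Sp d → ℝ) (K : Set (Sp d)) (B κ : ℝ) : Prop where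
  one_le : 1 ≤ B
  kappa_pos : 0 < κ
  norm_covector : ∀ z ∈ cosphereBundle F K, ‖z.2‖ ≤ B
  norm_colegendre : ∀ z ∈ cosphereBundle F K, ‖colegendre F z‖ ≤ B
  norm_force : ∀ z ∈ cosphereBundle F K, ‖force F z‖ ≤ B
  norm_fderiv_colegendre : ∀ z ∈ cosphereBundle F K, ‖fderiv ℝ (colegendre F) z‖ ≤ B
  norm_fderiv_force : ∀ z ∈ cosphereBundle F K, ‖fderiv ℝ (force F) z‖ ≤ B
  coercive : ∀ z ∈ cosphereBundle F K, ∀ w,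
    κ * ‖w‖ ^ 2 ≤ inner ℝ w (fderiv ℝ (colegendre F) z (0, w))

theorem HamiltonianBounds.mono (hB : HamiltonianBounds F K B κ) (hWK : W ⊆ K) :
    HamiltonianBounds F W B κ :=
  have hsub : cosphereBundle F W ⊆ cosphereBundle F K := fun _ hz => ⟨hWK hz.1, hz.2⟩
  ⟨hB.one_le, hB.kappa_pos, fun z hz => hB.norm_covector z (hsub hz),
    fun z hz => hB.norm_colegendre z (hsub hz), fun z hz => hB.norm_force z (hsub hz),
    fun z hz => hB.norm_fderiv_colegendre z (hsub hz),
    fun z hz => hB.norm_fderiv_force z (hsub hz), fun z hz => hB.coercive z (hsub hz)⟩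

theorem IsFinsler.exists_hamiltonianBounds (hV : IsOpen V) (hF : IsFinsler V F)
    (hK : IsCompact K) (hKV : K ⊆ V) : ∃ B κ, HamiltonianBounds F K B κ := by
  have hZ := hF.isCompact_cosphereBundle hV hK hKV
  have hcolegendre : ∀ z ∈ cosphereBundle F K, ContDiffAt ℝ ∞ (colegendre F) z := fun z hz =>
    hF.contDiffAt_colegendre hV (hKV hz.1) (ne_zero_of_mem_cosphere hz.2)
  have hforce : ∀ z ∈ cosphereBundle F K, ContDiffAt ℝ ∞ (force F) z := fun z hz =>
    hF.contDiffAt_force hV (hKV hz.1) (ne_zero_of_mem_cosphere hz.2)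
  have hfderiv {f : Sp d × Sp d → Sp d} (hf : ∀ z ∈ cosphereBundle F K, ContDiffAt ℝ ∞ f z) :
      ContinuousOn (fderiv ℝ f) (cosphereBundle F K) := fun z hz =>
    ((hf z hz).fderiv_right (m := ∞) (by simp)).continuousAt.continuousWithinAt
  obtain ⟨κ, hκ, hcoercive⟩ := exists_pos_mul_norm_sq_le_inner hZ
    (A := fun z => (fderiv ℝ (colegendre F) z).comp (.inr ℝ (Sp d) (Sp d)))
    ((hfderiv hcolegendre).clm_comp continuousOn_const) fun z hz w hw =>
      hF.inner_fderiv_colegendre_pos hV (hKV hz.1) (ne_zero_of_mem_cosphere hz.2) hw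
  obtain ⟨B, hB₁, hcov, hco, hfo, hdco, hdfo⟩ := ((eventually_ge_atTop 1).and <|
    (eventually_norm_le_of_continuousOn hZ continuousOn_snd).and <|
    (eventually_norm_le_of_continuousOn hZ fun z hz =>
      (hcolegendre z hz).continuousAt.continuousWithinAt).and <|
    (eventually_norm_le_of_continuousOn hZ fun z hz =>
      (hforce z hz).continuousAt.continuousWithinAt).and <|
    (eventually_norm_le_of_continuousOn hZ (hfderiv hcolegendre)).and <|
    eventually_norm_le_of_continuousOn hZ (hfderiv hforce)).exists
  exact ⟨B, κ, hB₁, hκ, hcov, hco, hfo, hdco, hdfo, hcoercive⟩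

end Bounds

section Riccati

section

variable {E : Type*} [NormedAddCommGroup E]

section NormedSpace

variable [NormedSpace ℝ E]

theorem norm_prodMk_apply_le (A : E →L[ℝ] E) (w : E) :
    ‖(w, A w)‖ ≤ (1 + ‖A‖) * ‖w‖ := by
  rw [Prod.norm_def, add_mul, one_mul]
  exact max_le (le_add_of_nonneg_right (by positivity))
    ((A.le_opNorm w).trans (le_add_of_nonneg_left (norm_nonneg w)))

theorem eventually_add_smul_mem {W : Set E} (hW : IsOpen W) {x : E} (hx : x ∈ W) (w : E) :
    ∀ᶠ t : ℝ in 𝓝 0, x + t • w ∈ W :=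
  (by fun_prop : Continuous fun t : ℝ => x + t • w).continuousAt.eventually_mem
    (hW.mem_nhds (by simpa using hx))

theorem fderiv_apply_eq_zero_of_eventually {G : Type*} [NormedAddCommGroup G] [NormedSpace ℝ G]
    {f : E → G} {x w : E} (hf : DifferentiableAt ℝ f x) (h : ∀ᶠ t : ℝ in 𝓝 0, f (x + t • w) = 0) :
    fderiv ℝ f x w = 0 :=
  (hf.hasFDerivAt.hasLineDerivAt w).unique ((hasDerivAt_const 0 0).congr_of_eventuallyEq h)

end NormedSpace

variable [InnerProductSpace ℝ E]

section Vanishing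

variable [CompleteSpace E] {W : Set E} {u : E → ℝ} {x y ξ : E} (hW : IsOpen W)
  (hvan : ∀ x ∈ W, inner ℝ ξ (x - y) = 0 → u x = 0)
include hW hvan

theorem inner_gradient_eq_zero_of_vanishing (hx : x ∈ W) (hu : DifferentiableAt ℝ u x)
    (hxy : inner ℝ ξ (x - y) = 0) {w : E} (hw : inner ℝ ξ w = 0) :
    inner ℝ (gradient u x) w = 0 := by
  rw [inner_gradient_left]
  refine fderiv_apply_eq_zero_of_eventually hu ?_
  filter_upwards [eventually_add_smul_mem hW hx w] with t ht
  refine hvan _ ht ?_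
  rw [add_sub_right_comm, inner_add_right, inner_smul_right, hxy, hw, mul_zero, add_zero]

theorem inner_fderiv_gradient_eq_zero_of_vanishing (hy : y ∈ W) (hu : ContDiffOn ℝ 2 u W)
    {a b : E} (ha : inner ℝ ξ a = 0) (hb : inner ℝ ξ b = 0) :
    inner ℝ (fderiv ℝ (gradient u) y a) b = 0 := by
  have hgrad := (contDiffAt_gradient (hu.contDiffAt (hW.mem_nhds hy))
    one_add_one_eq_two.le).differentiableAt one_ne_zero
  have h := fderiv_inner_apply ℝ hgrad (differentiableAt_const b) a
  rw [fderiv_apply_eq_zero_of_eventually (hgrad.inner ℝ (differentiableAt_const b))] at h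
  · simpa using h.symm
  filter_upwards [eventually_add_smul_mem hW hy a] with t ht
  refine inner_gradient_eq_zero_of_vanishing hW hvan ht
    ((hu.contDiffAt (hW.mem_nhds ht)).differentiableAt two_ne_zero) ?_ hb
  rw [add_sub_cancel_left, inner_smul_right, ha, mul_zero]

end Vanishing

section SymmetricOperator

variable {G : E →L[ℝ] E} {ξ v : E} (hG : (G : E →ₗ[ℝ] E).IsSymmetric)
  (hzero : ∀ a b, inner ℝ ξ a = 0 → inner ℝ ξ b = 0 → inner ℝ (G a) b = 0)
  (hξv : inner ℝ ξ v = 1)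
include hG hzero hξv

theorem apply_eq_of_inner_eq_zero (a : E) :
    G a = inner ℝ (a - inner ℝ ξ a • v) (G v) • ξ + inner ℝ ξ a • G v := by
  have hperp : ∀ b, inner ℝ ξ (b - inner ℝ ξ b • v) = 0 := fun b => by
    rw [inner_sub_right, inner_smul_right, hξv, mul_one, sub_self]
  refine ext_inner_right ℝ fun b => ?_
  have h := hzero _ _ (hperp a) (hperp b)
  have hsymm : inner ℝ (G (a - inner ℝ ξ a • v)) v = inner ℝ (a - inner ℝ ξ a • v) (G v) := hG _ _
  rw [inner_sub_right, inner_smul_right, hsymm, map_sub, map_smul, inner_sub_left,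
    real_inner_smul_left] at h
  rw [inner_add_left, real_inner_smul_left, real_inner_smul_left]
  linarith

theorem norm_le_of_inner_eq_zero {B : ℝ} (hξB : ‖ξ‖ ≤ B) (hvB : ‖v‖ ≤ B) (hGv : ‖G v‖ ≤ B) :
    ‖G‖ ≤ B ^ 2 * (2 + B ^ 2) := by
  have hB : 0 ≤ B := (norm_nonneg _).trans hξB
  refine G.opNorm_le_bound (by positivity) fun a => ?_
  have hcoeff : |inner ℝ ξ a| ≤ B * ‖a‖ :=
    (abs_real_inner_le_norm _ _).trans (by gcongr)
  have htangent : ‖a - inner ℝ ξ a • v‖ ≤ (1 + B ^ 2) * ‖a‖ :=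
    calc ‖a - inner ℝ ξ a • v‖ ≤ ‖a‖ + |inner ℝ ξ a| * ‖v‖ := by
          simpa [norm_smul] using norm_sub_le a (inner ℝ ξ a • v)
      _ ≤ ‖a‖ + B * ‖a‖ * B := by gcongr
      _ = (1 + B ^ 2) * ‖a‖ := by ring
  rw [apply_eq_of_inner_eq_zero hG hzero hξv a]
  calc ‖inner ℝ (a - inner ℝ ξ a • v) (G v) • ξ + inner ℝ ξ a • G v‖
      ≤ |inner ℝ (a - inner ℝ ξ a • v) (G v)| * ‖ξ‖ + |inner ℝ ξ a| * ‖G v‖ := by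
        simpa [norm_smul] using
          norm_add_le (inner ℝ (a - inner ℝ ξ a • v) (G v) • ξ) (inner ℝ ξ a • G v)
    _ ≤ ‖a - inner ℝ ξ a • v‖ * ‖G v‖ * ‖ξ‖ + |inner ℝ ξ a| * ‖G v‖ := by
        gcongr; exact abs_real_inner_le_norm _ _
    _ ≤ (1 + B ^ 2) * ‖a‖ * B * B + B * ‖a‖ * B := by gcongr
    _ = B ^ 2 * (2 + B ^ 2) * ‖a‖ := by ring

end SymmetricOperator

end

theorem norm_sub_le_exp_sub_one_mul {E : Type*} [NormedAddCommGroup E] [NormedSpace ℝ E]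
    {f f' : ℝ → E} {a b k : ℝ} (hk : 0 < k)
    (hf : ∀ t ∈ Icc a b, HasDerivWithinAt f (f' t) (Icc a b) t)
    (hf' : ∀ t ∈ Icc a b, ‖f' t‖ ≤ k * ‖f t‖) {t : ℝ} (ht : t ∈ Icc a b) :
    ‖f t - f a‖ ≤ (Real.exp (k * (t - a)) - 1) * ‖f a‖ := by
  have hbound : ∀ s ∈ Ico a b, ‖f' s‖ ≤ k * ‖f s - f a‖ + k * ‖f a‖ := fun s hs =>
    (hf' s (Ico_subset_Icc_self hs)).trans <| by
      rw [← mul_add]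
      gcongr
      exact norm_le_norm_sub_add _ _
  have h := norm_le_gronwallBound_of_norm_deriv_right_le (δ := 0)
    (fun s hs => (hf s hs).continuousWithinAt.sub continuousWithinAt_const)
    (fun s hs => ((hf s (Ico_subset_Icc_self hs)).sub_const (f a)).mono_of_mem_nhdsWithin
      (Icc_mem_nhdsGE_of_mem hs)) (by simp) hbound t ht
  rw [gronwallBound_of_K_ne_0 hk.ne'] at h
  simpa [mul_div_cancel_left₀ _ hk.ne', mul_comm] using h

variable {W : Set (Sp d)} {F : Sp d → Sp d → ℝ} {u : Sp d → ℝ} {x : Sp d} {B κ : ℝ}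

namespace IsEikonal

variable (hu : IsEikonal F W u)
include hu

theorem mk_mem_cosphereBundle (hx : x ∈ W) : (x, gradient u x) ∈ cosphereBundle F W :=
  ⟨hx, hu.dual_eq x hx⟩

variable (hW : IsOpen W) (hF : IsFinsler W F)
include hW hF

theorem fderiv_ray (hx : x ∈ W) (w : Sp d) :
    fderiv ℝ (ray F u) x w =
      fderiv ℝ (colegendre F) (x, gradient u x) (w, fderiv ℝ (gradient u) x w) := by
  have h := ((hF.contDiffAt_colegendre hW hx (hu.gradient_ne_zero hx)).differentiableAt
    (by simp)).hasFDerivAt.comp x ((hasFDerivAt_id x).prodMk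
      ((hu.contDiffAt_gradient hx hW).differentiableAt (by simp)).hasFDerivAt)
  rw [show fderiv ℝ (ray F u) x = _ from h.fderiv]
  rfl

theorem fderiv_fderiv_gradient_ray (hx : x ∈ W) (w : Sp d) :
    fderiv ℝ (fderiv ℝ (gradient u)) x (ray F u x) w =
      fderiv ℝ (force F) (x, gradient u x) (w, fderiv ℝ (gradient u) x w) -
        fderiv ℝ (gradient u) x (fderiv ℝ (ray F u) x w) := by
  have hgrad := hu.contDiffAt_gradient hx hW
  have hleft := ((hgrad.fderiv_right (m := ∞) (by simp)).differentiableAt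
    (by simp)).hasFDerivAt.clm_apply
      ((hu.contDiffAt_ray hx hW hF).differentiableAt (by simp)).hasFDerivAt
  have hright := ((hF.contDiffAt_force hW hx (hu.gradient_ne_zero hx)).differentiableAt
    (by simp)).hasFDerivAt.comp x
      ((hasFDerivAt_id x).prodMk (hgrad.differentiableAt (by simp)).hasFDerivAt)
  have heq : (fun y => fderiv ℝ (gradient u) y (ray F u y)) =ᶠ[𝓝 x]
      (force F ∘ fun y => (id y, gradient u y)) := by
    filter_upwards [hW.mem_nhds hx] with y hy using hu.fderiv_gradient_ray hy hW hF
  rw [fderiv_fderiv_comm (hgrad.of_le two_le_infty), eq_sub_iff_add_eq']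
  exact congrArg (fun g => g w) (hleft.unique (hright.congr_of_eventuallyEq heq))

variable (hB : HamiltonianBounds F W B κ)
include hB

theorem norm_fderiv_ray_le (hx : x ∈ W) :
    ‖fderiv ℝ (ray F u) x‖ ≤ B * (1 + ‖fderiv ℝ (gradient u) x‖) := by
  have hB₀ : 0 ≤ B := zero_le_one.trans hB.one_le
  refine ContinuousLinearMap.opNorm_le_bound _ (by positivity) fun w => ?_
  rw [hu.fderiv_ray hW hF hx, mul_assoc]
  exact (ContinuousLinearMap.le_opNorm _ _).trans (mul_le_mul
    (hB.norm_fderiv_colegendre _ (hu.mk_mem_cosphereBundle hx))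
    (norm_prodMk_apply_le _ _) (norm_nonneg _) hB₀)

theorem norm_fderiv_hessian_ray_le (hx : x ∈ W) :
    ‖fderiv ℝ (fderiv ℝ (gradient u)) x (ray F u x)‖ ≤
      B * (1 + ‖fderiv ℝ (gradient u) x‖) ^ 2 := by
  have hB₀ : 0 ≤ B := zero_le_one.trans hB.one_le
  refine ContinuousLinearMap.opNorm_le_bound _ (by positivity) fun w => ?_
  rw [hu.fderiv_fderiv_gradient_ray hW hF hx]
  set G := fderiv ℝ (gradient u) x
  have hforce : ‖fderiv ℝ (force F) (x, gradient u x) (w, G w)‖ ≤ B * ((1 + ‖G‖) * ‖w‖) :=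
    (ContinuousLinearMap.le_opNorm _ _).trans (mul_le_mul
      (hB.norm_fderiv_force _ (hu.mk_mem_cosphereBundle hx)) (norm_prodMk_apply_le _ _)
      (norm_nonneg _) hB₀)
  have hray : ‖G (fderiv ℝ (ray F u) x w)‖ ≤ ‖G‖ * (B * (1 + ‖G‖) * ‖w‖) :=
    G.le_opNorm_of_le (ContinuousLinearMap.le_of_opNorm_le _
      (hu.norm_fderiv_ray_le hW hF hB hx) w)
  calc ‖fderiv ℝ (force F) (x, gradient u x) (w, G w) - G (fderiv ℝ (ray F u) x w)‖
      ≤ B * ((1 + ‖G‖) * ‖w‖) + ‖G‖ * (B * (1 + ‖G‖) * ‖w‖) := norm_sub_le_of_le hforce hray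
    _ = B * (1 + ‖G‖) ^ 2 * ‖w‖ := by ring

theorem norm_hessian_le_of_vanishing {y : Sp d} (hy : y ∈ W)
    (hvan : ∀ x ∈ W, inner ℝ (gradient u y) (x - y) = 0 → u x = 0) :
    ‖fderiv ℝ (gradient u) y‖ ≤ B ^ 2 * (2 + B ^ 2) := by
  have hmem := hu.mk_mem_cosphereBundle hy
  have hsymm : (fderiv ℝ (gradient u) y : Sp d →ₗ[ℝ] Sp d).IsSymmetric := fun a b =>
    (inner_fderiv_gradient_comm ((hu.contDiffAt hy hW).of_le two_le_infty) a b).trans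
      (real_inner_comm _ _)
  have hforce : ‖fderiv ℝ (gradient u) y (ray F u y)‖ ≤ B := by
    rw [hu.fderiv_gradient_ray hy hW hF]
    exact hB.norm_force (y, gradient u y) hmem
  have hcov : ‖gradient u y‖ ≤ B := hB.norm_covector (y, gradient u y) hmem
  have hvel : ‖ray F u y‖ ≤ B := hB.norm_colegendre (y, gradient u y) hmem
  exact norm_le_of_inner_eq_zero hsymm (fun a b ha hb => inner_fderiv_gradient_eq_zero_of_vanishing
    hW hvan hy (hu.smooth.of_le two_le_infty) ha hb) (hu.inner_gradient_ray hy hW hF) hcov hvel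
    hforce

theorem norm_fderiv_gradient_ray_le {ψ : Sp d → ℝ} (hψ : ContDiffOn ℝ 2 ψ W)
    (hray : ∀ x ∈ W, inner ℝ (ray F u x) (gradient ψ x) = 0) (hx : x ∈ W) :
    ‖fderiv ℝ (gradient ψ) x (ray F u x)‖ ≤
      B * (1 + ‖fderiv ℝ (gradient u) x‖) * ‖gradient ψ x‖ := by
  have hψx := hψ.contDiffAt (hW.mem_nhds hx)
  have hderiv := (((hu.contDiffAt_ray hx hW hF).differentiableAt (by simp)).hasFDerivAt.inner ℝ
    ((Finsler.contDiffAt_gradient hψx one_add_one_eq_two.le).differentiableAt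
      one_ne_zero).hasFDerivAt)
    |>.unique ((hasFDerivAt_const (0 : ℝ) x).congr_of_eventuallyEq
      (by filter_upwards [hW.mem_nhds hx] with y hy using hray y hy))
  have hadjoint : fderiv ℝ (gradient ψ) x (ray F u x) =
      -(fderiv ℝ (ray F u) x).adjoint (gradient ψ x) := by
    refine ext_inner_right ℝ fun w => ?_
    have h : inner ℝ (ray F u x) (fderiv ℝ (gradient ψ) x w) +
        inner ℝ (fderiv ℝ (ray F u) x w) (gradient ψ x) = 0 := by
      simpa using congrArg (fun g => g w) hderiv
    rw [real_inner_comm, inner_fderiv_gradient_comm hψx, real_inner_comm (gradient ψ x)] at h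
    rw [inner_neg_left, ContinuousLinearMap.adjoint_inner_left]
    linarith
  rw [hadjoint, norm_neg]
  refine ContinuousLinearMap.le_of_opNorm_le _ ?_ _
  rw [LinearIsometryEquiv.norm_map]
  exact hu.norm_fderiv_ray_le hW hF hB hx

section Along

variable {c : ℝ → Sp d} {ℓ m : ℝ}
  (hc : IsCharacteristic F W u ℓ c) (hm : ‖fderiv ℝ (gradient u) (c 0)‖ ≤ m)
  (hℓ : |ℓ| * (B * (2 + m) ^ 2) < 1)
include hc hm hℓ

theorem norm_hessian_le_along {t : ℝ} (ht : t ∈ Icc (0 : ℝ) 1) :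
    ‖fderiv ℝ (gradient u) (c t)‖ ≤ m + 1 := by
  have hderiv : ∀ t ∈ Icc (0 : ℝ) 1, HasDerivWithinAt (fun t => fderiv ℝ (gradient u) (c t))
      (ℓ • fderiv ℝ (fderiv ℝ (gradient u)) (c t) (ray F u (c t))) (Icc 0 1) t := fun t ht => by
    rw [← map_smul]
    exact (((hu.contDiffAt_gradient (hc.mapsTo ht) hW).fderiv_right (m := ∞)
      (by simp)).differentiableAt (by simp)).hasFDerivAt.comp_hasDerivWithinAt t
        (hc.hasDerivWithinAt t ht)
  have hm₀ : 0 ≤ m := (norm_nonneg _).trans hm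
  have hB₀ : 0 ≤ B := zero_le_one.trans hB.one_le
  have hle : ‖fderiv ℝ (gradient u) (c t)‖ ≤ m + t :=
    image_norm_le_of_norm_deriv_right_lt_deriv_boundary (B' := fun _ => 1)
      (fun t ht => (hderiv t ht).continuousWithinAt)
      (fun t ht => (hderiv t (Ico_subset_Icc_self ht)).mono_of_mem_nhdsWithin
        (Icc_mem_nhdsGE_of_mem ht)) (by simpa using hm) (fun t => (hasDerivAt_id t).const_add m)
      (fun t ht heq => by
        have hrate := hu.norm_fderiv_hessian_ray_le hW hF hB (hc.mapsTo (Ico_subset_Icc_self ht))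
        have ht₁ := ht.2.le
        rw [heq, id] at hrate
        rw [norm_smul, Real.norm_eq_abs]
        refine lt_of_le_of_lt (mul_le_mul_of_nonneg_left (hrate.trans ?_) (abs_nonneg ℓ)) hℓ
        have ht₀ := ht.1
        exact mul_le_mul_of_nonneg_left
          (pow_le_pow_left₀ (by positivity) (by linarith) 2) hB₀) ht
  linarith [ht.2]

theorem norm_gradient_sub_le (hℓ' : |ℓ| * (B * (2 + m)) * 3 < 1) {ψ : Sp d → ℝ}
    (hψ : ContDiffOn ℝ 2 ψ W) (hray : ∀ x ∈ W, inner ℝ (ray F u x) (gradient ψ x) = 0) {t : ℝ}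
    (ht : t ∈ Icc (0 : ℝ) 1) :
    ‖gradient ψ (c t) - gradient ψ (c 0)‖ ≤ 1 / 2 * ‖gradient ψ (c 0)‖ := by
  have hB₀ : 0 ≤ B := zero_le_one.trans hB.one_le
  have hderiv : ∀ t ∈ Icc (0 : ℝ) 1, HasDerivWithinAt (fun t => gradient ψ (c t))
      (ℓ • fderiv ℝ (gradient ψ) (c t) (ray F u (c t))) (Icc 0 1) t := fun t ht => by
    rw [← map_smul]
    exact ((Finsler.contDiffAt_gradient (hψ.contDiffAt (hW.mem_nhds (hc.mapsTo ht)))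
      one_add_one_eq_two.le).differentiableAt one_ne_zero).hasFDerivAt.comp_hasDerivWithinAt
        t (hc.hasDerivWithinAt t ht)
  have hrate : ∀ t ∈ Icc (0 : ℝ) 1, ‖ℓ • fderiv ℝ (gradient ψ) (c t) (ray F u (c t))‖ ≤
      1 / 3 * ‖gradient ψ (c t)‖ := fun t ht => by
    have hhess := hu.norm_hessian_le_along hW hF hB hc hm hℓ ht
    rw [norm_smul, Real.norm_eq_abs]
    calc |ℓ| * ‖fderiv ℝ (gradient ψ) (c t) (ray F u (c t))‖
        ≤ |ℓ| * (B * (1 + (m + 1)) * ‖gradient ψ (c t)‖) := by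
          gcongr
          exact (hu.norm_fderiv_gradient_ray_le hW hF hB hψ hray (hc.mapsTo ht)).trans (by gcongr)
      _ = |ℓ| * (B * (2 + m)) * ‖gradient ψ (c t)‖ := by ring
      _ ≤ 1 / 3 * ‖gradient ψ (c t)‖ := by gcongr; linarith
  refine (norm_sub_le_exp_sub_one_mul (by norm_num) hderiv hrate ht).trans ?_
  gcongr
  calc Real.exp (1 / 3 * (t - 0)) - 1 ≤ Real.exp (1 / 3) - 1 := by gcongr; linarith [ht.2]
    _ ≤ 1 / (1 - 1 / 3) - 1 := by
        gcongr; exact Real.exp_bound_div_one_sub_of_interval (by norm_num) (by norm_num)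
    _ = 1 / 2 := by norm_num

end Along

end IsEikonal

end Riccati

section ParameterDerivative

variable {E G : Type*} [NormedAddCommGroup E] [NormedAddCommGroup G] [NormedSpace ℝ G]

section NormedSpace

variable [NormedSpace ℝ E]

/-- The derivative with respect to the real parameter of a one-parameter family of functions. -/
def paramDeriv (f : E × ℝ → G) (z : E × ℝ) : G := fderiv ℝ f z (0, 1)

theorem contDiffAt_paramDeriv {m n : WithTop ℕ∞} {f : E × ℝ → G} {z : E × ℝ}
    (h : ContDiffAt ℝ n f z) (hmn : m + 1 ≤ n) : ContDiffAt ℝ m (paramDeriv f) z :=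
  (h.fderiv_right hmn).clm_apply contDiffAt_const

theorem hasDerivAt_paramDeriv {f : E × ℝ → G} {x : E} {a : ℝ} (h : DifferentiableAt ℝ f (x, a)) :
    HasDerivAt (fun b => f (x, b)) (paramDeriv f (x, a)) a := by
  simpa [paramDeriv] using (hasFDerivAt_comp_prodMk_right h).hasDerivAt

theorem paramDeriv_eq_of_eventuallyEq {f : E × ℝ → G} {g : ℝ → G} {g' : G} {x : E} {a : ℝ}
    (hf : DifferentiableAt ℝ f (x, a)) (hg : HasDerivAt g g' a)
    (h : (fun b => f (x, b)) =ᶠ[𝓝 a] g) : paramDeriv f (x, a) = g' :=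
  (hasDerivAt_paramDeriv hf).unique (hg.congr_of_eventuallyEq h)

theorem iteratedDeriv_two_eq_paramDeriv {f : E × ℝ → G} {x : E} {a : ℝ}
    (h : ContDiffAt ℝ 2 f (x, a)) :
    iteratedDeriv 2 (fun b => f (x, b)) a = paramDeriv (paramDeriv f) (x, a) := by
  have heq : deriv (fun b => f (x, b)) =ᶠ[𝓝 a] fun b => paramDeriv f (x, b) := by
    filter_upwards [(Continuous.prodMk_right x).continuousAt.eventually (h.eventually (by simp))]
      with b hb using (hasDerivAt_paramDeriv (hb.differentiableAt two_ne_zero)).deriv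
  rw [iteratedDeriv_succ, iteratedDeriv_one, heq.deriv_eq]
  exact (hasDerivAt_paramDeriv ((contDiffAt_paramDeriv h
    one_add_one_eq_two.le).differentiableAt one_ne_zero)).deriv

end NormedSpace

variable [InnerProductSpace ℝ E] [CompleteSpace E]

theorem hasDerivWithinAt_comp_prodMk {f : E × ℝ → ℝ} {c : ℝ → E} {v : E} {s : Set ℝ} {t a : ℝ}
    (hf : DifferentiableAt ℝ f (c t, a)) (hc : HasDerivWithinAt c v s t) :
    HasDerivWithinAt (fun t => f (c t, a)) (inner ℝ (gradFst f (c t, a)) v) s t := by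
  rw [inner_gradFst]
  exact (hasFDerivAt_comp_prodMk_left hf).comp_hasDerivWithinAt t hc

theorem gradFst_paramDeriv {f : E × ℝ → ℝ} {z : E × ℝ} (h : ContDiffAt ℝ 2 f z) :
    gradFst (paramDeriv f) z = paramDeriv (gradFst f) z := by
  refine ext_inner_right ℝ fun w => ?_
  rw [inner_gradFst, paramDeriv, inner_fderiv_gradAlong h]
  change fderiv ℝ (fun y => fderiv ℝ f y (0, 1)) z (w, 0) = _
  rw [fderiv_clm_apply (differentiableAt_fderiv h) (differentiableAt_const _), fderiv_fderiv_comm h]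
  simp

theorem gradFst_paramDeriv_paramDeriv {f : E × ℝ → ℝ} {z : E × ℝ} (h : ContDiffAt ℝ 3 f z) :
    gradFst (paramDeriv (paramDeriv f)) z = paramDeriv (paramDeriv (gradFst f)) z := by
  have heq : gradFst (paramDeriv f) =ᶠ[𝓝 z] paramDeriv (gradFst f) := by
    filter_upwards [(h.of_le (m := 2) (by norm_num)).eventually (by simp)] with y hy
      using gradFst_paramDeriv hy
  rw [gradFst_paramDeriv (contDiffAt_paramDeriv h two_add_one_eq_three.le), paramDeriv,
    heq.fderiv_eq, paramDeriv]

end ParameterDerivative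

section Family

variable {W : Set (Sp d)} {J : Set ℝ} {F : Sp d → Sp d → ℝ} {G : Sp d × ℝ → ℝ} {B κ : ℝ}

/-- A smooth one-parameter family, with parameters in `J`, of solutions on `W` of the eikonal
equation. -/
structure IsEikonalFamily (F : Sp d → Sp d → ℝ) (W : Set (Sp d)) (J : Set ℝ)
    (G : Sp d × ℝ → ℝ) : Prop where
  smooth : ContDiffOn ℝ ∞ G (W ×ˢ J)
  dual_eq : ∀ x ∈ W, ∀ a ∈ J, dual F x (gradFst G (x, a)) = 1

/-- Along characteristics shorter than `1 / shortRate B`, the Hessians and normal derivatives of the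
eikonal solutions used here are controlled; `B ^ 2 * (2 + B ^ 2)` bounds the Hessian at the base
point. -/
def shortRate (B : ℝ) : ℝ := B * (2 + B ^ 2 * (2 + B ^ 2)) ^ 2 * 3

namespace IsEikonalFamily

variable (hG : IsEikonalFamily F W J G) (hW : IsOpen W) (hJ : IsOpen J)
include hG hW hJ

section Point

variable {x : Sp d} {a : ℝ} (hx : x ∈ W) (ha : a ∈ J)
include ha

theorem isEikonal : IsEikonal F W fun x => G (x, a) where
  smooth := hG.smooth.comp (contDiff_prodMk_left a).contDiffOn fun _ hx => ⟨hx, ha⟩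
  dual_eq x hx := by
    rw [gradient_comp_prodMk_left ((hG.smooth.contDiffAt
      ((hW.prod hJ).mem_nhds ⟨hx, ha⟩)).differentiableAt (by simp))]
    exact hG.dual_eq x hx a ha

include hx

theorem contDiffAt : ContDiffAt ℝ ∞ G (x, a) :=
  hG.smooth.contDiffAt ((hW.prod hJ).mem_nhds ⟨hx, ha⟩)

theorem contDiffAt_gradFst : ContDiffAt ℝ ∞ (gradFst G) (x, a) :=
  contDiffAt_gradAlong (hG.contDiffAt hW hJ hx ha) (by simp) _

theorem gradient_eq : gradient (fun x => G (x, a)) x = gradFst G (x, a) :=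
  gradient_comp_prodMk_left ((hG.contDiffAt hW hJ hx ha).differentiableAt (by simp))

theorem gradient_paramDeriv :
    gradient (fun y => paramDeriv G (y, a)) x = paramDeriv (gradFst G) (x, a) := by
  have h := hG.contDiffAt hW hJ hx ha
  rw [gradient_comp_prodMk_left ((contDiffAt_paramDeriv (m := ∞) h (by simp)).differentiableAt
    (by simp)), gradFst_paramDeriv (h.of_le two_le_infty)]

theorem ray_eq : ray F (fun x => G (x, a)) x = colegendre F (x, gradFst G (x, a)) := by
  rw [ray, hG.gradient_eq hW hJ hx ha]

variable (hF : IsFinsler W F)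
include hF

theorem inner_ray_paramDeriv :
    inner ℝ (ray F (fun x => G (x, a)) x) (paramDeriv (gradFst G) (x, a)) = 0 := by
  have hne := ne_zero_of_mem_cosphere (hG.dual_eq x hx a ha)
  have hderiv := ((hF.contDiffAt_ham hW hx hne).differentiableAt (by simp)).hasFDerivAt.comp (x, a)
    (hasFDerivAt_fst.prodMk
      ((hG.contDiffAt_gradFst hW hJ hx ha).differentiableAt (by simp)).hasFDerivAt)
  have hconst : (ham F ∘ fun z : Sp d × ℝ => (z.1, gradFst G z)) =ᶠ[𝓝 (x, a)] fun _ => 1 / 2 := by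
    filter_upwards [(hW.prod hJ).mem_nhds ⟨hx, ha⟩] with z hz
    have hdual := hG.dual_eq _ hz.1 _ hz.2
    rw [Function.comp_apply, hF.ham_eq hW hz.1 (ne_zero_of_mem_cosphere hdual), hdual, one_pow,
      mul_one]
  have hzero : fderiv ℝ (ham F) (x, gradFst G (x, a)) (0, paramDeriv (gradFst G) (x, a)) = 0 :=
    congrArg (fun g => g (0, 1))
      (hderiv.unique ((hasFDerivAt_const (1 / 2 : ℝ) (x, a)).congr_of_eventuallyEq hconst))
  rw [hF.fderiv_ham hW hx hne, inner_zero_right, sub_zero] at hzero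
  rw [hG.ray_eq hW hJ hx ha, hzero]

theorem inner_paramDeriv_paramDeriv_ray :
    inner ℝ (paramDeriv (paramDeriv (gradFst G)) (x, a)) (ray F (fun x => G (x, a)) x) =
      -inner ℝ (paramDeriv (gradFst G) (x, a)) (fderiv ℝ (colegendre F) (x, gradFst G (x, a))
        (0, paramDeriv (gradFst G) (x, a))) := by
  have hne := ne_zero_of_mem_cosphere (hG.dual_eq x hx a ha)
  have hgrad := hG.contDiffAt_gradFst hW hJ hx ha
  have hderiv := (((hF.contDiffAt_colegendre hW hx hne).differentiableAt (by simp)).hasFDerivAt.comp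
    (x, a) (hasFDerivAt_fst.prodMk (hgrad.differentiableAt (by simp)).hasFDerivAt)).inner ℝ
      ((contDiffAt_paramDeriv (m := ∞) hgrad (by simp)).differentiableAt (by simp)).hasFDerivAt
  have hconst : (fun z : Sp d × ℝ => inner ℝ
      ((colegendre F ∘ fun z : Sp d × ℝ => (z.1, gradFst G z)) z)
      (paramDeriv (gradFst G) z)) =ᶠ[𝓝 (x, a)] fun _ => 0 := by
    filter_upwards [(hW.prod hJ).mem_nhds ⟨hx, ha⟩] with z hz
    rw [Function.comp_apply, ← hG.ray_eq hW hJ hz.1 hz.2]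
    exact hG.inner_ray_paramDeriv hW hJ hz.1 hz.2 hF
  have hzero : inner ℝ (colegendre F (x, gradFst G (x, a)))
        (paramDeriv (paramDeriv (gradFst G)) (x, a)) +
      inner ℝ (fderiv ℝ (colegendre F) (x, gradFst G (x, a)) (0, paramDeriv (gradFst G) (x, a)))
        (paramDeriv (gradFst G) (x, a)) = 0 :=
    congrArg (fun g => g (0, 1))
      (hderiv.unique ((hasFDerivAt_const (0 : ℝ) (x, a)).congr_of_eventuallyEq hconst))
  rw [hG.ray_eq hW hJ hx ha, real_inner_comm, eq_neg_of_add_eq_zero_left hzero, real_inner_comm]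

end Point

section Along

variable {a : ℝ} (ha : a ∈ J) {c : ℝ → Sp d} {ℓ : ℝ}
  (hc : IsCharacteristic F W (fun x => G (x, a)) ℓ c) (hF : IsFinsler W F)
include ha hc hF

theorem hasDerivWithinAt_paramDeriv {t : ℝ} (ht : t ∈ Icc (0 : ℝ) 1) :
    HasDerivWithinAt (fun t => paramDeriv G (c t, a)) 0 (Icc 0 1) t := by
  have hsmooth := hG.contDiffAt hW hJ (hc.mapsTo ht) ha
  refine (hasDerivWithinAt_comp_prodMk ((contDiffAt_paramDeriv (m := ∞) hsmooth
    (by simp)).differentiableAt (by simp)) (hc.hasDerivWithinAt t ht)).congr_deriv ?_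
  rw [gradFst_paramDeriv (hsmooth.of_le two_le_infty), inner_smul_right, real_inner_comm,
    hG.inner_ray_paramDeriv hW hJ (hc.mapsTo ht) ha hF, mul_zero]

theorem paramDeriv_eq_of_mem_Icc {t : ℝ} (ht : t ∈ Icc (0 : ℝ) 1) :
    paramDeriv G (c t, a) = paramDeriv G (c 0, a) := by
  have hderiv := fun s (hs : s ∈ Icc (0 : ℝ) 1) =>
    hG.hasDerivWithinAt_paramDeriv hW hJ ha hc hF hs
  exact constant_of_derivWithin_zero (fun s hs => (hderiv s hs).differentiableWithinAt)
    (fun s hs => (hderiv s (Ico_subset_Icc_self hs)).derivWithin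
      (uniqueDiffOn_Icc_zero_one s (Ico_subset_Icc_self hs))) t ht

theorem hasDerivWithinAt_paramDeriv_paramDeriv {t : ℝ} (ht : t ∈ Icc (0 : ℝ) 1) :
    HasDerivWithinAt (fun t => paramDeriv (paramDeriv G) (c t, a))
      (-ℓ * inner ℝ (paramDeriv (gradFst G) (c t, a)) (fderiv ℝ (colegendre F)
        (c t, gradFst G (c t, a)) (0, paramDeriv (gradFst G) (c t, a)))) (Icc 0 1) t := by
  have hsmooth := hG.contDiffAt hW hJ (hc.mapsTo ht) ha
  refine (hasDerivWithinAt_comp_prodMk ((contDiffAt_paramDeriv (m := ∞)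
    (contDiffAt_paramDeriv (m := ∞) hsmooth (by simp)) (by simp)).differentiableAt (by simp))
    (hc.hasDerivWithinAt t ht)).congr_deriv ?_
  rw [gradFst_paramDeriv_paramDeriv (hsmooth.of_le (WithTop.coe_le_coe.2 le_top)), inner_smul_right,
    hG.inner_paramDeriv_paramDeriv_ray hW hJ (hc.mapsTo ht) ha hF, mul_neg, neg_mul]

theorem half_norm_paramDeriv_le (hB : HamiltonianBounds F W B κ)
    (hvan : ∀ x ∈ W, inner ℝ (gradFst G (c 0, a)) (x - c 0) = 0 → G (x, a) = 0)
    (hℓ : |ℓ| * shortRate B < 1) {t : ℝ} (ht : t ∈ Icc (0 : ℝ) 1) :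
    1 / 2 * ‖paramDeriv (gradFst G) (c 0, a)‖ ≤ ‖paramDeriv (gradFst G) (c t, a)‖ := by
  have h₀ : (0 : ℝ) ∈ Icc (0 : ℝ) 1 := by simp
  have hB₀ : 0 ≤ B := zero_le_one.trans hB.one_le
  have hu := hG.isEikonal hW hJ ha
  have hm := hu.norm_hessian_le_of_vanishing hW hF hB (hc.mapsTo h₀) (by
    rwa [hG.gradient_eq hW hJ (hc.mapsTo h₀) ha])
  rw [shortRate] at hℓ
  set m := B ^ 2 * (2 + B ^ 2)
  have hm₀ : 0 ≤ m := by positivity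
  have hψ : ContDiffOn ℝ 2 (fun y => paramDeriv G (y, a)) W := fun x hx =>
    ((contDiffAt_paramDeriv (m := 2) (hG.contDiffAt hW hJ hx ha)
      (WithTop.coe_le_coe.2 le_top)).comp x
        (contDiffAt_id.prodMk contDiffAt_const)).contDiffWithinAt
  have hriccati : |ℓ| * (B * (2 + m) ^ 2) < 1 := by
    have : 0 ≤ |ℓ| * (B * (2 + m) ^ 2) := by positivity
    linarith
  have hgronwall : |ℓ| * (B * (2 + m)) * 3 < 1 := by
    refine lt_of_le_of_lt ?_ hℓ
    rw [mul_assoc]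
    gcongr
    nlinarith
  have hdiff := hu.norm_gradient_sub_le hW hF hB hc hm hriccati hgronwall hψ (fun x hx => by
    rw [hG.gradient_paramDeriv hW hJ hx ha]
    exact hG.inner_ray_paramDeriv hW hJ hx ha hF) ht
  rw [hG.gradient_paramDeriv hW hJ (hc.mapsTo ht) ha,
    hG.gradient_paramDeriv hW hJ (hc.mapsTo h₀) ha] at hdiff
  have htri := norm_sub_norm_le (paramDeriv (gradFst G) (c 0, a)) (paramDeriv (gradFst G) (c t, a))
  rw [norm_sub_rev] at htri
  linarith

theorem exists_paramDeriv_paramDeriv_eq (hB : HamiltonianBounds F W B κ)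
    (hvan : ∀ x ∈ W, inner ℝ (gradFst G (c 0, a)) (x - c 0) = 0 → G (x, a) = 0)
    (hbase : ∀ b ∈ J, G (c 0, b) = 0) (hℓ : |ℓ| * shortRate B < 1) :
    ∃ q, κ / 4 * ‖paramDeriv (gradFst G) (c 0, a)‖ ^ 2 ≤ q ∧
      paramDeriv (paramDeriv G) (c 1, a) = -ℓ * q := by
  have hstart : ∀ b ∈ J, paramDeriv G (c 0, b) = 0 := fun b hb =>
    paramDeriv_eq_of_eventuallyEq ((hG.contDiffAt hW hJ (hc.mapsTo (by simp)) hb).differentiableAt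
      (by simp)) (hasDerivAt_const b 0) (by
        filter_upwards [hJ.mem_nhds hb] with b' hb' using hbase b' hb')
  have hstart' : paramDeriv (paramDeriv G) (c 0, a) = 0 :=
    paramDeriv_eq_of_eventuallyEq ((contDiffAt_paramDeriv (m := ∞) (hG.contDiffAt hW hJ
      (hc.mapsTo (by simp)) ha) (by simp)).differentiableAt (by simp)) (hasDerivAt_const a 0) (by
        filter_upwards [hJ.mem_nhds ha] with b hb using hstart b hb)
  have hderiv := fun t (ht : t ∈ Icc (0 : ℝ) 1) =>
    hG.hasDerivWithinAt_paramDeriv_paramDeriv hW hJ ha hc hF ht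
  obtain ⟨θ, hθ, hslope⟩ := exists_hasDerivAt_eq_slope _ _ (zero_lt_one' ℝ)
    (fun t ht => (hderiv t ht).continuousWithinAt)
    fun t ht => (hderiv t (Ioo_subset_Icc_self ht)).hasDerivAt (Icc_mem_nhds ht.1 ht.2)
  have hθ' := Ioo_subset_Icc_self hθ
  rw [hstart', sub_zero, sub_zero, div_one] at hslope
  refine ⟨_, ?_, hslope.symm⟩
  refine le_trans ?_ (hB.coercive (c θ, gradFst G (c θ, a))
    ⟨hc.mapsTo hθ', hG.dual_eq _ (hc.mapsTo hθ') a ha⟩ _)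
  have hhalf := pow_le_pow_left₀ (by positivity)
    (hG.half_norm_paramDeriv_le hW hJ ha hc hF hB hvan hℓ hθ') 2
  nlinarith [hB.kappa_pos]

end Along

end IsEikonalFamily

end Family

section Descent

theorem exists_integral_curve {E : Type*} [NormedAddCommGroup E] [NormedSpace ℝ E]
    [CompleteSpace E] {v : E → E} {x : E} {a B T : ℝ} {k : NNReal} (hB : 0 < B) (hT : 0 ≤ T)
    (hTa : 2 * B * T ≤ a) (hv : LipschitzOnWith k v (Metric.closedBall x a))
    (hvB : ∀ z ∈ Metric.closedBall x a, ‖v z‖ ≤ B) :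
    ∃ X : ℝ → E, X 0 = x ∧ (∀ t ∈ Icc 0 T, HasDerivWithinAt X (v (X t)) (Icc 0 T) t) ∧
      ∀ t ∈ Icc 0 T, ‖X t - x‖ ≤ 2 * B * t := by
  have ha : 0 ≤ a := le_trans (by positivity) hTa
  have hPL : IsPicardLindelof (fun _ => v) (⟨0, le_rfl, hT⟩ : Icc (0 : ℝ) T) x ⟨a, ha⟩ 0
      ⟨B, hB.le⟩ k := by
    refine IsPicardLindelof.of_time_independent hvB hv ?_
    simp only [sub_zero, sub_self, NNReal.coe_zero]
    rw [max_eq_left hT]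
    change B * T ≤ a
    linarith [mul_nonneg hB.le hT]
  obtain ⟨X, hX₀, hX⟩ := hPL.exists_eq_forall_mem_Icc_hasDerivWithinAt₀
  simp only at hX₀
  have hspeed : ∀ t ∈ Ico 0 T, ‖X t - x‖ = 2 * B * t → ‖v (X t)‖ < 2 * B := fun t ht heq => by
    have hmem : X t ∈ Metric.closedBall x a := by
      rw [mem_closedBall_iff_norm, heq]
      exact (mul_le_mul_of_nonneg_left ht.2.le (by positivity)).trans hTa
    linarith [hvB _ hmem]
  exact ⟨X, hX₀, hX, fun t ht => image_norm_le_of_norm_deriv_right_lt_deriv_boundary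
    (fun t ht => ((hX t ht).sub_const x).continuousWithinAt)
    (fun t ht => ((hX t (Ico_subset_Icc_self ht)).sub_const x).mono_of_mem_nhdsWithin
      (Icc_mem_nhdsGE_of_mem ht)) (by simp [hX₀])
    (fun t => by simpa using (hasDerivAt_id t).const_mul (2 * B)) hspeed ht⟩

theorem exists_eq_zero_of_deriv_lt {f f' : ℝ → ℝ} (h₀ : 0 ≤ f 0)
    (hf : ∀ t ∈ Icc 0 (2 * f 0), HasDerivWithinAt f (f' t) (Icc 0 (2 * f 0)) t)
    (hf' : ∀ t ∈ Icc 0 (2 * f 0), f t = f 0 - t / 2 → f' t < -(1 / 2)) :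
    ∃ t ∈ Icc 0 (2 * f 0), f t = 0 := by
  have hT : 0 ≤ 2 * f 0 := by positivity
  have hcont : ContinuousOn f (Icc 0 (2 * f 0)) := fun t ht => (hf t ht).continuousWithinAt
  have hle : f (2 * f 0) ≤ f 0 - 2 * f 0 / 2 :=
    image_le_of_deriv_right_lt_deriv_boundary hcont
      (fun t ht => (hf t (Ico_subset_Icc_self ht)).mono_of_mem_nhdsWithin
        (Icc_mem_nhdsGE_of_mem ht)) (B := fun t => f 0 - t / 2) (by simp)
      (fun t => by simpa using ((hasDerivAt_id t).div_const 2).const_sub (f 0))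
      (fun t ht => hf' t (Ico_subset_Icc_self ht)) (right_mem_Icc.2 hT)
  exact intermediate_value_Icc' hT hcont ⟨by linarith, h₀⟩

theorem hasDerivWithinAt_comp_mul_one_sub {E : Type*} [NormedAddCommGroup E] [NormedSpace ℝ E]
    {c : ℝ → E} {v : E} {T T' t : ℝ} (hT : T ∈ Icc 0 T')
    (h : HasDerivWithinAt c v (Icc 0 T') (T * (1 - t))) :
    HasDerivWithinAt (fun t => c (T * (1 - t))) (-T • v) (Icc 0 1) t := by
  have hmaps : MapsTo (fun s => T * (1 - s)) (Icc 0 1) (Icc 0 T') := fun _ hs =>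
    ⟨mul_nonneg hT.1 (sub_nonneg.2 hs.2),
      (mul_le_of_le_one_right hT.1 (sub_le_self 1 hs.1)).trans hT.2⟩
  exact h.scomp t (by simpa using
    ((hasDerivWithinAt_id t (Icc (0 : ℝ) 1)).const_sub 1).const_mul T) hmaps

theorem IsCharacteristic.reverse {F : Sp d → Sp d → ℝ} {W : Set (Sp d)} {u : Sp d → ℝ} {τ : ℝ}
    {c : ℝ → Sp d} (hc : IsCharacteristic F W u τ c) :
    IsCharacteristic F W u (-τ) fun t => c (1 - t) where
  mapsTo _ ht := hc.mapsTo ⟨sub_nonneg.2 ht.2, sub_le_self 1 ht.1⟩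
  hasDerivWithinAt t ht := by
    have h := hc.hasDerivWithinAt (1 - t) ⟨sub_nonneg.2 ht.2, sub_le_self 1 ht.1⟩
    rw [← one_mul (1 - t)] at h
    simpa using hasDerivWithinAt_comp_mul_one_sub ⟨zero_le_one, le_rfl⟩ h

theorem exists_first_exit {E : Type*} [NormedAddCommGroup E] [NormedSpace ℝ E] {N g : E → ℝ}
    {x y : E} {r ε : ℝ} (hN : ConvexOn ℝ univ N) (hNcont : Continuous N)
    (hNy : ∀ z, z ≠ y → N y < N z) (hr : IsCompact {z | N z ≤ r})
    (hg : ContinuousOn g {z | N z ≤ r}) (hgy : g y < ε) (hx : N x ≤ r) (hgx : ε ≤ g x) :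
    ∃ x', N x' ≤ r ∧ ε ≤ g x' ∧ ∀ z, N z ≤ N x' → g z ≤ ε := by
  have hbad : IsCompact ({z | N z ≤ r} ∩ g ⁻¹' Ici ε) :=
    hr.of_isClosed_subset (hg.preimage_isClosed_of_isClosed hr.isClosed isClosed_Ici)
      inter_subset_left
  obtain ⟨x', ⟨hx', hgx'⟩, hmin⟩ := hbad.exists_isMinOn ⟨x, hx, hgx⟩ hNcont.continuousOn
  have hgood : ∀ z, N z < N x' → g z ≤ ε := fun z hz =>
    le_of_not_gt fun h => hz.not_ge (hmin ⟨hz.le.trans hx', h.le⟩)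
  have hyx' : N y < N x' := hNy x' fun h => hgy.not_ge (h ▸ hgx')
  refine ⟨x', hx', hgx', fun z hz => ?_⟩
  have hsegment : ∀ w ∈ openSegment ℝ y z, N w < N x' := by
    rintro _ ⟨a, b, ha, hb, hab, rfl⟩
    calc N (a • y + b • z) ≤ a * N y + b * N z := hN.2 trivial trivial ha.le hb.le hab
      _ < a * N x' + b * N x' := add_lt_add_of_lt_of_le (mul_lt_mul_of_pos_left hyx' ha)
          (mul_le_mul_of_nonneg_left hz hb.le)
      _ = N x' := by rw [← add_mul, hab, one_mul]
  exact ContinuousWithinAt.closure_le (segment_subset_closure_openSegment (right_mem_segment ℝ y z))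
    ((hg z (hz.trans hx')).mono fun w hw => (hsegment w hw).le.trans hx')
    continuousWithinAt_const fun w hw => hgood w (hsegment w hw)

/-- A norm of `x - y` whose sublevel sets are, for small slopes `1 / (4 * B)`, domains of
dependence for the eikonal equation with data on the hyperplane through `y` conormal to `ξ`. -/
def coneNorm (B : ℝ) (y ξ x : Sp d) : ℝ := ‖x - y‖ + 4 * B * |inner ℝ ξ (x - y)|

section ConeNorm

variable {B : ℝ} (hB : 0 ≤ B) (y ξ : Sp d)

theorem continuous_coneNorm (B : ℝ) : Continuous (coneNorm B y ξ) := by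
  unfold coneNorm; fun_prop

theorem mul_abs_inner_le_coneNorm (B : ℝ) (x : Sp d) :
    4 * B * |inner ℝ ξ (x - y)| ≤ coneNorm B y ξ x :=
  le_add_of_nonneg_left (norm_nonneg _)

include hB

theorem convexOn_coneNorm : ConvexOn ℝ univ (coneNorm B y ξ) := by
  have h : ConvexOn ℝ univ fun w : Sp d => ‖w‖ + 4 * B * |inner ℝ ξ w| :=
    convexOn_univ_norm.add
      ((convexOn_univ_norm.comp_linearMap (innerₛₗ ℝ ξ)).smul (by positivity : 0 ≤ 4 * B))
  exact h.translate_left (-y) |>.congr fun x _ => by simp [coneNorm, sub_eq_add_neg]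

theorem norm_sub_le_coneNorm (x : Sp d) : ‖x - y‖ ≤ coneNorm B y ξ x :=
  le_add_of_nonneg_right (by positivity)

theorem coneNorm_self_lt {x : Sp d} (hx : x ≠ y) : coneNorm B y ξ y < coneNorm B y ξ x := by
  refine lt_of_eq_of_lt (by simp [coneNorm]) ((norm_pos_iff.2 (sub_ne_zero.2 hx)).trans_le
    (norm_sub_le_coneNorm hB y ξ x))

theorem coneNorm_le_subset_closedBall (r : ℝ) :
    {z | coneNorm B y ξ z ≤ r} ⊆ Metric.closedBall y r := fun z hz =>
  mem_closedBall_iff_norm.2 ((norm_sub_le_coneNorm hB y ξ z).trans hz)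

theorem isCompact_coneNorm_le (r : ℝ) : IsCompact {z | coneNorm B y ξ z ≤ r} :=
  (isCompact_closedBall y r).of_isClosed_subset
    (isClosed_le (continuous_coneNorm y ξ B) continuous_const)
    (coneNorm_le_subset_closedBall hB y ξ r)

end ConeNorm

variable {W : Set (Sp d)} {F : Sp d → Sp d → ℝ} {u : Sp d → ℝ} {B κ : ℝ} {x y ξ : Sp d}

namespace IsEikonal

variable (hu : IsEikonal F W u)
include hu

theorem exists_gradient_eq_smul (hW : IsOpen W) (hx : x ∈ W) (hξ : ξ ≠ 0)
    (hvan : ∀ x ∈ W, inner ℝ ξ (x - y) = 0 → u x = 0) (hxy : inner ℝ ξ (x - y) = 0) :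
    ∃ b : ℝ, gradient u x = b • ξ := by
  set p := gradient u x
  set b := inner ℝ ξ p / inner ℝ ξ ξ with hb
  have horth : inner ℝ ξ (p - b • ξ) = 0 := by
    rw [inner_sub_right, inner_smul_right, hb, div_mul_cancel₀ _ (inner_self_ne_zero.2 hξ),
      sub_self]
  have hp : inner ℝ p (p - b • ξ) = 0 := inner_gradient_eq_zero_of_vanishing hW hvan hx
    ((hu.contDiffAt hx hW).differentiableAt (by simp)) hxy horth
  refine ⟨b, sub_eq_zero.1 (inner_self_eq_zero (𝕜 := ℝ).1 ?_)⟩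
  rw [inner_sub_left, hp, real_inner_smul_left, horth, mul_zero, sub_zero]

variable (hB : HamiltonianBounds F W B κ)
include hB

theorem norm_gradient_le (hx : x ∈ W) : ‖gradient u x‖ ≤ B :=
  hB.norm_covector (x, gradient u x) (hu.mk_mem_cosphereBundle hx)

theorem norm_ray_le (hx : x ∈ W) : ‖ray F u x‖ ≤ B :=
  hB.norm_colegendre (x, gradient u x) (hu.mk_mem_cosphereBundle hx)

variable (hW : IsOpen W) (hF : IsFinsler W F)
include hW hF

theorem one_div_le_norm_gradient (hx : x ∈ W) : 1 / B ≤ ‖gradient u x‖ := by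
  rw [div_le_iff₀ (zero_lt_one.trans_le hB.one_le), ← hu.inner_gradient_ray hx hW hF]
  exact (real_inner_le_norm _ _).trans
    (mul_le_mul_of_nonneg_left (hu.norm_ray_le hB hx) (norm_nonneg _))

theorem three_quarters_le_inner_ray (hx : x ∈ W) (hclose : ‖gradient u x - ξ‖ ≤ 1 / (4 * B)) :
    3 / 4 ≤ inner ℝ ξ (ray F u x) := by
  have hB₀ := zero_lt_one.trans_le hB.one_le
  have h : inner ℝ (gradient u x - ξ) (ray F u x) ≤ 1 / 4 :=
    calc inner ℝ (gradient u x - ξ) (ray F u x) ≤ 1 / (4 * B) * B := (real_inner_le_norm _ _).trans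
          (mul_le_mul hclose (hu.norm_ray_le hB hx) (norm_nonneg _) (by positivity))
      _ = 1 / 4 := by field_simp
  rw [inner_sub_left, hu.inner_gradient_ray hx hW hF] at h
  linarith

theorem exists_integral_curve_smul_ray {s a T : ℝ} (hs : |s| = 1) (hT : 0 ≤ T)
    (hTa : 2 * B * T ≤ a) (hball : Metric.closedBall x a ⊆ W) :
    ∃ Y : ℝ → Sp d, Y 0 = x ∧ (∀ t ∈ Icc 0 T, HasDerivWithinAt Y (s • ray F u (Y t)) (Icc 0 T) t) ∧
      MapsTo Y (Icc 0 T) W ∧ ∀ t ∈ Icc 0 T, ‖Y t - x‖ ≤ 2 * B * t := by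
  have hB₀ := zero_lt_one.trans_le hB.one_le
  obtain ⟨k, hk⟩ := exists_lipschitzOnWith_of_contDiffAt (f := fun z => s • ray F u z)
    (isCompact_closedBall x a) fun z hz =>
      ((hu.contDiffAt_ray (hball hz) hW hF).of_le (by simp)).const_smul s
  obtain ⟨Y, hY₀, hY, hYx⟩ := exists_integral_curve hB₀ hT hTa hk fun z hz => by
    rw [norm_smul, Real.norm_eq_abs, hs, one_mul]
    exact hu.norm_ray_le hB (hball hz)
  refine ⟨Y, hY₀, hY, fun t ht => hball ?_, hYx⟩
  rw [mem_closedBall_iff_norm]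
  exact (hYx t ht).trans ((mul_le_mul_of_nonneg_left ht.2 (by positivity)).trans hTa)

theorem norm_gradient_sub_le_of_ray {c : ℝ → Sp d} {ℓ : ℝ}
    (hc : IsCharacteristic F W u ℓ c) : ‖gradient u (c 1) - gradient u (c 0)‖ ≤ |ℓ| * B := by
  have hderiv : ∀ t ∈ Icc (0 : ℝ) 1, HasDerivWithinAt (fun t => gradient u (c t))
      (ℓ • force F (c t, gradient u (c t))) (Icc 0 1) t := fun t ht => by
    rw [← hu.fderiv_gradient_ray (hc.mapsTo ht) hW hF, ← map_smul]
    exact ((hu.contDiffAt_gradient (hc.mapsTo ht) hW).differentiableAt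
      (by simp)).hasFDerivAt.comp_hasDerivWithinAt t (hc.hasDerivWithinAt t ht)
  refine norm_image_sub_le_of_norm_deriv_le_segment_01' hderiv fun t ht => ?_
  rw [norm_smul, Real.norm_eq_abs]
  exact mul_le_mul_of_nonneg_left (hB.norm_force (c t, gradient u (c t))
    (hu.mk_mem_cosphereBundle (hc.mapsTo (Ico_subset_Icc_self ht)))) (abs_nonneg _)

theorem norm_gradient_sub_le_on_plane (hx : x ∈ W) (hξ : 1 / B ≤ ‖ξ‖)
    (hvan : ∀ x ∈ W, inner ℝ ξ (x - y) = 0 → u x = 0) (hxy : inner ℝ ξ (x - y) = 0)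
    (hclose : ‖gradient u x - ξ‖ ≤ 1 / (4 * B)) :
    ‖gradient u x - ξ‖ ≤ |1 - dual F x ξ| * B := by
  have hB₀ := zero_lt_one.trans_le hB.one_le
  have hξ₀ : ξ ≠ 0 := norm_pos_iff.1 (lt_of_lt_of_le (by positivity) hξ)
  obtain ⟨b, hb⟩ := hu.exists_gradient_eq_smul hW hx hξ₀ hvan hxy
  have hb₀ : 0 < b := by
    by_contra! h
    rw [hb, ← neg_sub, norm_neg, show ξ - b • ξ = (1 - b) • ξ by module, norm_smul,
      Real.norm_of_nonneg (by linarith), show 1 / (4 * B) = 1 / B / 4 by field_simp] at hclose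
    have hBp : 0 < 1 / B := by positivity
    nlinarith
  have hdual := hu.dual_eq x hx
  rw [hb, hF.dual_smul hW hx hξ₀ hb₀] at hdual
  have heq : gradient u x - ξ = (1 - dual F x ξ) • gradient u x := by
    rw [hb, smul_smul, sub_mul, mul_comm (dual F x ξ), hdual]
    module
  rw [heq, norm_smul, Real.norm_eq_abs]
  exact mul_le_mul_of_nonneg_left (hu.norm_gradient_le hB hx) (abs_nonneg _)

section Backward

variable {n₀ : ℝ} (hball : Metric.closedBall y (2 * n₀) ⊆ W) (hx : coneNorm B y ξ x ≤ n₀)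
  (hclose : ∀ z, coneNorm B y ξ z ≤ coneNorm B y ξ x → ‖gradient u z - ξ‖ ≤ 1 / (4 * B))
include hball hx hclose

theorem exists_integral_curve_to_plane : ∃ (s T : ℝ) (Y : ℝ → Sp d), |s| = 1 ∧ 0 ≤ T ∧
    T ≤ 2 * |inner ℝ ξ (x - y)| ∧ Y 0 = x ∧ inner ℝ ξ (Y T - y) = 0 ∧
    ‖Y T - x‖ ≤ 2 * B * T ∧ MapsTo Y (Icc 0 T) W ∧
    ∀ t ∈ Icc 0 T, HasDerivWithinAt Y (-s • ray F u (Y t)) (Icc 0 T) t := by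
  have hB₀ := zero_lt_one.trans_le hB.one_le
  have hxn₀ : ‖x - y‖ ≤ n₀ := (norm_sub_le_coneNorm hB₀.le y ξ x).trans hx
  have hηn₀ := (mul_abs_inner_le_coneNorm y ξ B x).trans hx
  set η : ℝ := inner ℝ ξ (x - y) with hη
  obtain ⟨s, hs, hsη⟩ : ∃ s : ℝ, |s| = 1 ∧ s * η = |η| := by
    rcases abs_choice η with h | h
    · exact ⟨1, abs_one, by rw [h, one_mul]⟩
    · exact ⟨-1, by simp, by rw [h, neg_one_mul]⟩
  have hballx : Metric.closedBall x n₀ ⊆ W := by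
    refine (Metric.closedBall_subset_closedBall' ?_).trans hball
    rw [dist_eq_norm]; linarith
  obtain ⟨Y, hY₀, hY, hYW, hYx⟩ := hu.exists_integral_curve_smul_ray hB hW hF (s := -s)
    (T := 2 * |η|) (by rwa [abs_neg]) (by positivity) (by linarith) hballx
  set f : ℝ → ℝ := fun t => s * inner ℝ ξ (Y t - y)
  have hf₀ : f 0 = |η| := by simp only [f, hY₀, ← hη, hsη]
  have hf : ∀ t ∈ Icc 0 (2 * |η|),
      HasDerivWithinAt f (-inner ℝ ξ (ray F u (Y t))) (Icc 0 (2 * |η|)) t := fun t ht => by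
    have h := ((hasDerivWithinAt_const t (Icc 0 (2 * |η|)) ξ).inner ℝ
      ((hY t ht).sub_const y)).const_mul s
    rwa [inner_zero_left, add_zero, inner_smul_right, ← mul_assoc, mul_neg,
      ← abs_mul_abs_self s, hs, one_mul, neg_one_mul] at h
  -- As long as `f` decreases at rate `1 / 2`, the curve stays in the sublevel set of `x`.
  have hdecay : ∀ t ∈ Icc 0 (2 * |η|), f t = |η| - t / 2 →
      -inner ℝ ξ (ray F u (Y t)) < -(1 / 2) := fun t ht heq => by
    have hinner : |inner ℝ ξ (Y t - y)| = |η| - t / 2 := by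
      rw [← abs_of_nonneg (by linarith [ht.2] : 0 ≤ |η| - t / 2), ← heq, abs_mul, hs, one_mul]
    have hsublevel : coneNorm B y ξ (Y t) ≤ coneNorm B y ξ x := by
      rw [coneNorm, coneNorm, hinner]
      linarith [norm_sub_le_norm_sub_add_norm_sub (Y t) x y, hYx t ht]
    linarith [hu.three_quarters_le_inner_ray hB hW hF (hYW ht) (hclose _ hsublevel)]
  rw [← hf₀] at hf hdecay
  obtain ⟨T, hT, hfT⟩ := exists_eq_zero_of_deriv_lt (hf₀ ▸ abs_nonneg η) hf hdecay
  rw [hf₀] at hT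
  have hsub : Icc 0 T ⊆ Icc 0 (2 * |η|) := Icc_subset_Icc_right hT.2
  have hs₀ : s ≠ 0 := abs_pos.1 (hs ▸ one_pos)
  exact ⟨s, T, Y, hs, hT.1, hT.2, hY₀, (mul_eq_zero.1 hfT).resolve_left hs₀, hYx T hT,
    hYW.mono_left hsub, fun t ht => (hY t (hsub ht)).mono hsub⟩

theorem exists_characteristic : ∃ (τ : ℝ) (X : ℝ → Sp d),
    IsCharacteristic F W u τ X ∧ inner ℝ ξ (X 0 - y) = 0 ∧
    coneNorm B y ξ (X 0) ≤ coneNorm B y ξ x ∧ X 1 = x ∧ |τ| ≤ 2 * |inner ℝ ξ (x - y)| := by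
  obtain ⟨s, T, Y, hs, hT₀, hT, hY₀, hplane, hYx, hYW, hY⟩ :=
    hu.exists_integral_curve_to_plane hB hW hF hball hx hclose
  have hB₀ := zero_lt_one.trans_le hB.one_le
  have hmem : MapsTo (fun t => T * (1 - t)) (Icc 0 1) (Icc 0 T) := fun t ht =>
    ⟨mul_nonneg hT₀ (sub_nonneg.2 ht.2), mul_le_of_le_one_right hT₀ (sub_le_self 1 ht.1)⟩
  refine ⟨T * s, fun t => Y (T * (1 - t)), ⟨hYW.comp hmem, fun t ht => ?_⟩, by simpa using hplane,
    ?_, by simp [hY₀], by rwa [abs_mul, hs, mul_one, abs_of_nonneg hT₀]⟩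
  · rw [mul_smul, ← neg_smul_neg, ← neg_smul]
    exact hasDerivWithinAt_comp_mul_one_sub ⟨hT₀, le_rfl⟩ (hY _ (hmem ht))
  · simp only [sub_zero, mul_one]
    rw [coneNorm, hplane, abs_zero, mul_zero, add_zero, coneNorm]
    have hηT : 2 * B * T ≤ 2 * B * (2 * |inner ℝ ξ (x - y)|) :=
      mul_le_mul_of_nonneg_left hT (by positivity)
    linarith [norm_sub_le_norm_sub_add_norm_sub (Y T) x y]

theorem norm_gradient_sub_lt (hξ : 1 / B ≤ ‖ξ‖)
    (hvan : ∀ x ∈ W, inner ℝ ξ (x - y) = 0 → u x = 0) (hn₀B : n₀ ≤ 1 / (4 * B))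
    (hdual : ∀ z ∈ Metric.closedBall y n₀, |1 - dual F z ξ| ≤ 1 / (16 * B ^ 2)) :
    ‖gradient u x - ξ‖ < 1 / (4 * B) := by
  obtain ⟨τ, X, hX, hX₀, hX₀n, rfl, hτ⟩ := hu.exists_characteristic hB hW hF hball hx hclose
  have hB₀ := zero_lt_one.trans_le hB.one_le
  have hplane : ‖gradient u (X 0) - ξ‖ ≤ 1 / (4 * B) / 4 :=
    calc ‖gradient u (X 0) - ξ‖ ≤ |1 - dual F (X 0) ξ| * B :=
          hu.norm_gradient_sub_le_on_plane hB hW hF (hX.mapsTo (by simp)) hξ hvan hX₀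
            (hclose _ hX₀n)
      _ ≤ 1 / (16 * B ^ 2) * B := by
          gcongr
          exact hdual _ (coneNorm_le_subset_closedBall hB₀.le y ξ n₀ (hX₀n.trans hx))
      _ = 1 / (4 * B) / 4 := by field_simp; norm_num
  have halong : ‖gradient u (X 1) - gradient u (X 0)‖ ≤ 1 / (4 * B) / 2 :=
    calc ‖gradient u (X 1) - gradient u (X 0)‖ ≤ |τ| * B :=
          hu.norm_gradient_sub_le_of_ray hB hW hF hX
      _ ≤ 2 * |inner ℝ ξ (X 1 - y)| * B := by gcongr
      _ = 4 * B * |inner ℝ ξ (X 1 - y)| / 2 := by ring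
      _ ≤ 1 / (4 * B) / 2 := by
          gcongr
          exact ((mul_abs_inner_le_coneNorm y ξ B (X 1)).trans hx).trans hn₀B
  have hpos : 0 < 1 / (4 * B) := by positivity
  linarith [norm_sub_le_norm_sub_add_norm_sub (gradient u (X 1)) (gradient u (X 0)) ξ]

end Backward

section Cone

variable {n₀ : ℝ} (hball : Metric.closedBall y (2 * n₀) ⊆ W) (hξ : gradient u y = ξ)
  (hvan : ∀ x ∈ W, inner ℝ ξ (x - y) = 0 → u x = 0) (hn₀B : n₀ ≤ 1 / (4 * B))
  (hdual : ∀ z ∈ Metric.closedBall y n₀, |1 - dual F z ξ| ≤ 1 / (16 * B ^ 2))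
  (hx : coneNorm B y ξ x ≤ n₀)
include hball hξ hvan hn₀B hdual hx

theorem norm_gradient_sub_le_of_coneNorm_le : ‖gradient u x - ξ‖ ≤ 1 / (4 * B) := by
  have hB₀ := zero_lt_one.trans_le hB.one_le
  have hn₀ : 0 ≤ n₀ := (norm_nonneg _).trans ((norm_sub_le_coneNorm hB₀.le y ξ x).trans hx)
  have hyW : y ∈ W := hball (Metric.mem_closedBall_self (by positivity))
  have hcont : ContinuousOn (fun z => ‖gradient u z - ξ‖) {z | coneNorm B y ξ z ≤ n₀} := fun z hz =>
    ((hu.contDiffAt_gradient (hball (Metric.closedBall_subset_closedBall (by linarith)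
      (coneNorm_le_subset_closedBall hB₀.le y ξ n₀ hz))) hW).continuousAt.sub
        continuousAt_const).norm.continuousWithinAt
  have hy : ‖gradient u y - ξ‖ < 1 / (4 * B) := by
    rw [hξ, sub_self, norm_zero]
    positivity
  by_contra! hbad
  obtain ⟨x', hx'n, hx'bad, hclose⟩ := exists_first_exit (convexOn_coneNorm hB₀.le y ξ)
    (continuous_coneNorm y ξ B) (fun _ => coneNorm_self_lt hB₀.le y ξ)
    (isCompact_coneNorm_le hB₀.le y ξ n₀) hcont hy hx hbad.le
  exact (hu.norm_gradient_sub_lt hB hW hF hball hx'n hclose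
    (hξ ▸ hu.one_div_le_norm_gradient hB hW hF hyW) hvan hn₀B hdual).not_ge hx'bad

theorem exists_characteristic_of_coneNorm_le : ∃ (τ : ℝ) (X : ℝ → Sp d),
    IsCharacteristic F W u τ X ∧ inner ℝ ξ (X 0 - y) = 0 ∧ X 1 = x := by
  obtain ⟨τ, X, hX, hX₀, -, hX₁, -⟩ := hu.exists_characteristic hB hW hF hball hx
    fun z hz => hu.norm_gradient_sub_le_of_coneNorm_le hB hW hF hball hξ hvan hn₀B hdual
      (hz.trans hx)
  exact ⟨τ, X, hX, hX₀, hX₁⟩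

end Cone

end IsEikonal

end Descent

section Cosphere

variable {W : Set (Sp d)} {F : Sp d → Sp d → ℝ} {y ξ ζ : Sp d}

/-- The curve in the cosphere at `y` obtained by radial projection of the line through `ξ` with
direction `ζ`. -/
def radialCurve (F : Sp d → Sp d → ℝ) (y ξ ζ : Sp d) (a : ℝ) : Sp d :=
  (dual F y (ξ + a • ζ))⁻¹ • (ξ + a • ζ)

/-- The parameters for which the radial projection defining `radialCurve` makes sense. -/
def radialDomain (ξ ζ : Sp d) : Set ℝ := {a | ξ + a • ζ ≠ 0}

theorem isOpen_radialDomain (ξ ζ : Sp d) : IsOpen (radialDomain ξ ζ) :=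
  isOpen_ne_fun (by fun_prop) continuous_const

theorem zero_mem_radialDomain (hξ : ξ ≠ 0) (ζ : Sp d) : (0 : ℝ) ∈ radialDomain ξ ζ := by
  simpa [radialDomain] using hξ

theorem radialCurve_zero (hξ : dual F y ξ = 1) (ζ : Sp d) : radialCurve F y ξ ζ 0 = ξ := by
  simp [radialCurve, hξ]

namespace IsFinsler

variable (hF : IsFinsler W F) (hW : IsOpen W) (hy : y ∈ W)
include hF hW hy

theorem contDiffAt_dual_snd (hξ : ξ ≠ 0) : ContDiffAt ℝ ∞ (dual F y) ξ :=
  (hF.contDiffAt_dual hW hy hξ).comp ξ (contDiffAt_const.prodMk contDiffAt_id)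

theorem dual_radialCurve {a : ℝ} (ha : a ∈ radialDomain ξ ζ) :
    dual F y (radialCurve F y ξ ζ a) = 1 := by
  have hpos := hF.dual_pos hW hy ha
  rw [radialCurve, hF.dual_smul hW hy ha (inv_pos.2 hpos), inv_mul_cancel₀ hpos.ne']

theorem contDiffAt_radialCurve {a : ℝ} (ha : a ∈ radialDomain ξ ζ) :
    ContDiffAt ℝ ∞ (radialCurve F y ξ ζ) a := by
  have hline : ContDiffAt ℝ ∞ (fun a : ℝ => ξ + a • ζ) a := by fun_prop
  have hdual : ContDiffAt ℝ ∞ (fun a : ℝ => dual F y (ξ + a • ζ)) a :=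
    ContDiffAt.comp (g := dual F y) a (hF.contDiffAt_dual_snd hW hy ha) hline
  exact (hdual.inv (hF.dual_pos hW hy ha).ne').smul hline

theorem fderiv_dual_eq_zero_of_isCurveThrough {η : ℝ → Sp d} (hξ : ξ ≠ 0)
    (hη : IsCurveThrough (cosphere F y) ξ ζ η) : fderiv ℝ (dual F y) ξ ζ = 0 := by
  have hdual := HasFDerivAt.comp_hasDerivAt_of_eq (l := dual F y) 0
    ((hF.contDiffAt_dual_snd hW hy hξ).differentiableAt (by simp)).hasFDerivAt hη.vel hη.base.symm
  exact hdual.unique ((hasDerivAt_const (0 : ℝ) (1 : ℝ)).congr_of_eventuallyEq hη.mem)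

variable (hξ : dual F y ξ = 1)
include hξ

theorem fderiv_dual (w : Sp d) :
    fderiv ℝ (dual F y) ξ w = inner ℝ (colegendre F (y, ξ)) w := by
  have hξ₀ := ne_zero_of_mem_cosphere hξ
  have hsq := (((hF.contDiffAt_dual_snd hW hy hξ₀).differentiableAt
    (by simp)).hasFDerivAt.pow 2).const_mul (1 / 2 : ℝ)
  have hham := hasFDerivAt_comp_prodMk_right ((hF.contDiffAt_ham hW hy hξ₀).differentiableAt
    (by simp))
  have heq : (fun η => ham F (y, η)) =ᶠ[𝓝 ξ] fun η => 1 / 2 * dual F y η ^ 2 := by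
    filter_upwards [isOpen_compl_singleton.mem_nhds hξ₀] with η hη using hF.ham_eq hW hy hη
  have hw : fderiv ℝ (ham F) (y, ξ) (0, w) = fderiv ℝ (dual F y) ξ w := by
    simpa [hξ] using congrArg (fun g => g w) (hham.unique (hsq.congr_of_eventuallyEq heq))
  rw [← hw, hF.fderiv_ham hW hy hξ₀, inner_zero_right, sub_zero]

theorem fderiv_dual_self : fderiv ℝ (dual F y) ξ ξ = 1 := by
  rw [hF.fderiv_dual hW hy hξ, real_inner_comm,
    hF.inner_colegendre hW hy (ne_zero_of_mem_cosphere hξ), hξ, one_pow]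

theorem hasDerivAt_radialCurve (hζ : fderiv ℝ (dual F y) ξ ζ = 0) :
    HasDerivAt (radialCurve F y ξ ζ) ζ 0 := by
  have hline : HasDerivAt (fun a : ℝ => ξ + a • ζ) ζ 0 := by
    simpa using ((hasDerivAt_id (0 : ℝ)).smul_const ζ).const_add ξ
  have hdual := HasFDerivAt.comp_hasDerivAt_of_eq (l := dual F y) 0 ((hF.contDiffAt_dual_snd hW hy
    (ne_zero_of_mem_cosphere hξ)).differentiableAt (by simp)).hasFDerivAt hline (by simp)
  rw [hζ] at hdual
  exact ((hdual.inv (by simp [hξ])).smul hline).congr_deriv (by simp [hξ])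

theorem isCurveThrough_radialCurve (hζ : fderiv ℝ (dual F y) ξ ζ = 0) :
    IsCurveThrough (cosphere F y) ξ ζ (radialCurve F y ξ ζ) where
  smooth := hF.contDiffAt_radialCurve hW hy (zero_mem_radialDomain (ne_zero_of_mem_cosphere hξ) ζ)
  mem := by
    filter_upwards [(isOpen_radialDomain ξ ζ).mem_nhds
      (zero_mem_radialDomain (ne_zero_of_mem_cosphere hξ) ζ)] with a ha
    exact hF.dual_radialCurve hW hy ha
  base := radialCurve_zero hξ ζ
  vel := hF.hasDerivAt_radialCurve hW hy hξ hζ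

end IsFinsler

theorem IsCurveThrough.iteratedDeriv_two_comp {S : Set (Sp d)} {g : Sp d → ℝ} {η : ℝ → Sp d}
    (hη : IsCurveThrough S ξ ζ η) (hg : ContDiffAt ℝ 2 g ξ) :
    iteratedDeriv 2 (fun a => g (η a)) 0 =
      fderiv ℝ (fderiv ℝ g) ξ ζ ζ + fderiv ℝ g ξ (iteratedDeriv 2 η 0) := by
  rw [← hη.base] at hg
  have h := iteratedDeriv_vcomp_two hg (hη.smooth.of_le two_le_infty)
  rwa [iteratedFDeriv_two_apply, hη.base, hη.vel.deriv] at h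

namespace IsCritical

variable {g : Sp d → ℝ} (hcrit : IsCritical (cosphere F y) g ξ) (hF : IsFinsler W F)
  (hW : IsOpen W) (hy : y ∈ W)
include hcrit hF hW hy

theorem fderiv_eq_mul (hg : DifferentiableAt ℝ g ξ) (w : Sp d) :
    fderiv ℝ g ξ w = fderiv ℝ g ξ ξ * fderiv ℝ (dual F y) ξ w := by
  have hξ : dual F y ξ = 1 := hcrit.1
  have htangent : fderiv ℝ (dual F y) ξ (w - fderiv ℝ (dual F y) ξ w • ξ) = 0 := by
    simp [hF.fderiv_dual_self hW hy hξ]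
  have hcurve := hF.isCurveThrough_radialCurve hW hy hξ htangent
  have hzero := (HasFDerivAt.comp_hasDerivAt_of_eq 0 hg.hasFDerivAt hcurve.vel
    hcurve.base.symm).unique (hcrit.2 _ _ hcurve)
  rw [map_sub, map_smul, smul_eq_mul, sub_eq_zero] at hzero
  rw [hzero, mul_comm]

theorem iteratedDeriv_two_eq (hg : ContDiffAt ℝ 2 g ξ) {η : ℝ → Sp d}
    (hη : IsCurveThrough (cosphere F y) ξ ζ η) :
    iteratedDeriv 2 (fun a => g (η a)) 0 =
      fderiv ℝ (fderiv ℝ g) ξ ζ ζ - fderiv ℝ g ξ ξ * fderiv ℝ (fderiv ℝ (dual F y)) ξ ζ ζ := by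
  have hdual := hη.iteratedDeriv_two_comp
    ((hF.contDiffAt_dual_snd hW hy (ne_zero_of_mem_cosphere hcrit.1)).of_le two_le_infty)
  have hconst : (fun a => dual F y (η a)) =ᶠ[𝓝 0] fun _ => (1 : ℝ) := hη.mem
  rw [hconst.iteratedDeriv_eq, iteratedDeriv_const] at hdual
  rw [hη.iteratedDeriv_two_comp hg, hcrit.fderiv_eq_mul hF hW hy (hg.differentiableAt (by simp)),
    eq_neg_of_add_eq_zero_right hdual.symm]
  ring

theorem exists_isHessian (hg : ContDiffAt ℝ 2 g ξ) :
    ∃ H : QuadraticForm ℝ (cosphereTangent F y ξ),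
      IsHessian (cosphere F y) g ξ (cosphereTangent F y ξ) H := by
  -- `b` is the second derivative of the Lagrangian `g - λ F_*(y, ·)` with multiplier `λ = dg(ξ) ξ`.
  let b := fderiv ℝ (fderiv ℝ g) ξ - fderiv ℝ g ξ ξ • fderiv ℝ (fderiv ℝ (dual F y)) ξ
  exact ⟨(LinearMap.BilinMap.toQuadraticMap b.toLinearMap₁₂).comp (cosphereTangent F y ξ).subtype,
    fun _ _ hη => hcrit.iteratedDeriv_two_eq hF hW hy hg hη⟩

end IsCritical

end Cosphere

section Phase

variable {W U : Set (Sp d)} {F : Sp d → Sp d → ℝ} {φ : Sp d → Sp d → Sp d → ℝ} {B κ : ℝ}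
  {x y ξ ζ : Sp d}

/-- The phase with base point `y`, and with covectors restricted to the curve `radialCurve`, as a
one-parameter family of functions. -/
def radialFamily (F : Sp d → Sp d → ℝ) (φ : Sp d → Sp d → Sp d → ℝ) (y ξ ζ : Sp d)
    (z : Sp d × ℝ) : ℝ :=
  φ z.1 y (radialCurve F y ξ ζ z.2)

namespace IsEikonalPhase

variable (hφ : IsEikonalPhase F W U φ) (hy : y ∈ U)
include hφ hy

theorem ray_self (F : Sp d → Sp d → ℝ) (hξ : ξ ≠ 0) :
    ray F (fun x => φ x y ξ) y = colegendre F (y, ξ) := by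
  rw [ray, hφ.orientation y hy ξ hξ]

theorem self_eq_zero (hyW : y ∈ W) (hξ : ξ ≠ 0) : φ y y ξ = 0 :=
  hφ.vanishing y hyW y hy ξ hξ (by simp)

variable (hW : IsOpen W)
include hW

section Smooth

variable (hx : x ∈ W) (hξ : ξ ≠ 0)
include hx hξ

theorem contDiffAt : ContDiffAt ℝ ∞ (fun z : Sp d × Sp d => φ z.1 y z.2) (x, ξ) :=
  (hφ.smooth.comp (s := W ×ˢ {0}ᶜ) (f := fun z : Sp d × Sp d => (z.1, y, z.2)) (by fun_prop)
    fun _ hz => ⟨hz.1, hy, hz.2⟩).contDiffAt ((hW.prod isOpen_compl_singleton).mem_nhds ⟨hx, hξ⟩)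

theorem contDiffAt_covector : ContDiffAt ℝ ∞ (fun ξ => φ x y ξ) ξ :=
  (hφ.contDiffAt hy hW hx hξ).comp ξ (contDiffAt_const.prodMk contDiffAt_id)

theorem inner_gradient_add_fderiv_eq_zero {w : Sp d} (h₀ : inner ℝ ξ (x - y) = 0)
    (h₁ : inner ℝ ξ w + inner ℝ ζ (x - y) = 0) (h₂ : inner ℝ ζ w = 0) :
    inner ℝ (gradient (fun x => φ x y ξ) x) w + fderiv ℝ (φ x y) ξ ζ = 0 := by
  have hsmooth := (hφ.contDiffAt hy hW hx hξ).differentiableAt (by simp)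
  have hcovector := (hasFDerivAt_comp_prodMk_right hsmooth).fderiv
  have hzero := fderiv_apply_eq_zero_of_eventually (w := (w, ζ)) hsmooth (by
    filter_upwards [eventually_add_smul_mem (hW.prod isOpen_compl_singleton)
      (show (x, ξ) ∈ W ×ˢ {0}ᶜ from ⟨hx, hξ⟩) (w, ζ)] with t ht
    refine hφ.vanishing _ ht.1 y hy _ ht.2 ?_
    simp only [Prod.mk_add_mk, Prod.smul_mk, add_sub_right_comm, inner_add_left, inner_add_right,
      real_inner_smul_left, inner_smul_right, h₀, h₂]
    linear_combination t * h₁)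
  rw [gradient_comp_prodMk_left hsmooth, inner_gradFst, hcovector]
  simpa [← map_add] using hzero

end Smooth

theorem isEikonal (hξ : dual F y ξ = 1) : IsEikonal F W fun x => φ x y ξ where
  smooth x hx := ((hφ.contDiffAt hy hW hx (ne_zero_of_mem_cosphere hξ)).comp x
    (contDiffAt_id.prodMk contDiffAt_const)).contDiffWithinAt
  dual_eq x hx := by rw [hφ.eikonal x hx y hy ξ (ne_zero_of_mem_cosphere hξ), hξ]

variable (hyW : y ∈ W) (hF : IsFinsler W F)
include hyW hF

theorem contDiffAt_radialFamily (hx : x ∈ W) {a : ℝ} (ha : a ∈ radialDomain ξ ζ) :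
    ContDiffAt ℝ ∞ (radialFamily F φ y ξ ζ) (x, a) :=
  ContDiffAt.comp (g := fun z : Sp d × Sp d => φ z.1 y z.2) (x, a)
    (hφ.contDiffAt hy hW hx (ne_zero_of_mem_cosphere (hF.dual_radialCurve hW hyW ha)))
    (contDiffAt_fst.prodMk ((hF.contDiffAt_radialCurve hW hyW ha).comp (x, a) contDiffAt_snd))

theorem isEikonalFamily_radialFamily (ξ ζ : Sp d) :
    IsEikonalFamily F W (radialDomain ξ ζ) (radialFamily F φ y ξ ζ) where
  smooth z hz := (hφ.contDiffAt_radialFamily hy hW hyW hF hz.1 hz.2).contDiffWithinAt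
  dual_eq x hx a ha := by
    rw [← gradient_comp_prodMk_left ((hφ.contDiffAt_radialFamily hy hW hyW hF hx
      ha).differentiableAt (by simp))]
    exact (hφ.isEikonal hy hW (hF.dual_radialCurve hW hyW ha)).dual_eq x hx

theorem gradFst_radialFamily {a : ℝ} (ha : a ∈ radialDomain ξ ζ) :
    gradFst (radialFamily F φ y ξ ζ) (y, a) = radialCurve F y ξ ζ a := by
  rw [← (hφ.isEikonalFamily_radialFamily hy hW hyW hF ξ ζ).gradient_eq hW
    (isOpen_radialDomain ξ ζ) hyW ha]
  exact hφ.orientation y hy _ (ne_zero_of_mem_cosphere (hF.dual_radialCurve hW hyW ha))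

section Tangent

variable (hξ : dual F y ξ = 1) (hζ : fderiv ℝ (dual F y) ξ ζ = 0)
include hξ hζ

theorem paramDeriv_gradFst_radialFamily :
    paramDeriv (gradFst (radialFamily F φ y ξ ζ)) (y, 0) = ζ := by
  have h₀ := zero_mem_radialDomain (ne_zero_of_mem_cosphere hξ) ζ
  refine paramDeriv_eq_of_eventuallyEq
    (((hφ.isEikonalFamily_radialFamily hy hW hyW hF ξ ζ).contDiffAt_gradFst hW
      (isOpen_radialDomain ξ ζ) hyW h₀).differentiableAt (by simp))
    (hF.hasDerivAt_radialCurve hW hyW hξ hζ) ?_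
  filter_upwards [(isOpen_radialDomain ξ ζ).mem_nhds h₀] with a ha
    using hφ.gradFst_radialFamily hy hW hyW hF ha

theorem paramDeriv_radialFamily (hx : x ∈ W) :
    paramDeriv (radialFamily F φ y ξ ζ) (x, 0) = fderiv ℝ (φ x y) ξ ζ := by
  have hξ₀ := ne_zero_of_mem_cosphere hξ
  exact (hasDerivAt_paramDeriv ((hφ.contDiffAt_radialFamily hy hW hyW hF hx
    (zero_mem_radialDomain hξ₀ ζ)).differentiableAt (by simp))).unique
      (HasFDerivAt.comp_hasDerivAt_of_eq 0
        ((hφ.contDiffAt_covector hy hW hx hξ₀).differentiableAt (by simp)).hasFDerivAt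
        (hF.hasDerivAt_radialCurve hW hyW hξ hζ) (radialCurve_zero hξ ζ).symm)

end Tangent

variable (hξ : dual F y ξ = 1) {c : ℝ → Sp d} {ℓ : ℝ}
  (hc : IsCharacteristic F W (fun x => φ x y ξ) ℓ c)
include hξ hc

theorem fderiv_eq_of_isCharacteristic (hζ : fderiv ℝ (dual F y) ξ ζ = 0) :
    fderiv ℝ (φ (c 1) y) ξ ζ = fderiv ℝ (φ (c 0) y) ξ ζ := by
  have hc' : IsCharacteristic F W (fun x => radialFamily F φ y ξ ζ (x, 0)) ℓ c := by
    simpa only [radialFamily, radialCurve_zero hξ] using hc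
  rw [← hφ.paramDeriv_radialFamily hy hW hyW hF hξ hζ (hc.mapsTo (by simp)),
    ← hφ.paramDeriv_radialFamily hy hW hyW hF hξ hζ (hc.mapsTo (by simp))]
  exact (hφ.isEikonalFamily_radialFamily hy hW hyW hF ξ ζ).paramDeriv_eq_of_mem_Icc hW
    (isOpen_radialDomain ξ ζ) (zero_mem_radialDomain (ne_zero_of_mem_cosphere hξ) ζ) hc' hF
    (by simp)

theorem start_eq_of_isCritical (hc₀ : inner ℝ ξ (c 0 - y) = 0)
    (hcrit : IsCritical (cosphere F y) (φ (c 1) y) ξ) : c 0 = y := by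
  have hξ₀ := ne_zero_of_mem_cosphere hξ
  have hc₀W : c 0 ∈ W := hc.mapsTo (by simp)
  have hu := hφ.isEikonal hy hW hξ
  set z := c 0
  set v := colegendre F (y, ξ)
  set ζ := (z - y) - inner ℝ v (z - y) • ξ with hζ_def
  have hξv : inner ℝ ξ v = 1 := by rw [hF.inner_colegendre hW hyW hξ₀, hξ, one_pow]
  have hvζ : inner ℝ v ζ = 0 := by
    rw [hζ_def, inner_sub_right, inner_smul_right, real_inner_comm ξ v, hξv, mul_one, sub_self]
  have hζz : inner ℝ ζ (z - y) = ‖z - y‖ ^ 2 := by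
    rw [hζ_def, inner_sub_left, real_inner_smul_left, hc₀, mul_zero, sub_zero,
      real_inner_self_eq_norm_sq]
  have hζ : fderiv ℝ (dual F y) ξ ζ = 0 := by rw [hF.fderiv_dual hW hyW hξ, hvζ]
  have hcurve := hF.isCurveThrough_radialCurve hW hyW hξ hζ
  have hfderiv : fderiv ℝ (φ z y) ξ ζ = 0 := by
    rw [← hφ.fderiv_eq_of_isCharacteristic hy hW hyW hF hξ hc hζ]
    exact (HasFDerivAt.comp_hasDerivAt_of_eq 0 ((hφ.contDiffAt_covector hy hW
      (hc.mapsTo (by simp)) hξ₀).differentiableAt (by simp)).hasFDerivAt hcurve.vel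
      hcurve.base.symm).unique (hcrit.2 ζ _ hcurve)
  -- Moving `ξ` along `ζ` tilts the plane on which the phase vanishes; `z` follows it along `w`.
  have hzero := hφ.inner_gradient_add_fderiv_eq_zero hy hW hc₀W hξ₀ hc₀
    (ζ := ζ) (w := -‖z - y‖ ^ 2 • v)
    (by rw [inner_smul_right, hξv, hζz]; ring)
    (by rw [inner_smul_right, real_inner_comm, hvζ, mul_zero])
  obtain ⟨b, hb⟩ := hu.exists_gradient_eq_smul hW hc₀W hξ₀
    (fun x hx => hφ.vanishing x hx y hy ξ hξ₀) hc₀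
  have hb₀ : b ≠ 0 := fun h => hu.gradient_ne_zero hc₀W (by rw [hb, h, zero_smul])
  rw [hfderiv, hb, real_inner_smul_left, inner_smul_right, hξv] at hzero
  simpa [hb₀, sub_eq_zero] using hzero

variable (hc₀ : c 0 = y)
include hc₀

theorem apply_end_eq : φ (c 1) y ξ = ℓ := by
  have h := hc.sub_eq hW hF (hφ.isEikonal hy hW hξ)
  rwa [hc₀, hφ.self_eq_zero hy hyW (ne_zero_of_mem_cosphere hξ), sub_zero] at h

theorem isCritical_of_isCharacteristic : IsCritical (cosphere F y) (φ (c 1) y) ξ := by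
  have hξ₀ := ne_zero_of_mem_cosphere hξ
  refine ⟨hξ, fun ζ η hη => ?_⟩
  have hζ := hF.fderiv_dual_eq_zero_of_isCurveThrough hW hyW hξ₀ hη
  have hzero : fderiv ℝ (φ (c 1) y) ξ ζ = 0 := by
    rw [hφ.fderiv_eq_of_isCharacteristic hy hW hyW hF hξ hc hζ, hc₀]
    simpa using hφ.inner_gradient_add_fderiv_eq_zero hy hW hyW hξ₀ (w := 0) (ζ := ζ)
  refine HasDerivAt.congr_deriv ?_ hzero
  exact HasFDerivAt.comp_hasDerivAt_of_eq 0 ((hφ.contDiffAt_covector hy hW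
    (hc.mapsTo unitInterval.one_mem) hξ₀).differentiableAt (by simp)).hasFDerivAt hη.vel
    hη.base.symm

variable (hB : HamiltonianBounds F W B κ) (hℓ : |ℓ| * shortRate B < 1)
include hB hℓ

theorem exists_iteratedDeriv_two_eq (hζ : fderiv ℝ (dual F y) ξ ζ = 0) :
    ∃ q, κ / 4 * ‖ζ‖ ^ 2 ≤ q ∧
      iteratedDeriv 2 (fun a => φ (c 1) y (radialCurve F y ξ ζ a)) 0 = -ℓ * q := by
  have hξ₀ := ne_zero_of_mem_cosphere hξ
  have hJ := isOpen_radialDomain ξ ζ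
  have h₀ := zero_mem_radialDomain hξ₀ ζ
  have hG := hφ.isEikonalFamily_radialFamily hy hW hyW hF ξ ζ
  have hc' : IsCharacteristic F W (fun x => radialFamily F φ y ξ ζ (x, 0)) ℓ c := by
    simpa only [radialFamily, radialCurve_zero hξ] using hc
  obtain ⟨q, hq, heq⟩ := hG.exists_paramDeriv_paramDeriv_eq hW hJ h₀ hc' hF hB
    (fun x hx h => by
      rw [hc₀, hφ.gradFst_radialFamily hy hW hyW hF h₀, radialCurve_zero hξ] at h
      simpa only [radialFamily, radialCurve_zero hξ] using hφ.vanishing x hx y hy ξ hξ₀ h)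
    (fun a ha => by
      rw [hc₀]
      exact hφ.self_eq_zero hy hyW (ne_zero_of_mem_cosphere (hF.dual_radialCurve hW hyW ha))) hℓ
  rw [hc₀, hφ.paramDeriv_gradFst_radialFamily hy hW hyW hF hξ hζ] at hq
  refine ⟨q, hq, ?_⟩
  rw [← heq, ← iteratedDeriv_two_eq_paramDeriv
    ((hG.contDiffAt hW hJ (hc.mapsTo unitInterval.one_mem) h₀).of_le two_le_infty)]
  rfl

theorem exists_isHessian : ∃ H : QuadraticForm ℝ (cosphereTangent F y ξ),
    IsHessian (cosphere F y) (φ (c 1) y) ξ (cosphereTangent F y ξ) H ∧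
      ∀ ζ, ∃ q, κ / 4 * ‖ζ‖ ^ 2 ≤ q ∧ H ζ = -ℓ * q := by
  obtain ⟨H, hH⟩ := (hφ.isCritical_of_isCharacteristic hy hW hyW hF hξ hc hc₀).exists_isHessian hF
    hW hyW ((hφ.contDiffAt_covector hy hW (hc.mapsTo (by simp))
      (ne_zero_of_mem_cosphere hξ)).of_le two_le_infty)
  refine ⟨H, hH, fun ζ => ?_⟩
  rw [← hH ζ _ (hF.isCurveThrough_radialCurve hW hyW hξ ζ.2)]
  exact hφ.exists_iteratedDeriv_two_eq hy hW hyW hF hξ hc hc₀ hB hℓ ζ.2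

end IsEikonalPhase

end Phase

section Matching

variable {W U : Set (Sp d)} {F : Sp d → Sp d → ℝ} {u w : Sp d → ℝ} {φ : Sp d → Sp d → Sp d → ℝ}
  {c e : ℝ → Sp d} {ℓ τ t : ℝ} {x y v ξ η : Sp d}

namespace IsCharacteristic

variable (hc : IsCharacteristic F W w ℓ c) (hW : IsOpen W) (hF : IsFinsler W F)
  (hw : IsEikonal F W w)
include hc hW hF hw

theorem speed_eq (hℓ : 0 ≤ ℓ) (ht : t ∈ Icc (0 : ℝ) 1) : F (c t) (ℓ • ray F w (c t)) = ℓ := by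
  rw [hF.homogeneous _ (hc.mapsTo ht) _ ℓ hℓ, hw.apply_ray (hc.mapsTo ht) hW hF, mul_one]

variable (hu : IsEikonal F W u)
include hu

theorem sub_le (hℓ : 0 ≤ ℓ) : u (c 1) - u (c 0) ≤ ℓ :=
  hu.sub_le_of_speed_le hW hc.hasDerivWithinAt hc.mapsTo hF fun _ ht =>
    (hc.speed_eq hW hF hw hℓ ht).le

theorem gradient_eq (he : IsCharacteristic F W u τ e) (hℓ : 0 < ℓ) (hτ : 0 < τ)
    (h₀ : c 0 = e 0) (h₁ : c 1 = e 1) (ht : t ∈ Icc (0 : ℝ) 1) :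
    gradient u (c t) = gradient w (c t) := by
  have hsub_w := hc.sub_eq hW hF hw
  have hsub_u := he.sub_eq hW hF hu
  have hle_w := he.sub_le hW hF hu hw hτ.le
  have hle_u := hc.sub_le hW hF hw hu hℓ.le
  rw [← h₀, ← h₁] at hsub_u hle_w
  have hray := hu.eq_smul_ray_of_sub_eq hW hc.hasDerivWithinAt hc.mapsTo hF hℓ
    (fun t ht => hc.speed_eq hW hF hw hℓ.le ht) (by linarith) ht
  rw [← hu.momentum_ray (hc.mapsTo ht) hW hF, ← smul_right_injective _ hℓ.ne' hray,
    hw.momentum_ray (hc.mapsTo ht) hW hF]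

end IsCharacteristic

theorem IsEikonalPhase.covector_eq_of_isCharacteristic (hφ : IsEikonalPhase F W U φ) (hy : y ∈ U)
    (hW : IsOpen W) (hF : IsFinsler W F) (hξ : dual F y ξ = 1) (hη : dual F y η = 1)
    (hc : IsCharacteristic F W (fun x => φ x y ξ) ℓ c)
    (he : IsCharacteristic F W (fun x => φ x y η) τ e) (hc₀ : c 0 = y) (he₀ : e 0 = y)
    (h₁ : c 1 = e 1) (hsign : 0 < ℓ * τ) : ξ = η := by
  have hu := hφ.isEikonal hy hW hξ
  have hw := hφ.isEikonal hy hW hη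
  rw [← hφ.orientation y hy ξ (ne_zero_of_mem_cosphere hξ),
    ← hφ.orientation y hy η (ne_zero_of_mem_cosphere hη)]
  rcases mul_pos_iff.1 hsign with ⟨hℓ, hτ⟩ | ⟨hℓ, hτ⟩
  · simpa [hc₀] using (hc.gradient_eq hW hF hu hw he hℓ hτ (hc₀.trans he₀.symm) h₁
      unitInterval.zero_mem).symm
  · simpa [hc₀] using (hc.reverse.gradient_eq hW hF hu hw he.reverse (neg_pos.2 hℓ)
      (neg_pos.2 hτ) (by simpa using h₁) (by simp [hc₀, he₀]) unitInterval.one_mem).symm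

section Unit

variable (hF : IsFinsler W F) (hW : IsOpen W) (hx : x ∈ W) (hv : v ≠ 0)
include hF hW hx hv

theorem IsFinsler.unit_ne_zero : unit F x v ≠ 0 :=
  smul_ne_zero (inv_pos.2 (hF.pos hW hx hv)).ne' hv

theorem IsFinsler.dual_legendre_unit : dual F x (legendre F x (unit F x v)) = 1 := by
  have hpos := hF.pos hW hx hv
  have hne := hF.unit_ne_zero hW hx hv
  rw [hF.legendre_eq hW hx hne, hF.dual_momentum hW hx hne, unit,
    hF.homogeneous x hx _ _ (inv_pos.2 hpos).le, inv_mul_cancel₀ hpos.ne']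

theorem IsFinsler.smul_colegendre_legendre_unit :
    F x v • colegendre F (x, legendre F x (unit F x v)) = v := by
  have hne := hF.unit_ne_zero hW hx hv
  rw [hF.legendre_eq hW hx hne, hF.colegendre_momentum hW hx hne, unit, smul_smul,
    mul_inv_cancel₀ (hF.pos hW hx hv).ne', one_smul]

end Unit

namespace IsGeodesic

variable (hc : IsGeodesic F c) (hW : IsOpen W) (hF : IsFinsler W F) (hcW : MapsTo c (Icc 0 1) W)
  (hne : c 0 ≠ c 1)
include hc hW hF hcW hne

theorem length_pos : 0 < length F c := by
  rw [hc.length_eq hW hF hcW]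
  exact hc.speed_pos hW hF hcW hne

variable (ht : t ∈ Icc (0 : ℝ) 1)
include ht

theorem velocity_ne_zero_of_ne : velocity c t ≠ 0 := by
  refine hc.velocity_ne_zero hW hF hcW unitInterval.zero_mem (fun hv => ?_) ht
  have hpos := hc.speed_pos hW hF hcW hne
  rw [hv, hF.apply_zero (hcW unitInterval.zero_mem)] at hpos
  exact hpos.ne' rfl

theorem dual_legendre_unit_velocity :
    dual F (c t) (legendre F (c t) (unit F (c t) (velocity c t))) = 1 :=
  hF.dual_legendre_unit hW (hcW ht) (hc.velocity_ne_zero_of_ne hW hF hcW hne ht)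

theorem isCharacteristic (hφ : IsEikonalPhase F W U φ) (hct : c t ∈ U) :
    IsCharacteristic F W (fun x => φ x (c t) (legendre F (c t) (unit F (c t) (velocity c t))))
      (length F c) c where
  mapsTo := hcW
  hasDerivWithinAt s hs := by
    have hξ := hc.dual_legendre_unit_velocity hW hF hcW hne ht
    have hray : velocity c t = length F c • ray F
        (fun x => φ x (c t) (legendre F (c t) (unit F (c t) (velocity c t)))) (c t) := by
      rw [hφ.ray_self hct F (ne_zero_of_mem_cosphere hξ), hc.length_eq hW hF hcW,
        ← hc.speed_eq hW hF hcW ht, hF.smul_colegendre_legendre_unit hW (hcW ht)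
          (hc.velocity_ne_zero_of_ne hW hF hcW hne ht)]
    rw [← hc.velocity_eq_ray hW hF (hφ.isEikonal hct hW hξ) hcW
      (hc.length_pos hW hF hcW hne) ht hray hs]
    exact hc.hasDerivWithinAt hs

end IsGeodesic

end Matching

section SmallRadius

variable {V W K U : Set (Sp d)} {F : Sp d → Sp d → ℝ} {u : Sp d → ℝ} {φ : Sp d → Sp d → Sp d → ℝ}
  {B κ n₀ ℓ : ℝ} {c : ℝ → Sp d} {x y ξ : Sp d}

/-- `n₀` is so small that eikonal phases with base point `y` are controlled at distance `n₀` from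
`y`: points in the cone of size `n₀` are reached by characteristics, and characteristics from `y`
to points at distance at most `n₀` are shorter than `1 / shortRate B`. -/
structure IsSmallRadius (F : Sp d → Sp d → ℝ) (W : Set (Sp d)) (B : ℝ) (y : Sp d) (n₀ : ℝ) :
    Prop where
  closedBall_subset : Metric.closedBall y (2 * n₀) ⊆ W
  le : n₀ ≤ 1 / (4 * B)
  mul_shortRate_lt : B * n₀ * shortRate B < 1
  abs_one_sub_dual_le : ∀ ξ ∈ cosphere F y, ∀ z ∈ Metric.closedBall y n₀,
    |1 - dual F z ξ| ≤ 1 / (16 * B ^ 2)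

theorem IsFinsler.exists_abs_one_sub_dual_le (hF : IsFinsler V F) (hV : IsOpen V)
    (hK : IsCompact K) (hKV : K ⊆ V) {ε : ℝ} (hε : 0 < ε) :
    ∃ δ > 0, ∀ x ∈ K, ∀ z ∈ K, dist z x ≤ δ → ∀ ξ ∈ cosphere F x, |1 - dual F z ξ| ≤ ε := by
  have hS : IsCompact (Prod.snd '' cosphereBundle F K) :=
    (hF.isCompact_cosphereBundle hV hK hKV).image continuous_snd
  have hcont : ContinuousOn (fun z : Sp d × Sp d => dual F z.1 z.2)
      (K ×ˢ (Prod.snd '' cosphereBundle F K)) := by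
    rintro ⟨x, _⟩ ⟨hx, z, hz, rfl⟩
    exact (hF.contDiffAt_dual hV (hKV hx)
      (ne_zero_of_mem_cosphere hz.2)).continuousAt.continuousWithinAt
  obtain ⟨δ, hδ, h⟩ := Metric.uniformContinuousOn_iff_le.1
    ((hK.prod hS).uniformContinuousOn_of_continuous hcont) ε hε
  refine ⟨δ, hδ, fun x hx z hz hzx ξ hξ => ?_⟩
  have hξS : ξ ∈ Prod.snd '' cosphereBundle F K := ⟨(x, ξ), ⟨hx, hξ⟩, rfl⟩
  have hdual : dual F x ξ = 1 := hξ
  simpa [Real.dist_eq, hdual] using h (x, ξ) ⟨hx, hξS⟩ (z, ξ) ⟨hz, hξS⟩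
    (by rwa [Prod.dist_eq, dist_self, max_eq_left dist_nonneg, dist_comm])

theorem IsFinsler.exists_isSmallRadius (hF : IsFinsler V F) (hV : IsOpen V) (hK : IsCompact K)
    (hKV : K ⊆ V) (hB : 0 < B) : ∃ ρ > 0, ∀ n₀ ≤ ρ, ∀ W ⊆ K, ∀ y,
      Metric.closedBall y (2 * n₀) ⊆ W → IsSmallRadius F W B y n₀ := by
  obtain ⟨δ, hδ, hdual⟩ := hF.exists_abs_one_sub_dual_le hV hK hKV
    (ε := 1 / (16 * B ^ 2)) (by positivity)
  have hrate : 0 < shortRate B := by unfold shortRate; positivity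
  refine ⟨min δ (min (1 / (4 * B)) (1 / (2 * (B * shortRate B)))), by positivity,
    fun n₀ hn₀ W hWK y hball => ⟨hball, ?_, ?_, fun ξ hξ z hz => ?_⟩⟩
  · exact hn₀.trans ((min_le_right _ _).trans (min_le_left _ _))
  · have hle := (le_div_iff₀ (by positivity)).1
      (hn₀.trans ((min_le_right _ _).trans (min_le_right _ _)))
    linarith
  · have hpos : 0 ≤ n₀ := dist_nonneg.trans hz
    have hsub : Metric.closedBall y n₀ ⊆ K :=
      (Metric.closedBall_subset_closedBall (by linarith)).trans (hball.trans hWK)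
    exact hdual y (hsub (Metric.mem_closedBall_self hpos)) z (hsub hz)
      (hz.trans (hn₀.trans (min_le_left _ _))) ξ hξ

theorem IsEikonal.abs_sub_le (hu : IsEikonal F W u) (hW : IsOpen W)
    (hB : HamiltonianBounds F W B κ) (hball : Metric.closedBall y ‖x - y‖ ⊆ W) :
    |u x - u y| ≤ B * ‖x - y‖ := by
  refine (convex_closedBall y ‖x - y‖).norm_image_sub_le_of_norm_fderiv_le (fun z hz =>
    (hu.contDiffAt (hball hz) hW).differentiableAt (by simp)) (fun z hz => ?_)
    (Metric.mem_closedBall_self (norm_nonneg _)) (mem_closedBall_iff_norm.2 le_rfl)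
  simpa [gradient] using hu.norm_gradient_le hB (hball hz)

theorem HamiltonianBounds.coneNorm_le (hB : HamiltonianBounds F W B κ) (hyW : y ∈ W)
    (hξ : ξ ∈ cosphere F y) (x : Sp d) : coneNorm B y ξ x ≤ (1 + 4 * B ^ 2) * ‖x - y‖ := by
  have hB₀ := zero_lt_one.trans_le hB.one_le
  calc coneNorm B y ξ x ≤ ‖x - y‖ + 4 * B * (B * ‖x - y‖) := by
        unfold coneNorm
        gcongr
        exact (abs_real_inner_le_norm _ _).trans
          (mul_le_mul_of_nonneg_right (hB.norm_covector (y, ξ) ⟨hyW, hξ⟩) (norm_nonneg _))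
    _ = (1 + 4 * B ^ 2) * ‖x - y‖ := by ring

namespace IsEikonalPhase

variable (hφ : IsEikonalPhase F W U φ) (hy : y ∈ U) (hW : IsOpen W) (hF : IsFinsler W F)
  (hB : HamiltonianBounds F W B κ) (hn : IsSmallRadius F W B y n₀)
include hφ hy hW hF hB hn

theorem exists_isCharacteristic_of_isCritical (hx : (1 + 4 * B ^ 2) * ‖x - y‖ ≤ n₀)
    (hcrit : IsCritical (cosphere F y) (φ x y) ξ) :
    ∃ (τ : ℝ) (X : ℝ → Sp d),
      IsCharacteristic F W (fun x => φ x y ξ) τ X ∧ X 0 = y ∧ X 1 = x := by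
  have hn₀ : 0 ≤ n₀ := le_trans (by positivity) hx
  have hyW : y ∈ W := hn.closedBall_subset (Metric.mem_closedBall_self (by positivity))
  have hξ₀ := ne_zero_of_mem_cosphere hcrit.1
  obtain ⟨τ, X, hX, hX₀, rfl⟩ :=
    (hφ.isEikonal hy hW hcrit.1).exists_characteristic_of_coneNorm_le hB hW hF
      hn.closedBall_subset (hφ.orientation y hy ξ hξ₀)
      (fun x hx => hφ.vanishing x hx y hy ξ hξ₀) hn.le (hn.abs_one_sub_dual_le ξ hcrit.1)
      ((hB.coneNorm_le hyW hcrit.1 x).trans hx)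
  exact ⟨τ, X, hX, hφ.start_eq_of_isCritical hy hW hyW hF hcrit.1 hX hX₀ hcrit, rfl⟩

section TwoCharacteristics

variable {ξp ξm : Sp d} {p m : ℝ} {cp cm : ℝ → Sp d}
  (hx : (1 + 4 * B ^ 2) * ‖x - y‖ ≤ n₀) (hξp : dual F y ξp = 1) (hξm : dual F y ξm = 1)
  (hp : IsCharacteristic F W (fun x => φ x y ξp) p cp)
  (hm : IsCharacteristic F W (fun x => φ x y ξm) m cm)
  (hcp₀ : cp 0 = y) (hcm₀ : cm 0 = y) (hcp₁ : cp 1 = x) (hcm₁ : cm 1 = x)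
include hx hξp hξm hp hm hcp₀ hcm₀ hcp₁ hcm₁

theorem setOf_isCritical_eq (hp₀ : 0 < p) (hm₀ : m < 0) :
    {ξ | IsCritical (cosphere F y) (φ x y) ξ} = {ξp, ξm} := by
  have hyW : y ∈ W := hcp₀ ▸ hp.mapsTo unitInterval.zero_mem
  refine Subset.antisymm (fun ξ hcrit => ?_) ?_
  · obtain ⟨τ, X, hX, hX₀, hX₁⟩ :=
      hφ.exists_isCharacteristic_of_isCritical hy hW hF hB hn hx hcrit
    have hτ : τ ≠ 0 := by
      rintro rfl
      have hval := hp.sub_eq hW hF (hφ.isEikonal hy hW hξp)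
      have hconst := constant_of_derivWithin_zero
        (fun t ht => (hX.hasDerivWithinAt t ht).differentiableWithinAt)
        (fun t ht => by
          rw [(hX.hasDerivWithinAt t (Ico_subset_Icc_self ht)).derivWithin
            (uniqueDiffOn_Icc zero_lt_one t (Ico_subset_Icc_self ht)), zero_smul]) 1 (by simp)
      rw [hcp₁, hcp₀, ← hX₁, hconst, hX₀, sub_self] at hval
      exact hp₀.ne hval
    rcases hτ.lt_or_gt with hτ | hτ
    · exact .inr (hφ.covector_eq_of_isCharacteristic hy hW hF hcrit.1 hξm hX hm hX₀ hcm₀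
        (hX₁.trans hcm₁.symm) (mul_pos_of_neg_of_neg hτ hm₀))
    · exact .inl (hφ.covector_eq_of_isCharacteristic hy hW hF hcrit.1 hξp hX hp hX₀ hcp₀
        (hX₁.trans hcp₁.symm) (mul_pos hτ hp₀))
  · rintro ξ (rfl | rfl)
    · exact hcp₁ ▸ hφ.isCritical_of_isCharacteristic hy hW hyW hF hξp hp hcp₀
    · exact hcm₁ ▸ hφ.isCritical_of_isCharacteristic hy hW hyW hF hξm hm hcm₀

end TwoCharacteristics

variable (hξ : dual F y ξ = 1) (hc : IsCharacteristic F W (fun x => φ x y ξ) ℓ c) (hc₀ : c 0 = y)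
  (hx : (1 + 4 * B ^ 2) * ‖c 1 - y‖ ≤ n₀)
include hξ hc hc₀ hx

theorem abs_mul_shortRate_lt : |ℓ| * shortRate B < 1 := by
  have hyW : y ∈ W := hc₀ ▸ hc.mapsTo unitInterval.zero_mem
  have hB₀ := zero_lt_one.trans_le hB.one_le
  have hrate : 0 ≤ shortRate B := by unfold shortRate; positivity
  have hdist : ‖c 1 - y‖ ≤ n₀ := le_trans (by nlinarith [norm_nonneg (c 1 - y)]) hx
  have habs := (hφ.isEikonal hy hW hξ).abs_sub_le hW hB (y := y) (x := c 1)
    ((Metric.closedBall_subset_closedBall (by linarith [norm_nonneg (c 1 - y)])).trans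
      hn.closedBall_subset)
  rw [hφ.apply_end_eq hy hW hyW hF hξ hc hc₀,
    hφ.self_eq_zero hy hyW (ne_zero_of_mem_cosphere hξ), sub_zero] at habs
  calc |ℓ| * shortRate B ≤ B * n₀ * shortRate B := by gcongr; exact habs.trans (by gcongr)
    _ < 1 := hn.mul_shortRate_lt

theorem exists_isHessian_le (hℓ : 0 ≤ ℓ) : ∃ H : QuadraticForm ℝ (cosphereTangent F y ξ),
    IsHessian (cosphere F y) (φ (c 1) y) ξ (cosphereTangent F y ξ) H ∧
      ∀ ζ, H ζ ≤ -(κ / 4 * ℓ * ‖ζ‖ ^ 2) := by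
  obtain ⟨H, hH, hq⟩ := hφ.exists_isHessian hy hW (hc₀ ▸ hc.mapsTo unitInterval.zero_mem) hF hξ hc
    hc₀ hB (hφ.abs_mul_shortRate_lt hy hW hF hB hn hξ hc hc₀ hx)
  refine ⟨H, hH, fun ζ => ?_⟩
  obtain ⟨q, hq, hHq⟩ := hq ζ
  linarith [mul_le_mul_of_nonneg_left hq hℓ]

theorem exists_le_isHessian (hℓ : ℓ ≤ 0) : ∃ H : QuadraticForm ℝ (cosphereTangent F y ξ),
    IsHessian (cosphere F y) (φ (c 1) y) ξ (cosphereTangent F y ξ) H ∧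
      ∀ ζ, κ / 4 * -ℓ * ‖ζ‖ ^ 2 ≤ H ζ := by
  obtain ⟨H, hH, hq⟩ := hφ.exists_isHessian hy hW (hc₀ ▸ hc.mapsTo unitInterval.zero_mem) hF hξ hc
    hc₀ hB (hφ.abs_mul_shortRate_lt hy hW hF hB hn hξ hc hc₀ hx)
  refine ⟨H, hH, fun ζ => ?_⟩
  obtain ⟨q, hq, hHq⟩ := hq ζ
  linarith [mul_le_mul_of_nonneg_left hq (neg_nonneg.2 hℓ)]

end IsEikonalPhase

end SmallRadius

section Geodesics

variable {V W U U₀ : Set (Sp d)} {F : Sp d → Sp d → ℝ} {φ : Sp d → Sp d → Sp d → ℝ}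
  {c : ℝ → Sp d} {x y : Sp d}

theorem IsFinsler.exists_scale (hF : IsFinsler V F) (hV : IsOpen V)
    (hU₀b : Bornology.IsBounded U₀) (hU₀V : closure U₀ ⊆ V) :
    ∃ B κ : ℝ, 0 < κ ∧ ∃ K > 0, ∃ r > 0, ∀ U ⊆ U₀, Metric.diam U ≤ r → 0 < Metric.diam U →
      Metric.thickening (K * Metric.diam U) U ⊆ V ∧
      HamiltonianBounds F (Metric.thickening (K * Metric.diam U) U) B κ ∧
      ∀ y ∈ U, IsSmallRadius F (Metric.thickening (K * Metric.diam U) U) B y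
        ((1 + 4 * B ^ 2) * Metric.diam U) := by
  obtain ⟨δ, hδ, hδV⟩ := hU₀b.isCompact_closure.exists_cthickening_subset_open hV hU₀V
  rw [Metric.cthickening_closure] at hδV
  have hcompact : IsCompact (Metric.cthickening δ U₀) :=
    Metric.isCompact_of_isClosed_isBounded Metric.isClosed_cthickening hU₀b.cthickening
  obtain ⟨B, κ, hB⟩ := hF.exists_hamiltonianBounds hV hcompact hδV
  obtain ⟨ρ, hρ, hsmall⟩ :=
    hF.exists_isSmallRadius hV hcompact hδV (zero_lt_one.trans_le hB.one_le)
  have hA : 0 < 1 + 4 * B ^ 2 := by positivity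
  have hK : 0 < 2 * (1 + 4 * B ^ 2) + 1 := by positivity
  refine ⟨B, κ, hB.kappa_pos, _, hK, min (δ / (2 * (1 + 4 * B ^ 2) + 1)) (ρ / (1 + 4 * B ^ 2)),
    by positivity, fun U hUU₀ hdiam hpos => ?_⟩
  have hδ' := (le_div_iff₀' hK).1 (hdiam.trans (min_le_left _ _))
  have hρ' := (le_div_iff₀' hA).1 (hdiam.trans (min_le_right _ _))
  have hWδ : Metric.thickening ((2 * (1 + 4 * B ^ 2) + 1) * Metric.diam U) U ⊆
      Metric.cthickening δ U₀ :=
    (Metric.thickening_subset_cthickening _ _).trans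
      ((Metric.cthickening_subset_of_subset _ hUU₀).trans (Metric.cthickening_mono hδ' _))
  exact ⟨hWδ.trans hδV, hB.mono hWδ, fun y hy => hsmall _ hρ' _ hWδ y
    ((Metric.closedBall_subset_ball (by linarith)).trans (Metric.ball_subset_thickening hy _))⟩

theorem IsGeodesic.length_pos_of_isPath (hc : IsGeodesic F c) (hW : IsOpen W) (hF : IsFinsler W F)
    (hUW : U ⊆ W) (hpath : IsPath U x y c) (hxy : x ≠ y) : 0 < length F c :=
  hc.length_pos hW hF (hpath.mapsTo.mono_right hUW) (by rwa [hpath.source, hpath.target])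

section Endpoints

variable (hc : IsGeodesic F c) (hyx : y ≠ x) (hφ : IsEikonalPhase F W U φ) (hW : IsOpen W)
  (hF : IsFinsler W F) (hUW : U ⊆ W)
include hc hyx hφ hW hF hUW

section Source

variable (hpath : IsPath U y x c)
include hpath

theorem IsGeodesic.isCharacteristic_of_source :
    dual F y (legendre F y (unit F y (velocity c 0))) = 1 ∧
      IsCharacteristic F W (fun z => φ z y (legendre F y (unit F y (velocity c 0))))
        (length F c) c := by
  obtain ⟨-, hcU, rfl, rfl⟩ := hpath
  have hcW := hcU.mono_right hUW
  exact ⟨hc.dual_legendre_unit_velocity hW hF hcW hyx unitInterval.zero_mem,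
    hc.isCharacteristic hW hF hcW hyx unitInterval.zero_mem hφ (hcU unitInterval.zero_mem)⟩

theorem IsEikonalPhase.apply_of_isGeodesic_source :
    φ x y (legendre F y (unit F y (velocity c 0))) = length F c := by
  have hy : y ∈ U := hpath.source ▸ hpath.mapsTo unitInterval.zero_mem
  obtain ⟨hξ, hchar⟩ := hc.isCharacteristic_of_source hyx hφ hW hF hUW hpath
  simpa only [hpath.target] using hφ.apply_end_eq hy hW (hUW hy) hF hξ hchar hpath.source

end Source

section Target

variable (hpath : IsPath U x y c)
include hpath

theorem IsGeodesic.isCharacteristic_of_target :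
    dual F y (legendre F y (unit F y (velocity c 1))) = 1 ∧
      IsCharacteristic F W (fun z => φ z y (legendre F y (unit F y (velocity c 1))))
        (-length F c) fun t => c (1 - t) := by
  obtain ⟨-, hcU, rfl, rfl⟩ := hpath
  have hcW := hcU.mono_right hUW
  exact ⟨hc.dual_legendre_unit_velocity hW hF hcW hyx.symm unitInterval.one_mem,
    (hc.isCharacteristic hW hF hcW hyx.symm unitInterval.one_mem hφ
      (hcU unitInterval.one_mem)).reverse⟩

theorem IsEikonalPhase.apply_of_isGeodesic_target :
    φ x y (legendre F y (unit F y (velocity c 1))) = -length F c := by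
  have hy : y ∈ U := hpath.target ▸ hpath.mapsTo unitInterval.one_mem
  obtain ⟨hξ, hchar⟩ := hc.isCharacteristic_of_target hyx hφ hW hF hUW hpath
  simpa [hpath.source] using
    hφ.apply_end_eq hy hW (hUW hy) hF hξ hchar (by simpa using hpath.target)

end Target

end Endpoints

namespace IsEikonalPhase

variable {cp cm : ℝ → Sp d} {B κ n₀ : ℝ} (hφ : IsEikonalPhase F W U φ) (hW : IsOpen W)
  (hF : IsFinsler W F) (hUW : U ⊆ W) (hB : HamiltonianBounds F W B κ)
  (hn : IsSmallRadius F W B y n₀) (hx : (1 + 4 * B ^ 2) * ‖x - y‖ ≤ n₀) (hyx : y ≠ x)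
include hφ hW hF hUW hB hn hx hyx

theorem exists_isHessian_of_isGeodesic_source (hc : IsGeodesic F c) (hpath : IsPath U y x c) :
    ∃ H : QuadraticForm ℝ (cosphereTangent F y (legendre F y (unit F y (velocity c 0)))),
      IsHessian (cosphere F y) (φ x y) (legendre F y (unit F y (velocity c 0)))
        (cosphereTangent F y (legendre F y (unit F y (velocity c 0)))) H ∧
      ∀ ζ, H ζ ≤ -(κ / 4 * length F c * ‖ζ‖ ^ 2) := by
  have hy : y ∈ U := hpath.source ▸ hpath.mapsTo unitInterval.zero_mem
  obtain ⟨hξ, hchar⟩ := hc.isCharacteristic_of_source hyx hφ hW hF hUW hpath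
  have hlength := hc.length_pos_of_isPath hW hF hUW hpath hyx
  simpa only [hpath.target] using hφ.exists_isHessian_le hy hW hF hB hn hξ hchar hpath.source
    (by rwa [hpath.target]) hlength.le

theorem exists_isHessian_of_isGeodesic_target (hc : IsGeodesic F c) (hpath : IsPath U x y c) :
    ∃ H : QuadraticForm ℝ (cosphereTangent F y (legendre F y (unit F y (velocity c 1)))),
      IsHessian (cosphere F y) (φ x y) (legendre F y (unit F y (velocity c 1)))
        (cosphereTangent F y (legendre F y (unit F y (velocity c 1)))) H ∧
      ∀ ζ, κ / 4 * length F c * ‖ζ‖ ^ 2 ≤ H ζ := by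
  have hy : y ∈ U := hpath.target ▸ hpath.mapsTo unitInterval.one_mem
  obtain ⟨hξ, hchar⟩ := hc.isCharacteristic_of_target hyx hφ hW hF hUW hpath
  have hlength := hc.length_pos_of_isPath hW hF hUW hpath hyx.symm
  simpa only [sub_self, hpath.source, neg_neg] using
    hφ.exists_le_isHessian hy hW hF hB hn hξ hchar (by simpa using hpath.target)
      (by simpa [hpath.source] using hx) (neg_nonpos.2 hlength.le)

theorem setOf_isCritical_eq_of_isGeodesic (hcp : IsGeodesic F cp) (hpathp : IsPath U y x cp)
    (hcm : IsGeodesic F cm) (hpathm : IsPath U x y cm) :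
    {ξ | IsCritical (cosphere F y) (φ x y) ξ} =
      {legendre F y (unit F y (velocity cp 0)), legendre F y (unit F y (velocity cm 1))} := by
  have hy : y ∈ U := hpathp.source ▸ hpathp.mapsTo unitInterval.zero_mem
  obtain ⟨hξp, hp⟩ := hcp.isCharacteristic_of_source hyx hφ hW hF hUW hpathp
  obtain ⟨hξm, hm⟩ := hcm.isCharacteristic_of_target hyx hφ hW hF hUW hpathm
  exact hφ.setOf_isCritical_eq hy hW hF hB hn hx hξp hξm hp hm hpathp.source
    (by simpa using hpathm.target) hpathp.target (by simpa using hpathm.source)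
    (hcp.length_pos_of_isPath hW hF hUW hpathp hyx)
    (neg_neg_of_pos (hcm.length_pos_of_isPath hW hF hUW hpathm hyx.symm))

end IsEikonalPhase

end Geodesics

end Finsler

end

theorem mainTheorem7_general (d : ℕ) (U₀ V : Set (Finsler.Sp d))
    (F : Finsler.Sp d → Finsler.Sp d → ℝ) (hU₀b : Bornology.IsBounded U₀) (hV : IsOpen V)
    (hU₀V : closure U₀ ⊆ V) (hF : Finsler.IsFinsler V F) :
    ∃ K > (0 : ℝ), ∃ r > (0 : ℝ), ∃ C > (0 : ℝ),
      ∀ U : Set (Finsler.Sp d), U ⊆ U₀ → Metric.diam U ≤ r →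
      ∀ φ : Finsler.Sp d → Finsler.Sp d → Finsler.Sp d → ℝ,
      Finsler.IsEikonalPhase F (Metric.thickening (K * Metric.diam U) U) U φ →
      ∀ x₀ ∈ U, ∀ x₁ ∈ U, x₀ ≠ x₁ →
      ∀ cp cm : ℝ → Finsler.Sp d,
      Finsler.IsGeodesic F cp → Finsler.IsPath U x₀ x₁ cp →
      Finsler.IsGeodesic F cm → Finsler.IsPath U x₁ x₀ cm →
      ∀ ξp ξm : Finsler.Sp d,
      ξp = Finsler.legendre F x₀ (Finsler.unit F x₀ (Finsler.velocity cp 0)) →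
      ξm = Finsler.legendre F x₀ (Finsler.unit F x₀ (Finsler.velocity cm 1)) →
        ξp ≠ ξm ∧
        {ξ | Finsler.IsCritical (Finsler.cosphere F x₀) (φ x₁ x₀) ξ} = {ξp, ξm} ∧
        φ x₁ x₀ ξp = Finsler.length F cp ∧
        φ x₁ x₀ ξm = -Finsler.length F cm ∧
        (∃ H : QuadraticForm ℝ (Finsler.cosphereTangent F x₀ ξp),
          Finsler.IsHessian (Finsler.cosphere F x₀) (φ x₁ x₀) ξp
            (Finsler.cosphereTangent F x₀ ξp) H ∧
          ∀ ζ, H ζ ≤ -(C * Finsler.length F cp * ‖ζ‖ ^ 2)) ∧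
        (∃ H : QuadraticForm ℝ (Finsler.cosphereTangent F x₀ ξm),
          Finsler.IsHessian (Finsler.cosphere F x₀) (φ x₁ x₀) ξm
            (Finsler.cosphereTangent F x₀ ξm) H ∧
          ∀ ζ, C * Finsler.length F cm * ‖ζ‖ ^ 2 ≤ H ζ) := by
  obtain ⟨B, κ, hκ, K, hK, r, hr, hscale⟩ := hF.exists_scale hV hU₀b hU₀V
  refine ⟨K, hK, r, hr, κ / 4, by positivity, ?_⟩
  rintro U hUU₀ hdiam φ hφ x₀ hx₀ x₁ hx₁ hne cp cm hcp hpathp hcm hpathm _ _ rfl rfl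
  have hdist : dist x₁ x₀ ≤ Metric.diam U :=
    Metric.dist_le_diam_of_mem (hU₀b.subset hUU₀) hx₁ hx₀
  have hpos : 0 < Metric.diam U := (dist_pos.2 hne.symm).trans_le hdist
  obtain ⟨hWV, hB, hn⟩ := hscale U hUU₀ hdiam hpos
  have hW : IsOpen (Metric.thickening (K * Metric.diam U) U) := Metric.isOpen_thickening
  have hUW := Metric.self_subset_thickening (mul_pos hK hpos) U
  have hFW := hF.mono hWV
  have hx : (1 + 4 * B ^ 2) * ‖x₁ - x₀‖ ≤ (1 + 4 * B ^ 2) * Metric.diam U := by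
    rw [← dist_eq_norm]
    gcongr
  have hp := hφ.apply_of_isGeodesic_source hcp hne hW hFW hUW hpathp
  have hm := hφ.apply_of_isGeodesic_target hcm hne hW hFW hUW hpathm
  refine ⟨fun heq => ?_,
    hφ.setOf_isCritical_eq_of_isGeodesic hW hFW hUW hB (hn x₀ hx₀) hx hne hcp hpathp hcm hpathm,
    hp, hm,
    hφ.exists_isHessian_of_isGeodesic_source hW hFW hUW hB (hn x₀ hx₀) hx hne hcp hpathp,
    hφ.exists_isHessian_of_isGeodesic_target hW hFW hUW hB (hn x₀ hx₀) hx hne hcm hpathm⟩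
  have hLp := hcp.length_pos_of_isPath hW hFW hUW hpathp hne
  have hLm := hcm.length_pos_of_isPath hW hFW hUW hpathm hne.symm
  rw [heq, hm] at hp
  linarith

theorem mainTheorem7 (d : ℕ) (U₀ V : Set (Finsler.Sp d)) (F : Finsler.Sp d → Finsler.Sp d → ℝ)
    (hU₀ : IsOpen U₀) (hU₀b : Bornology.IsBounded U₀)
    (hV : IsOpen V) (hU₀V : closure U₀ ⊆ V) (hF : Finsler.IsFinsler V F) :
    ∃ K > (0 : ℝ), ∃ r > (0 : ℝ), ∃ C > (0 : ℝ),
      ∀ U : Set (Finsler.Sp d), IsOpen U → U ⊆ U₀ → Metric.diam U ≤ r →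
      Finsler.GeodesicallyConvex F U₀ U →
      ∀ φ : Finsler.Sp d → Finsler.Sp d → Finsler.Sp d → ℝ,
      Finsler.IsEikonalPhase F (Metric.thickening (K * Metric.diam U) U) U φ →
      ∀ x₀ ∈ U, ∀ x₁ ∈ U, x₀ ≠ x₁ →
      -- the forward geodesics from `x₀` to `x₁` and from `x₁` to `x₀`
      ∀ cp cm : ℝ → Finsler.Sp d,
      Finsler.IsMinimizingGeodesic F U₀ U x₀ x₁ cp →
      Finsler.IsMinimizingGeodesic F U₀ U x₁ x₀ cm →
      ∀ ξp ξm : Finsler.Sp d,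
      -- `ξp` and `ξm` are dual to the unit tangent vectors of these geodesics at `x₀`
      ξp = Finsler.legendre F x₀ (Finsler.unit F x₀ (Finsler.velocity cp 0)) →
      ξm = Finsler.legendre F x₀ (Finsler.unit F x₀ (Finsler.velocity cm 1)) →
      ∀ Ψ : Finsler.Sp d → ℝ, Ψ = (fun ξ => φ x₁ x₀ ξ) →
        ξp ≠ ξm ∧
        {ξ | Finsler.IsCritical (Finsler.cosphere F x₀) Ψ ξ} = {ξp, ξm} ∧
        Ψ ξp = Finsler.dPlus F U₀ x₀ x₁ ∧
        Ψ ξm = -Finsler.dMinus F U₀ x₀ x₁ ∧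
        (∃ H : QuadraticForm ℝ (Finsler.cosphereTangent F x₀ ξp),
          Finsler.IsHessian (Finsler.cosphere F x₀) Ψ ξp (Finsler.cosphereTangent F x₀ ξp) H ∧
          ∀ ζ, H ζ ≤ -(C * Finsler.dPlus F U₀ x₀ x₁ * ‖ζ‖ ^ 2)) ∧
        (∃ H : QuadraticForm ℝ (Finsler.cosphereTangent F x₀ ξm),
          Finsler.IsHessian (Finsler.cosphere F x₀) Ψ ξm (Finsler.cosphereTangent F x₀ ξm) H ∧
          ∀ ζ, C * Finsler.dMinus F U₀ x₀ x₁ * ‖ζ‖ ^ 2 ≤ H ζ) := by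
  obtain ⟨K, hK, r, hr, C, hC, h⟩ := mainTheorem7_general d U₀ V F hU₀b hV hU₀V hF
  refine ⟨K, hK, r, hr, C, hC, fun U _ hUU₀ hdiam _ φ hφ x₀ hx₀ x₁ hx₁ hne cp cm hcp hcm ξp ξm
    hξp hξm Ψ hΨ => ?_⟩
  rw [Finsler.dMinus, ← hcp.minimizing, ← hcm.minimizing, hΨ]
  exact h U hUU₀ hdiam φ hφ x₀ hx₀ x₁ hx₁ hne cp cm hcp.geodesic hcp.path hcm.geodesic hcm.path
    ξp ξm hξp hξm
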